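/- **Setting.** Let $\mathcal X,\mathcal Y$ be finite sets, $P_{X,Y}$ a distribution on $\mathcal X\times\mathcal Y$, $0<R<1$, $p_e:\mathcal X\to[0,1]$, $p_d:\mathcal Y\to[0,1]$, and let $P_Q$ be a finitely supported distribution on $[0,1]$ that is symmetric about $1/2$. Logarithms are to base $2$, $H_b(\phi,\psi)=-\phi\log\psi-(1-\phi)\log(1-\psi)\in[0,\infty]$ (with $0\cdot\infty=0$), and $H$ denotes (conditional) entropy. For $\mathbf q\in[0,1]^n$, $\mathbf u\in\mathbb F_2^n$ put $w_{\mathbf q}(\mathbf u)=\prod_{i}q_i^{u_i}(1-q_i)^{1-u_i}$ (with $0^0=1$), and for an invertible $\mathbf H\in\mathbb F_2^{n\times n}$ let $f_{\mathbf H}(\mathbf p,\mathbf q)$ be a maximizer of $w_{\mathbf p}(\mathbf z)\,w_{\mathbf q}(\mathbf z\mathbf H^T)$ over $\mathbf z\in\mathbb F_2^n$, ties being broken by an arbitrary fixed rule (a function of $n,\mathbf H,\mathbf p,\mathbf q$). **Code.** For block length $n$ let $k=\lfloor nR\rfloor$. Let $\mathbf H$ be uniform over the invertible matrices in $\mathbb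 F_2^{n\times n}$, $(x_i,y_i)_{i\le n}$ i.i.d. $\sim P_{X,Y}$ and $\mathbf q=[q_1,\dots,q_{n-k}]$ i.i.d. $\sim P_Q$, all independent. The encoder computes $\mathbf z=f_{\mathbf H}\big([p_e(x_1),\dots,p_e(x_n)],[\tfrac12\mathbf 1^k,\mathbf q]\big)$ and sends $\mathbf m$, the first $k$ entries of $\mathbf z\mathbf H^T$. The decoder outputs $\hat{\mathbf z}=f_{\mathbf H}\big([p_d(y_1),\dots,p_d(y_n)],[\mathbf m,\mathbf q]\big)$. **Theorem.** Let $(X,Y)\sim P_{X,Y}$ and $Q\sim P_Q$; let $Z,V$ be bits with conditional laws $P_{Z|X}$, $P_{V|Q}$, with $Z$ conditionally independent of $Y$ given $X$. Suppose that $(P_{Z|X},P_{V|Q})$ is the unique minimizer (up to values of $X$, $Q$ of probability zero) of $$\mathbf E[H_b(Z,p_e(X))]+(1-R)\,\mathbf E[H_b(V,Q)]\quad\text{subject to}\quad H(Z|X)+(1-R)H(V|Q)\ge 1-R .$$ Suppose also that for all $P_{\tilde Z|Y},P_{\tilde V|Q}$ (conditional laws of bits) with $H(\tilde Z|Y)+(1-R)H(\tilde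 V|Q)\ge1$, $$\mathbf E[H_b(\tilde Z,p_d(Y))]+(1-R)\mathbf E[H_b(\tilde V,Q)]>\mathbf E[H_b(Z,p_d(Y))]+(1-R)\mathbf E[H_b(V,Q)].$$ Exclude two exact coincidences, that is, suppose that 1. if $\mathbf P(0<p_e(X)<1)+(1-R)\mathbf P(0<Q<1)=1-R$, then $\mathbf P(0<Q<1)=1$; 2. if $\mathbf P(p_e(X)=\tfrac12)+(1-R)\mathbf P(Q=\tfrac12)=1-R$, then either $\mathbf P(Q=\tfrac12)=1$, or $p_e(x)=p_d(y)$ for all $(x,y)$ with $P_{X,Y}(x,y)>0$ and $p_d(y)\in\{0,1\}$. Then, as $n\to\infty$, the empirical joint distribution of $(x_i,\hat z_i)_{i=1,\dots,n}$ tends to $P_XP_{Z|X}$ in probability. -/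

import Mathlib

open Filter Topology
open scoped ENNReal unitInterval Matrix MatrixGroups

noncomputable section

namespace WPC

/-! ### Finite probability -/

/-- The law of `n` independent samples of `p`. -/
def iid {α : Type*} (p : PMF α) : (n : ℕ) → PMF (Fin n → α)
  | 0 => PMF.pure Fin.elim0
  | n + 1 => p.bind fun a => (iid p n).bind fun v => PMF.pure (Fin.cons a v)

/-- The expectation of a function with values in `[0, ∞]`. -/
def expect {α : Type*} (p : PMF α) (f : α → ℝ≥0∞) : ℝ≥0∞ := ∑' a, p a * f a

/-- The probability that a `Bern(r)` bit equals `b`. -/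
def bern (r : I) (b : ZMod 2) : I := if b = 1 then r else σ r

/-- The point `1/2` of `[0, 1]`. -/
def half : I := ⟨1 / 2, by norm_num, by norm_num⟩

/-- A bit, read as an element of `[0, 1]`. -/
def bitVal (b : ZMod 2) : I := if b = 1 then 1 else 0

/-! ### Entropies, in bits -/

/-- `-log₂ t`, with the value `∞` at `t = 0`. -/
def negLog (t : I) : ℝ≥0∞ := if t = 0 then ∞ else ENNReal.ofReal (-Real.logb 2 t)

/-- The binary cross entropy `-φ log₂ ψ - (1 - φ) log₂ (1 - ψ)`, with values in `[0, ∞]` and the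
convention `0 · ∞ = 0`. -/
def crossEntropy (φ ψ : I) : ℝ≥0∞ :=
  ENNReal.ofReal φ * negLog ψ + ENNReal.ofReal (σ φ : I) * negLog (σ ψ)

/-- The conditional entropy, in bits, of a bit `B` given `A ∼ p`, where `κ a = P(B = 1 | A = a)`. -/
def condEntropy {α : Type*} (p : PMF α) (κ : α → I) : ℝ≥0∞ :=
  expect p fun a => ENNReal.ofReal (Real.binEntropy (κ a) / Real.log 2)

/-- `E[H_b(B, g(A))]`, where `A ∼ p` and `B` is a bit with `κ a = P(B = 1 | A = a)`. -/
def expCross {α : Type*} (p : PMF α) (κ g : α → I) : ℝ≥0∞ :=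
  expect p fun a => ∑ b : ZMod 2, ENNReal.ofReal (bern (κ a) b) * crossEntropy (bitVal b) (g a)

/-! ### The code

Conditional laws of bits are given by the conditional probability of the value `1`. -/

/-- The `q`-weight of a binary vector `u`. -/
def weight {n : ℕ} (q : Fin n → I) (u : Fin n → ZMod 2) : ℝ := ∏ i, (bern (q i) (u i) : ℝ)

/-- `f` is a query function: for every full-rank parity check matrix `H`, codeword bias `p` and
parity bias `q`, the vector `f n H p q` maximizes `w_p(z) w_q(z Hᵀ)` over all binary vectors `z`.
Ties are broken in an arbitrary way. -/
def IsQuery (f : (n : ℕ) → GL (Fin n) (ZMod 2) → (Fin n → I) → (Fin n → I) → Fin n → ZMod 2) :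
    Prop :=
  ∀ (n : ℕ) (H : GL (Fin n) (ZMod 2)) (p q : Fin n → I) (z : Fin n → ZMod 2),
    weight p z * weight q (z ᵥ* (H : Matrix (Fin n) (Fin n) (ZMod 2))ᵀ) ≤
      weight p (f n H p q) *
        weight q (f n H p q ᵥ* (H : Matrix (Fin n) (Fin n) (ZMod 2))ᵀ)

section code

variable {X Y : Type*}
  (f : (n : ℕ) → GL (Fin n) (ZMod 2) → (Fin n → I) → (Fin n → I) → Fin n → ZMod 2)
  (pe : X → I) (pd : Y → I) {k l : ℕ}

/-- The vector chosen by the encoder, for a message of `k` bits and block length `k + l`. -/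
def encWord (H : GL (Fin (k + l)) (ZMod 2)) (q : Fin l → I) (x : Fin (k + l) → X) :
    Fin (k + l) → ZMod 2 :=
  f (k + l) H (fun i => pe (x i)) (Fin.append (fun _ : Fin k => half) q)

/-- The message: the first `k` bits of `z Hᵀ`, where `z` is the vector chosen by the encoder. -/
def message (H : GL (Fin (k + l)) (ZMod 2)) (q : Fin l → I) (x : Fin (k + l) → X) :
    Fin k → ZMod 2 :=
  fun i => (encWord f pe H q x ᵥ* (H : Matrix (Fin (k + l)) (Fin (k + l)) (ZMod 2))ᵀ)
    (Fin.castAdd l i)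

/-- The reconstruction of the decoder from the message `m` and the side information `y`. -/
def decWord (H : GL (Fin (k + l)) (ZMod 2)) (q : Fin l → I) (m : Fin k → ZMod 2)
    (y : Fin (k + l) → Y) : Fin (k + l) → ZMod 2 :=
  f (k + l) H (fun i => pd (y i)) (Fin.append (fun i => bitVal (m i)) q)

/-- The joint law of the matrix `H` (uniform over the full-rank matrices), of the source
sequence `(x, y)` (i.i.d. `∼ P`) and of the parity biases `q` (i.i.d. `∼ PQ`), which are
independent. -/
def sampleLaw (P : PMF (X × Y)) (PQ : PMF I) (k l : ℕ) :
    PMF (GL (Fin (k + l)) (ZMod 2) × (Fin (k + l) → X × Y) × (Fin l → I)) :=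
  (PMF.uniformOfFintype (GL (Fin (k + l)) (ZMod 2))).bind fun H =>
    (iid P (k + l)).bind fun s => (iid PQ l).bind fun q => PMF.pure (H, s, q)

open Classical in
/-- The empirical distribution of the pairs `(x i, z i)`. -/
def empirical {n : ℕ} (x : Fin n → X) (z : Fin n → ZMod 2) (a : X) (b : ZMod 2) : ℝ :=
  ((Finset.univ.filter fun i => x i = a ∧ z i = b).card : ℝ) / n

/-- The event that the empirical distribution of the source symbols `x i` and the decoder
outputs differs by at least `ε`, in some entry, from the law of `(A, B)` with `A ∼ PX` and
`κ a = P(B = 1 | A = a)`. -/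
def deviation (PX : PMF X) (κ : X → I) (ε : ℝ) :
    Set (GL (Fin (k + l)) (ZMod 2) × (Fin (k + l) → X × Y) × (Fin l → I)) :=
  {ω | ∃ (a : X) (b : ZMod 2),
    ε ≤ |empirical (fun i => (ω.2.1 i).1)
          (decWord f pd ω.1 ω.2.2 (message f pe ω.1 ω.2.2 fun i => (ω.2.1 i).1)
            fun i => (ω.2.1 i).2) a b
        - (PX a).toReal * bern (κ a) b|}

end code

/-! ### The optimization problem of the encoder -/

section optimization

variable {X : Type*} (PX : PMF X) (PQ : PMF I) (pe : X → I) (R : ℝ)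

/-- The constraint `H(Z|X) + (1-R) H(V|Q) ≥ 1 - R`. -/
def EncFeasible (κ : X → I) (ν : I → I) : Prop :=
  ENNReal.ofReal (1 - R) ≤ condEntropy PX κ + ENNReal.ofReal (1 - R) * condEntropy PQ ν

/-- The objective `E[H_b(Z, p_e(X))] + (1-R) E[H_b(V, Q)]`. -/
def encCost (κ : X → I) (ν : I → I) : ℝ≥0∞ :=
  expCross PX κ pe + ENNReal.ofReal (1 - R) * expCross PQ ν id

/-- `(κ, ν)` minimizes the objective under the constraint. -/
def IsEncMin (κ : X → I) (ν : I → I) : Prop :=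
  EncFeasible PX PQ R κ ν ∧
    ∀ κ' ν', EncFeasible PX PQ R κ' ν' → encCost PX PQ pe R κ ν ≤ encCost PX PQ pe R κ' ν'

/-- `(κ, ν)` is the unique minimizer; conditional laws are identified when they agree at all
values of positive probability of the conditioning variable. -/
def IsUniqueEncMin (κ : X → I) (ν : I → I) : Prop :=
  IsEncMin PX PQ pe R κ ν ∧
    ∀ κ' ν', IsEncMin PX PQ pe R κ' ν' →
      (∀ a ∈ PX.support, κ' a = κ a) ∧ (∀ q ∈ PQ.support, ν' q = ν q)

end optimization

end WPC

end

open scoped NNReal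

noncomputable section

namespace WPC

/-! ### Images of vectors under a random invertible matrix over `𝔽₂` -/

section GLcount

variable {n : ℕ}

/-! Attach to a vector z its word: the n bits of z followed by its l ≈ n(1-R) parity bits. After
taking `-log₂`, the encoder minimizes the cost of the word, since message bits of bias 1/2 cost
exactly one bit each. The decoder minimizes its own cost among the vectors that have the received
message bits, provided one of them has finite cost.

For z ≠ 0 the image under the random matrix is uniform over the nonzero vectors, and for distinct
nonzero z, z' the pair of images is uniform over the pairs of distinct nonzero vectors. Hence about
|U| 2^(-n(1-R)) words are expected in a set U of sequences, and about |U| |U'| 2^(-n(2-R)) pairs of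
words in U × U' with equal message bits. Such sets are counted by types (`exists_card_le`,
`exists_le_card`): about 2^(n · entropy) sequences share a type, and there are only polynomially
many types. Compactness and lower semicontinuity of the cost turn strict inequalities into
exponential margins (`exists_gap`).

Let C be the minimum of the encoder's problem. A second moment bound yields a word of cost at most
n(C + δ) (`eventually_exists_cost_le`). A first moment bound shows that all such words have a source
type close to the minimizer (`eventually_type_near`). Given the source, the matrix and the parity
biases, the side information is still conditionally independent across positions. So the decoder's
cost of the encoder's vector concentrates around the right-hand side of the decoder inequality
(`eventually_decoder_dev_le`, `decoder_cost_le`). By `eventually_unique_le` no other vector with the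
same message is as cheap for the decoder, so it recovers the encoder's vector, whose type is already
known.

Infinite costs produce the two excluded coincidences. The second moment needs slightly more entropy
than 1-R at finite cost. If biases in (0,1) supply exactly 1-R, the first exclusion leaves
deterministic source biases, and symmetry of the parity biases makes the cost concentrate
(`measure_parity_cost_le`). The second exclusion ensures that the encoder never selects a bit ruled
out by a deterministic decoder bias (`bitCost_encWord_ne_top`). -/

theorem exists_GL_of_linearEquiv (g : (Fin n → ZMod 2) ≃ₗ[ZMod 2] (Fin n → ZMod 2)) :
    ∃ G : GL (Fin n) (ZMod 2), ∀ z, (G : Matrix (Fin n) (Fin n) (ZMod 2)) *ᵥ z = g z := by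
  refine ⟨⟨LinearMap.toMatrix' g.toLinearMap, LinearMap.toMatrix' g.symm.toLinearMap, ?_, ?_⟩,
    fun z => LinearMap.toMatrix'_mulVec _ _⟩
  · rw [← LinearMap.toMatrix'_comp]; simp
  · rw [← LinearMap.toMatrix'_comp]; simp

theorem eq_of_mk_eq {v w : Fin n → ZMod 2} (hv : v ≠ 0) (hw : w ≠ 0)
    (h : Projectivization.mk (ZMod 2) v hv = Projectivization.mk (ZMod 2) w hw) : v = w := by
  rw [Projectivization.mk_eq_mk_iff] at h
  obtain ⟨a, ha⟩ := h
  have : a = 1 := Subsingleton.elim _ _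
  rw [← ha, this, one_smul]

/-- The only nonzero scalar of 𝔽₂ is 1, so nonzero vectors are the points of projective space, on
which the linear group acts 2-transitively. -/
theorem exists_GL_pair {z z' w w' : Fin n → ZMod 2} (hz : z ≠ 0) (hz' : z' ≠ 0) (hne : z ≠ z')
    (hw : w ≠ 0) (hw' : w' ≠ 0) (hne' : w ≠ w') :
    ∃ G : GL (Fin n) (ZMod 2), (G : Matrix (Fin n) (Fin n) (ZMod 2)) *ᵥ z = w ∧
      (G : Matrix (Fin n) (Fin n) (ZMod 2)) *ᵥ z' = w' := by
  have h := Projectivization.linearEquiv_is_two_pretransitive (ZMod 2) (Fin n → ZMod 2)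
  rw [MulAction.is_two_pretransitive_iff] at h
  obtain ⟨g, h1, h2⟩ := h (a := .mk (ZMod 2) z hz) (b := .mk (ZMod 2) z' hz')
    (c := .mk (ZMod 2) w hw) (d := .mk (ZMod 2) w' hw')
    (fun h => hne (eq_of_mk_eq _ _ h)) (fun h => hne' (eq_of_mk_eq _ _ h))
  rw [Projectivization.smul_mk] at h1 h2
  obtain ⟨G, hG⟩ := exists_GL_of_linearEquiv g
  exact ⟨G, by rw [hG]; exact eq_of_mk_eq _ hw h1, by rw [hG]; exact eq_of_mk_eq _ hw' h2⟩

theorem exists_GL {w w' : Fin n → ZMod 2} (hw : w ≠ 0) (hw' : w' ≠ 0) :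
    ∃ G : GL (Fin n) (ZMod 2), (G : Matrix (Fin n) (Fin n) (ZMod 2)) *ᵥ w = w' := by
  have h := Projectivization.linearEquiv_is_two_pretransitive (ZMod 2) (Fin n → ZMod 2)
  have h' : MulAction.IsPretransitive ((Fin n → ZMod 2) ≃ₗ[ZMod 2] (Fin n → ZMod 2))
    (Projectivization (ZMod 2) (Fin n → ZMod 2)) := MulAction.isPretransitive_of_is_two_pretransitive
  obtain ⟨g, h1⟩ := h'.exists_smul_eq (.mk (ZMod 2) w hw) (.mk (ZMod 2) w' hw')
  rw [Projectivization.smul_mk] at h1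
  obtain ⟨G, hG⟩ := exists_GL_of_linearEquiv g
  exact ⟨G, by rw [hG]; exact eq_of_mk_eq _ hw' h1⟩

theorem mulVec_ne_zero (H : GL (Fin n) (ZMod 2)) {z : Fin n → ZMod 2} (hz : z ≠ 0) :
    (H : Matrix (Fin n) (Fin n) (ZMod 2)) *ᵥ z ≠ 0 := fun h => hz <| by
  have := congrArg (fun v => ((H⁻¹ : GL (Fin n) (ZMod 2)) : Matrix (Fin n) (Fin n) (ZMod 2)) *ᵥ v) h
  simpa [Matrix.mulVec_mulVec, ← Units.val_mul] using this

theorem mulVec_injective (H : GL (Fin n) (ZMod 2)) :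
    Function.Injective fun z => (H : Matrix (Fin n) (Fin n) (ZMod 2)) *ᵥ z := fun z z' h => by
  have := congrArg (fun v => ((H⁻¹ : GL (Fin n) (ZMod 2)) : Matrix (Fin n) (Fin n) (ZMod 2)) *ᵥ v) h
  simpa [Matrix.mulVec_mulVec, ← Units.val_mul] using this

/-- The number of invertible matrices that send `z` to `w` and `z'` to `w'`. -/
def pairCount (z w z' w' : Fin n → ZMod 2) : ℕ :=
  (Finset.univ.filter fun H : GL (Fin n) (ZMod 2) =>
    (H : Matrix (Fin n) (Fin n) (ZMod 2)) *ᵥ z = w ∧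
      (H : Matrix (Fin n) (Fin n) (ZMod 2)) *ᵥ z' = w').card

/-- Left multiplication by G is a bijection between the two sets of matrices. This makes all
admissible images equally likely. -/
theorem pairCount_mulVec (G : GL (Fin n) (ZMod 2)) (z w z' w' : Fin n → ZMod 2) :
    pairCount z w z' w' = pairCount z ((G : Matrix (Fin n) (Fin n) (ZMod 2)) *ᵥ w) z'
      ((G : Matrix (Fin n) (Fin n) (ZMod 2)) *ᵥ w') := by
  refine Finset.card_bij (fun H _ => G * H) ?_ (fun _ _ _ _ h => mul_left_cancel h) ?_
  · intro H hH
    simp only [Finset.mem_filter, Finset.mem_univ, true_and] at hH ⊢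
    simp [← Matrix.mulVec_mulVec, hH.1, hH.2]
  · intro H hH
    simp only [Finset.mem_filter, Finset.mem_univ, true_and] at hH
    refine ⟨G⁻¹ * H, ?_, by simp⟩
    simp only [Finset.mem_filter, Finset.mem_univ, true_and, Units.val_mul,
      ← Matrix.mulVec_mulVec, hH.1, hH.2]
    simp [Matrix.mulVec_mulVec]

theorem card_ne_zero : (Finset.univ.filter fun w : Fin n → ZMod 2 => w ≠ 0).card = 2 ^ n - 1 := by
  rw [Finset.filter_ne', Finset.card_erase_of_mem (Finset.mem_univ _), Finset.card_univ]
  simp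

/-- The counts for the different nonzero images of z agree by transitivity, and they add up to the
order of the group. -/
theorem pairCount_self {z w : Fin n → ZMod 2} (hz : z ≠ 0) (hw : w ≠ 0) :
    pairCount z w z w * (2 ^ n - 1) = Fintype.card (GL (Fin n) (ZMod 2)) := by
  have h1 : ∑ w' ∈ Finset.univ.filter (fun w : Fin n → ZMod 2 => w ≠ 0), pairCount z w' z w' =
      Fintype.card (GL (Fin n) (ZMod 2)) := by
    simp only [pairCount, and_self]
    rw [← Finset.card_eq_sum_card_fiberwise]
    · rw [Finset.card_univ]
    · intro H _
      simpa using mulVec_ne_zero H hz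
  rw [← h1, Finset.sum_congr rfl (g := fun _ => pairCount z w z w), Finset.sum_const, card_ne_zero,
    smul_eq_mul, mul_comm]
  intro w' hw'
  obtain ⟨G, hG⟩ := exists_GL hw (by simpa using hw' : w' ≠ 0)
  rw [pairCount_mulVec G z w z w, hG]

/-- Among the matrices with z ↦ w, the image of z' ranges over the 2^n - 2 nonzero vectors other
than w, all equally often. The remaining values of w' are impossible, which leaves an inequality. -/
theorem pairCount_of_ne {z z' w w' : Fin n → ZMod 2} (hz' : z' ≠ 0) (hne : z ≠ z')
    (hw : w ≠ 0) :
    pairCount z w z' w' * (2 ^ n - 2) ≤ pairCount z w z w := by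
  by_cases hw' : w' = 0
  · have : pairCount z w z' w' = 0 := by
      simp only [pairCount, Finset.card_eq_zero, Finset.filter_eq_empty_iff]
      rintro H - ⟨-, h⟩
      exact mulVec_ne_zero H hz' (h.trans hw')
    simp [this]
  by_cases hww : w = w'
  · have : pairCount z w z' w' = 0 := by
      simp only [pairCount, Finset.card_eq_zero, Finset.filter_eq_empty_iff]
      rintro H - ⟨h1, h⟩
      exact hne (mulVec_injective H (h1.trans (hww.trans h.symm)))
    simp [this]
  have h1 : ∑ v ∈ (Finset.univ.filter (fun w : Fin n → ZMod 2 => w ≠ 0)).erase w,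
      pairCount z w z' v = pairCount z w z w := by
    simp only [pairCount, and_self]
    rw [Finset.card_eq_sum_card_fiberwise (f := fun H : GL (Fin n) (ZMod 2) =>
      (H : Matrix (Fin n) (Fin n) (ZMod 2)) *ᵥ z')
      (t := (Finset.univ.filter (fun w : Fin n → ZMod 2 => w ≠ 0)).erase w)]
    · simp [Finset.filter_filter]
    · intro H hH
      simp only [Finset.coe_filter, Finset.mem_univ, true_and, Set.mem_ofPred_eq] at hH
      simp only [Finset.coe_erase, Finset.coe_filter, Finset.mem_univ, true_and, Set.mem_sdiff,
        Set.mem_ofPred_eq, Set.mem_singleton_iff]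
      exact ⟨mulVec_ne_zero H hz', fun h => hne (mulVec_injective H (hH.trans h.symm))⟩
  rw [← h1, Finset.sum_congr rfl (g := fun _ => pairCount z w z' w'), Finset.sum_const,
    Finset.card_erase_of_mem (by simpa using hw), card_ne_zero, smul_eq_mul, mul_comm]
  · exact le_of_eq (by congr 1)
  · intro v hv
    simp only [Finset.mem_erase, Finset.mem_filter, Finset.mem_univ, true_and] at hv
    obtain ⟨G, hG, hG'⟩ := exists_GL_pair hw hw' hww hw hv.2 (Ne.symm hv.1)
    rw [pairCount_mulVec G z w z' w', hG, hG']

/-- The probability of an event under a uniformly chosen invertible matrix. -/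
def glProb (p : GL (Fin n) (ZMod 2) → Prop) [DecidablePred p] : ℝ :=
  ((Finset.univ.filter p).card : ℝ) / Fintype.card (GL (Fin n) (ZMod 2))

theorem card_GL_pos : (0 : ℝ) < Fintype.card (GL (Fin n) (ZMod 2)) := by
  exact_mod_cast Fintype.card_pos

theorem pairCount_self_div {z w : Fin n → ZMod 2} (hn : 1 ≤ n) (hz : z ≠ 0) (hw : w ≠ 0) :
    (pairCount z w z w : ℝ) / Fintype.card (GL (Fin n) (ZMod 2)) = 1 / (2 ^ n - 1) := by
  have h2 : (2 : ℝ) ^ n ≥ 2 := by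
    simpa using pow_le_pow_right₀ (by norm_num : (1 : ℝ) ≤ 2) hn
  rw [div_eq_div_iff card_GL_pos.ne' (by linarith), one_mul, ← pairCount_self hz hw]
  push_cast [Nat.one_le_two_pow]
  ring

theorem pairCount_of_ne_div {z z' w w' : Fin n → ZMod 2} (hn : 2 ≤ n) (hz : z ≠ 0) (hz' : z' ≠ 0)
    (hne : z ≠ z') (hw : w ≠ 0) :
    (pairCount z w z' w' : ℝ) / Fintype.card (GL (Fin n) (ZMod 2)) ≤
      1 / ((2 ^ n - 1) * (2 ^ n - 2)) := by
  have h4 : (2 : ℝ) ^ n ≥ 4 := by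
    have := pow_le_pow_right₀ (by norm_num : (1 : ℝ) ≤ 2) hn
    norm_num at this ⊢; exact this
  have h := pairCount_of_ne (w' := w') hz' hne hw
  have h5 : (pairCount z w z' w' : ℝ) * (2 ^ n - 2) ≤ pairCount z w z w := by
    have h6 : 2 ≤ 2 ^ n := by
      simpa using Nat.pow_le_pow_right (by norm_num : 0 < 2) (by omega : 1 ≤ n)
    have := (Nat.cast_le (α := ℝ)).2 h
    push_cast [h6] at this
    exact this
  have h7 := pairCount_self_div (by omega : 1 ≤ n) hz hw
  rw [div_eq_div_iff card_GL_pos.ne' (by linarith)] at h7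
  rw [div_le_div_iff₀ card_GL_pos (by nlinarith)]
  nlinarith

open Classical in
/-- Union bound over the images of one vector. -/
theorem glProb_exists_le (hn : 1 ≤ n) (T : Finset ((Fin n → ZMod 2) × (Fin n → ZMod 2)))
    (hT : ∀ t ∈ T, t.1 ≠ 0) :
    glProb (fun H : GL (Fin n) (ZMod 2) =>
      ∃ t ∈ T, (H : Matrix (Fin n) (Fin n) (ZMod 2)) *ᵥ t.1 = t.2) ≤ T.card / (2 ^ n - 1) := by
  have h2 : (2 : ℝ) ^ n ≥ 2 := by
    simpa using pow_le_pow_right₀ (by norm_num : (1 : ℝ) ≤ 2) hn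
  have h1 : (Finset.univ.filter fun H : GL (Fin n) (ZMod 2) =>
      ∃ t ∈ T, (H : Matrix (Fin n) (Fin n) (ZMod 2)) *ᵥ t.1 = t.2).card ≤
        ∑ t ∈ T, pairCount t.1 t.2 t.1 t.2 := by
    refine (Finset.card_le_card ?_).trans Finset.card_biUnion_le
    intro H
    simp
  calc glProb _ ≤ (∑ t ∈ T, (pairCount t.1 t.2 t.1 t.2 : ℝ)) /
        Fintype.card (GL (Fin n) (ZMod 2)) := by
        unfold glProb; gcongr; exact_mod_cast h1
    _ = ∑ t ∈ T, (pairCount t.1 t.2 t.1 t.2 : ℝ) / Fintype.card (GL (Fin n) (ZMod 2)) :=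
        Finset.sum_div _ _ _
    _ ≤ ∑ _t ∈ T, 1 / ((2 : ℝ) ^ n - 1) := by
        refine Finset.sum_le_sum fun t ht => ?_
        by_cases hw : t.2 = 0
        · have : pairCount t.1 t.2 t.1 t.2 = 0 := by
            simp only [pairCount, Finset.card_eq_zero, Finset.filter_eq_empty_iff]
            rintro H - ⟨-, h⟩
            exact mulVec_ne_zero H (hT t ht) (h.trans hw)
          rw [this]
          have : 0 ≤ 1 / ((2 : ℝ) ^ n - 1) := one_div_nonneg.2 (by linarith)
          simpa using this
        · exact (pairCount_self_div hn (hT t ht) hw).le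
    _ = T.card / (2 ^ n - 1) := by rw [Finset.sum_const, nsmul_eq_mul]; ring

open Classical in
/-- Union bound over the images of two vectors. -/
theorem glProb_exists_pair_le (hn : 2 ≤ n)
    (T : Finset (((Fin n → ZMod 2) × (Fin n → ZMod 2)) × ((Fin n → ZMod 2) × (Fin n → ZMod 2))))
    (hT : ∀ t ∈ T, t.1.1 ≠ 0 ∧ t.2.1 ≠ 0 ∧ t.1.1 ≠ t.2.1) :
    glProb (fun H : GL (Fin n) (ZMod 2) =>
      ∃ t ∈ T, (H : Matrix (Fin n) (Fin n) (ZMod 2)) *ᵥ t.1.1 = t.1.2 ∧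
        (H : Matrix (Fin n) (Fin n) (ZMod 2)) *ᵥ t.2.1 = t.2.2) ≤
      T.card / ((2 ^ n - 1) * (2 ^ n - 2)) := by
  have h4 : (2 : ℝ) ^ n ≥ 4 := by
    have := pow_le_pow_right₀ (by norm_num : (1 : ℝ) ≤ 2) hn
    norm_num at this ⊢; exact this
  have h1 : (Finset.univ.filter fun H : GL (Fin n) (ZMod 2) =>
      ∃ t ∈ T, (H : Matrix (Fin n) (Fin n) (ZMod 2)) *ᵥ t.1.1 = t.1.2 ∧
        (H : Matrix (Fin n) (Fin n) (ZMod 2)) *ᵥ t.2.1 = t.2.2).card ≤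
        ∑ t ∈ T, pairCount t.1.1 t.1.2 t.2.1 t.2.2 := by
    refine (Finset.card_le_card ?_).trans Finset.card_biUnion_le
    intro H
    simp
  calc glProb _ ≤ (∑ t ∈ T, (pairCount t.1.1 t.1.2 t.2.1 t.2.2 : ℝ)) /
        Fintype.card (GL (Fin n) (ZMod 2)) := by
        unfold glProb; gcongr; exact_mod_cast h1
    _ = ∑ t ∈ T, (pairCount t.1.1 t.1.2 t.2.1 t.2.2 : ℝ) / Fintype.card (GL (Fin n) (ZMod 2)) :=
        Finset.sum_div _ _ _
    _ ≤ ∑ _t ∈ T, 1 / (((2 : ℝ) ^ n - 1) * (2 ^ n - 2)) := by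
        refine Finset.sum_le_sum fun t ht => ?_
        obtain ⟨hz, hz', hne⟩ := hT t ht
        by_cases hw : t.1.2 = 0
        · have : pairCount t.1.1 t.1.2 t.2.1 t.2.2 = 0 := by
            simp only [pairCount, Finset.card_eq_zero, Finset.filter_eq_empty_iff]
            rintro H - ⟨h, -⟩
            exact mulVec_ne_zero H hz (h.trans hw)
          rw [this]
          have : 0 ≤ 1 / (((2 : ℝ) ^ n - 1) * (2 ^ n - 2)) :=
            one_div_nonneg.2 (mul_nonneg (by linarith) (by linarith))
          simpa using this
        · exact pairCount_of_ne_div hn hz hz' hne hw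
    _ = T.card / ((2 ^ n - 1) * (2 ^ n - 2)) := by rw [Finset.sum_const, nsmul_eq_mul]; ring

open Classical in
/-- Second moment bound: many admissible images of nonzero vectors force one to occur. -/
theorem glProb_forall_ne_le (hn : 2 ≤ n) (T : Finset ((Fin n → ZMod 2) × (Fin n → ZMod 2)))
    (hT : ∀ t ∈ T, t.1 ≠ 0 ∧ t.2 ≠ 0) (hpos : 0 < T.card) :
    glProb (fun H : GL (Fin n) (ZMod 2) =>
      ∀ t ∈ T, (H : Matrix (Fin n) (Fin n) (ZMod 2)) *ᵥ t.1 ≠ t.2) ≤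
      (2 ^ n - 1) / T.card + 1 / (2 ^ n - 2) := by
  have h4 : (2 : ℝ) ^ n ≥ 4 := by
    have := pow_le_pow_right₀ (by norm_num : (1 : ℝ) ≤ 2) hn
    norm_num at this ⊢; exact this
  set L : ℝ := (Fintype.card (GL (Fin n) (ZMod 2)) : ℝ) with hL
  have hL0 : 0 < L := card_GL_pos
  set p : ℝ := 1 / ((2 : ℝ) ^ n - 1) with hp
  set p2 : ℝ := 1 / (((2 : ℝ) ^ n - 1) * (2 ^ n - 2)) with hp2
  have hp2' : 0 ≤ p2 := one_div_nonneg.2 (mul_nonneg (by linarith) (by linarith))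
  set M : ℝ := (T.card : ℝ) with hM
  have hM0 : 0 < M := by rw [hM]; exact_mod_cast hpos
  let ind : GL (Fin n) (ZMod 2) → ((Fin n → ZMod 2) × (Fin n → ZMod 2)) → ℝ := fun H t =>
    if (H : Matrix (Fin n) (Fin n) (ZMod 2)) *ᵥ t.1 = t.2 then 1 else 0
  have hind : ∀ t t', ∑ H, ind H t * ind H t' = pairCount t.1 t.2 t'.1 t'.2 := by
    intro t t'
    simp only [ind, pairCount, Finset.card_filter, Nat.cast_sum, ← ite_and, mul_ite, mul_one,
      mul_zero]
    refine Finset.sum_congr rfl fun H _ => ?_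
    by_cases h1 : (H : Matrix (Fin n) (Fin n) (ZMod 2)) *ᵥ t.1 = t.2 <;>
    by_cases h2 : (H : Matrix (Fin n) (Fin n) (ZMod 2)) *ᵥ t'.1 = t'.2 <;> simp [h1, h2]
  have hind1 : ∀ t ∈ T, ∑ H, ind H t = L * p := by
    intro t ht
    have h := hind t t
    have h3 := pairCount_self_div (by omega : 1 ≤ n) (hT t ht).1 (hT t ht).2
    rw [← h, div_eq_iff hL0.ne'] at h3
    rw [mul_comm, hp, ← h3]
    refine Finset.sum_congr rfl fun H _ => ?_
    simp only [ind]; split_ifs <;> simp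
  have hind2 : ∀ t ∈ T, ∀ t' ∈ T, ∑ H, ind H t * ind H t' ≤
      L * (p2 + if t = t' then p else 0) := by
    intro t ht t' ht'
    rw [hind, mul_comm, ← div_le_iff₀ hL0]
    by_cases htt : t = t'
    · subst htt
      rw [pairCount_self_div (by omega : 1 ≤ n) (hT t ht).1 (hT t ht).2]
      rw [if_pos rfl, ← hp]
      linarith
    -- Two different images of the same vector exclude each other.
    by_cases h1 : t.1 = t'.1
    · have h0 : pairCount t.1 t.2 t'.1 t'.2 = 0 := by
        simp only [pairCount, Finset.card_eq_zero, Finset.filter_eq_empty_iff]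
        rintro H - ⟨h3, h4⟩
        rw [← h1, h3] at h4
        exact htt (Prod.ext h1 h4)
      simp [h0, htt, hp2']
    · rw [if_neg htt, add_zero]
      exact pairCount_of_ne_div (w' := t'.2) hn (hT t ht).1 (hT t' ht').1 h1 (hT t ht).2
  -- The number of pairs of T that occur has mean M p. Distinct pairs have joint probability at most
  -- `p2`, barely above p², so the variance is small.
  have hsq : ∑ H, (∑ t ∈ T, ind H t - M * p) ^ 2 ≤ L * (M * p + M ^ 2 * p2 - M ^ 2 * p ^ 2) := by
    have e1 : ∀ H, (∑ t ∈ T, ind H t - M * p) ^ 2 =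
        ∑ t ∈ T, ∑ t' ∈ T, ind H t * ind H t' - 2 * (M * p) * ∑ t ∈ T, ind H t + (M * p) ^ 2 := by
      intro H
      rw [← Finset.sum_mul_sum]; ring
    simp only [e1, Finset.sum_add_distrib, Finset.sum_sub_distrib]
    rw [← Finset.mul_sum, Finset.sum_comm, Finset.sum_comm (s := Finset.univ) (t := T), Finset.sum_congr rfl hind1]
    have e2 : ∑ t ∈ T, ∑ H, ∑ t' ∈ T, ind H t * ind H t' ≤ L * (M * p + M ^ 2 * p2) := by
      calc _ = ∑ t ∈ T, ∑ t' ∈ T, ∑ H, ind H t * ind H t' :=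
            Finset.sum_congr rfl fun t _ => Finset.sum_comm
        _ ≤ ∑ t ∈ T, ∑ t' ∈ T, L * (p2 + if t = t' then p else 0) :=
            Finset.sum_le_sum fun t ht => Finset.sum_le_sum fun t' ht' => hind2 t ht t' ht'
        _ = L * (M * p + M ^ 2 * p2) := by
            simp only [← Finset.mul_sum, Finset.sum_add_distrib, Finset.sum_const, nsmul_eq_mul,
              Finset.sum_ite_eq, ← hM]
            rw [Finset.sum_congr rfl (g := fun _ => p) (fun t ht => by simp [ht]), Finset.sum_const,
              nsmul_eq_mul, ← hM]
            ring
    simp only [Finset.sum_const, nsmul_eq_mul, Finset.card_univ, ← hL, ← hM]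
    linarith
  -- On the event in question the count is 0, so it deviates from its mean by all of M p.
  have hmain : ((Finset.univ.filter fun H : GL (Fin n) (ZMod 2) =>
      ∀ t ∈ T, (H : Matrix (Fin n) (Fin n) (ZMod 2)) *ᵥ t.1 ≠ t.2).card : ℝ) * (M * p) ^ 2 ≤
      ∑ H, (∑ t ∈ T, ind H t - M * p) ^ 2 := by
    rw [← nsmul_eq_mul, ← Finset.sum_const]
    refine (Finset.sum_le_sum ?_).trans (Finset.sum_le_univ_sum_of_nonneg fun H => sq_nonneg _)
    intro H hH
    simp only [Finset.mem_filter, Finset.mem_univ, true_and] at hH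
    rw [Finset.sum_eq_zero fun t ht => if_neg (hH t ht)]
    simp
  have hp0 : 0 < p := one_div_pos.2 (by linarith)
  have key := hmain.trans hsq
  unfold glProb
  rw [div_le_iff₀ hL0, ← mul_le_mul_iff_left₀ (by positivity : 0 < (M * p) ^ 2)]
  refine key.trans (le_of_eq ?_)
  rw [hp, hp2]
  have e1 : (2 : ℝ) ^ n - 1 ≠ 0 := by linarith
  have e2 : (2 : ℝ) ^ n - 2 ≠ 0 := by linarith
  field_simp
  ring

end GLcount

/-! ### Single-letter quantities -/

/-- The entropy, in bits, of a bit that equals `1` with probability `r`. -/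
def bitEnt (r : I) : ℝ := Real.binEntropy r / Real.log 2

/-- The cost `-log₂` of the bit value `u` under the bias `β`. -/
def bitCost (β : I) (u : ZMod 2) : ℝ≥0∞ := negLog (bern β u)

/-- The mean cost, under the bias `β`, of a bit that equals `1` with probability `r`. -/
def meanCost (β r : I) : ℝ≥0∞ := ∑ u : ZMod 2, ENNReal.ofReal (bern r u) * bitCost β u

/-- The convex combination `(1 - t) r + t r'`. -/
def mix (t r r' : I) : I :=
  ⟨(1 - t) * r + t * r', by
    have := t.2.1; have := t.2.2; have := r.2.1; have := r'.2.1
    have h : (0 : ℝ) ≤ 1 - t := by linarith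
    positivity, by
    have := t.2.1; have := t.2.2; have := r.2.2; have := r'.2.2
    nlinarith⟩

theorem sum_bit {M : Type*} [AddCommMonoid M] (f : ZMod 2 → M) : ∑ u, f u = f 0 + f 1 :=
  Fin.sum_univ_two f

theorem bit_cases (u : ZMod 2) : u = 0 ∨ u = 1 := by
  revert u; decide

@[simp] theorem bern_one (r : I) : bern r 1 = r := by simp [bern]

@[simp] theorem bern_zero (r : I) : bern r 0 = σ r := by simp [bern]

theorem bern_add (r : I) : (bern r 0 : ℝ) + bern r 1 = 1 := by simp

theorem coe_mix (t r r' : I) : (mix t r r' : ℝ) = (1 - t) * r + t * r' := rfl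

theorem bern_mix (t r r' : I) (u : ZMod 2) :
    (bern (mix t r r') u : ℝ) = (1 - t) * bern r u + t * bern r' u := by
  rcases bit_cases u with rfl | rfl
  · simp [coe_mix]; ring
  · simp [coe_mix]

theorem mix_self (t r : I) : mix t r r = r := by
  ext; simp [coe_mix]; ring

theorem meanCost_mix (β t r r' : I) :
    meanCost β (mix t r r') =
      ENNReal.ofReal (1 - t) * meanCost β r + ENNReal.ofReal t * meanCost β r' := by
  have h0 : (0 : ℝ) ≤ 1 - t := by linarith [t.2.2]
  have h : ∀ u, ENNReal.ofReal (bern (mix t r r') u) = ENNReal.ofReal (1 - t) *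
      ENNReal.ofReal (bern r u) + ENNReal.ofReal t * ENNReal.ofReal (bern r' u) := by
    intro u
    rw [bern_mix, ENNReal.ofReal_add (mul_nonneg h0 (bern r u).2.1)
      (mul_nonneg t.2.1 (bern r' u).2.1), ENNReal.ofReal_mul h0, ENNReal.ofReal_mul t.2.1]
  simp only [meanCost, h, add_mul, Finset.sum_add_distrib, Finset.mul_sum, mul_assoc]

theorem log_two_pos : 0 < Real.log 2 := Real.log_pos (by norm_num)

theorem bitEnt_nonneg (r : I) : 0 ≤ bitEnt r :=
  div_nonneg (Real.binEntropy_nonneg r.2.1 r.2.2) log_two_pos.le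

theorem bitEnt_le_one (r : I) : bitEnt r ≤ 1 :=
  (div_le_one log_two_pos).2 Real.binEntropy_le_log_two

theorem bitEnt_eq_zero {r : I} : bitEnt r = 0 ↔ r = 0 ∨ r = 1 := by
  rw [bitEnt, div_eq_zero_iff, Real.binEntropy_eq_zero, or_iff_left log_two_pos.ne', Subtype.ext_iff,
    Subtype.ext_iff]
  rfl

theorem bitEnt_eq_one {r : I} : bitEnt r = 1 ↔ r = half := by
  rw [bitEnt, div_eq_one_iff_eq log_two_pos.ne', Real.binEntropy_eq_log_two, Subtype.ext_iff]
  norm_num [half]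

theorem bitEnt_mix (t r r' : I) :
    (1 - t) * bitEnt r + t * bitEnt r' ≤ bitEnt (mix t r r') := by
  have h := Real.strictConcave_binEntropy.concaveOn.2 r.2 r'.2
    (by linarith [t.2.2] : (0 : ℝ) ≤ 1 - t) t.2.1 (by ring)
  simp only [smul_eq_mul] at h
  simp only [bitEnt, coe_mix]
  rw [← mul_div_assoc, ← mul_div_assoc, ← add_div]
  exact div_le_div_of_nonneg_right h log_two_pos.le

theorem continuous_bitEnt : Continuous bitEnt := by
  unfold bitEnt; fun_prop

theorem negLog_zero : negLog 0 = ∞ := if_pos rfl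

theorem negLog_of_ne {t : I} (ht : t ≠ 0) : negLog t = ENNReal.ofReal (-Real.logb 2 t) := if_neg ht

theorem negLog_eq_top {t : I} : negLog t = ∞ ↔ t = 0 := by
  unfold negLog; split_ifs with h <;> simp [h]

theorem coe_pos_of_ne {t : I} (ht : t ≠ 0) : (0 : ℝ) < t :=
  unitInterval.pos_iff_ne_zero.2 ht

theorem negLog_one : negLog 1 = 0 := by simp [negLog]

theorem neg_logb_nonneg (t : I) : 0 ≤ -Real.logb 2 t := by
  have := Real.logb_nonpos (b := 2) (by norm_num) t.2.1 t.2.2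
  linarith

theorem negLog_mul (s t : I) : negLog (s * t) = negLog s + negLog t := by
  by_cases hs : s = 0
  · simp [hs, negLog_zero]
  by_cases ht : t = 0
  · simp [ht, negLog_zero]
  rw [negLog_of_ne hs, negLog_of_ne ht, negLog_of_ne (mul_ne_zero hs ht),
    ← ENNReal.ofReal_add (neg_logb_nonneg s) (neg_logb_nonneg t)]
  congr 1
  rw [Set.Icc.coe_mul, Real.logb_mul (coe_pos_of_ne hs).ne' (coe_pos_of_ne ht).ne']
  ring

theorem negLog_prod {ι : Type*} (s : Finset ι) (f : ι → I) :
    negLog (∏ i ∈ s, f i) = ∑ i ∈ s, negLog (f i) := by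
  classical
  induction s using Finset.induction_on with
  | empty => simp [negLog_one]
  | insert i s hi ih => rw [Finset.prod_insert hi, Finset.sum_insert hi, negLog_mul, ih]

theorem negLog_antitone {s t : I} (h : s ≤ t) : negLog t ≤ negLog s := by
  by_cases hs : s = 0
  · simp [hs, negLog_zero]
  have hs' := coe_pos_of_ne hs
  have ht : t ≠ 0 := fun h0 => hs (le_antisymm (h0 ▸ h) s.2.1)
  rw [negLog_of_ne hs, negLog_of_ne ht]
  refine ENNReal.ofReal_le_ofReal (neg_le_neg ?_)
  exact Real.logb_le_logb_of_le (by norm_num) hs' h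

theorem negLog_half : negLog half = 1 := by
  have h : half ≠ 0 := by
    intro h; have := congrArg Subtype.val h; norm_num [half] at this
  rw [negLog_of_ne h]
  have : Real.logb 2 (half : I) = -1 := by
    have : ((half : I) : ℝ) = 2⁻¹ := by norm_num [half]
    rw [this, Real.logb_inv, Real.logb_self_eq_one (by norm_num)]
  rw [this]; simp

theorem symm_half : σ half = half := by ext; norm_num [half]

theorem bern_half (u : ZMod 2) : bern half u = half := by
  rcases bit_cases u with rfl | rfl <;> simp [symm_half]

theorem bitCost_half (u : ZMod 2) : bitCost half u = 1 := by
  rw [bitCost, bern_half, negLog_half]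

theorem bern_bitVal (b u : ZMod 2) : bern (bitVal b) u = if u = b then 1 else 0 := by
  rcases bit_cases b with rfl | rfl <;> rcases bit_cases u with rfl | rfl <;> simp [bitVal]

theorem bern_eq_zero_or {β : I} {u : ZMod 2} (h : bern β u = 0) : β = 0 ∨ β = 1 := by
  rcases bit_cases u with rfl | rfl
  · right; simpa using h
  · left; simpa using h

theorem bitCost_ne_top {β : I} (h : 0 < β) (h' : β < 1) (u : ZMod 2) : bitCost β u ≠ ∞ := by
  rw [bitCost, Ne, negLog_eq_top]
  intro h0
  rcases bern_eq_zero_or h0 with rfl | rfl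
  · exact lt_irrefl _ h
  · exact lt_irrefl _ h'

theorem meanCost_ne_top {β : I} (h : 0 < β) (h' : β < 1) (r : I) : meanCost β r ≠ ∞ := by
  rw [meanCost, ENNReal.sum_ne_top]
  exact fun u _ => ENNReal.mul_ne_top ENNReal.ofReal_ne_top (bitCost_ne_top h h' u)

theorem meanCost_bitVal (β : I) (u : ZMod 2) : meanCost β (bitVal u) = bitCost β u := by
  rw [meanCost, Finset.sum_eq_single u]
  · simp [bern_bitVal]
  · intro v _ hv; simp [bern_bitVal, hv]
  · simp

theorem bern_eq_zero_of_meanCost {β r : I} (h : meanCost β r ≠ ∞) {u : ZMod 2}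
    (hu : bitCost β u = ∞) : bern r u = 0 := by
  rw [meanCost, ENNReal.sum_ne_top] at h
  by_contra h0
  refine h u (Finset.mem_univ _) ?_
  rw [hu, ENNReal.mul_top]
  simpa using coe_pos_of_ne h0

/-- For c = ∞ the product jumps at zeros of f, so continuity fails. Truncating c at m gives
continuous functions whose supremum is the product. -/
theorem lowerSemicontinuous_mul_top {α : Type*} [TopologicalSpace α] {f : α → ℝ≥0∞}
    (hf : Continuous f) (c : ℝ≥0∞) : LowerSemicontinuous fun x => f x * c := by
  have h : (fun x => f x * c) = fun x => ⨆ m : ℕ, f x * min c m := by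
    funext x
    rw [← ENNReal.mul_iSup]
    congr 1
    rw [← inf_iSup_eq, ENNReal.iSup_natCast, inf_top_eq]
  rw [h]
  refine lowerSemicontinuous_iSup fun m => Continuous.lowerSemicontinuous ?_
  exact ENNReal.continuous_mul_const (ne_top_of_le_ne_top (ENNReal.natCast_ne_top m)
    (min_le_right _ _)) |>.comp hf

theorem continuous_bern (u : ZMod 2) : Continuous fun r : I => (bern r u : ℝ) := by
  rcases bit_cases u with rfl | rfl
  · simp only [bern_zero]; fun_prop
  · simp only [bern_one]; fun_prop

/-! ### Weighted averages over an alphabet, and the optimization problem -/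

section alphabet

variable {A : Type*} [Fintype A] (ω : A → ℝ≥0) (β : A → I)

/-- The weighted sum of the entropies of the bits with laws `κ a`. -/
def ent (κ : A → I) : ℝ := ∑ a, ω a * bitEnt (κ a)

/-- The weighted sum of the mean costs of the bits with laws `κ a`. -/
def avgCost (κ : A → I) : ℝ≥0∞ := ∑ a, ω a * meanCost (β a) (κ a)

/-- `κ` is the only feasible point, up to values of weight zero, whose cost is at most its own. -/
def IsUMin (h : ℝ) (κ : A → I) : Prop :=
  h ≤ ent ω κ ∧ ∀ κ', h ≤ ent ω κ' → avgCost ω β κ' ≤ avgCost ω β κ → ∀ a, ω a ≠ 0 → κ' a = κ a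

variable {ω β}

theorem avgCost_mix (t : I) (κ κ' : A → I) :
    avgCost ω β (fun a => mix t (κ a) (κ' a)) =
      ENNReal.ofReal (1 - t) * avgCost ω β κ + ENNReal.ofReal t * avgCost ω β κ' := by
  simp only [avgCost, meanCost_mix, mul_add, Finset.sum_add_distrib, Finset.mul_sum]
  congr 1 <;> exact Finset.sum_congr rfl fun a _ => by ring

theorem ofReal_add_one_sub (t : I) (c : ℝ≥0∞) :
    ENNReal.ofReal (1 - t) * c + ENNReal.ofReal t * c = c := by
  rw [← add_mul, ← ENNReal.ofReal_add (by linarith [t.2.2]) t.2.1]; simp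

theorem avgCost_mix_le (t : I) {κ κ' : A → I} (h : avgCost ω β κ' ≤ avgCost ω β κ) :
    avgCost ω β (fun a => mix t (κ a) (κ' a)) ≤ avgCost ω β κ := by
  rw [avgCost_mix]
  calc _ ≤ ENNReal.ofReal (1 - t) * avgCost ω β κ + ENNReal.ofReal t * avgCost ω β κ := by gcongr
    _ = _ := ofReal_add_one_sub t _

theorem ent_mix (t : I) (κ κ' : A → I) :
    (1 - t) * ent ω κ + t * ent ω κ' ≤ ent ω (fun a => mix t (κ a) (κ' a)) := by
  simp only [ent, Finset.mul_sum, ← Finset.sum_add_distrib]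
  refine Finset.sum_le_sum fun a _ => ?_
  calc _ = (ω a : ℝ) * ((1 - t) * bitEnt (κ a) + t * bitEnt (κ' a)) := by ring
    _ ≤ _ := mul_le_mul_of_nonneg_left (bitEnt_mix _ _ _) (ω a).2

theorem ent_nonneg (κ : A → I) : 0 ≤ ent ω κ :=
  Finset.sum_nonneg fun a _ => mul_nonneg (ω a).2 (bitEnt_nonneg _)

theorem ent_congr {κ κ' : A → I} (h : ∀ a, ω a ≠ 0 → κ' a = κ a) : ent ω κ' = ent ω κ :=
  Finset.sum_congr rfl fun a _ => by
    by_cases ha : ω a = 0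
    · simp [ha]
    · rw [h a ha]

theorem mix_eq_left {t r r' : I} (ht : t ≠ 0) (h : mix t r r' = r) : r' = r := by
  have := congrArg Subtype.val h
  rw [coe_mix] at this
  have ht' := (coe_pos_of_ne ht).ne'
  ext
  have h2 : (t : ℝ) * (r' - r) = 0 := by linarith
  rcases mul_eq_zero.1 h2 with h3 | h3
  · exact absurd h3 ht'
  · linarith

/-- If the entropy constraint were slack, some letter of positive weight would carry a random bit.
Its law is a mixture of the two deterministic ones and the cost is affine, so moving towards one of
them does not raise the cost. A short move stays feasible and contradicts uniqueness. -/
theorem IsUMin.ent_eq {h : ℝ} (h0 : 0 < h) {κ : A → I} (hκ : IsUMin ω β h κ) : ent ω κ = h := by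
  classical
  by_contra hne
  have hlt : h < ent ω κ := lt_of_le_of_ne hκ.1 (Ne.symm hne)
  obtain ⟨a, ha, ha'⟩ : ∃ a, ω a ≠ 0 ∧ bitEnt (κ a) ≠ 0 := by
    by_contra hcon
    push Not at hcon
    have : ent ω κ = 0 := Finset.sum_eq_zero fun a _ => by
      by_cases ha : ω a = 0
      · simp [ha]
      · simp [hcon a ha]
    linarith
  rw [Ne, bitEnt_eq_zero, not_or] at ha'
  have hmixeq : (fun b => mix (κ a) (Function.update κ a 0 b) (Function.update κ a 1 b)) = κ := by
    funext b
    by_cases hb : b = a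
    · subst hb; ext; simp [coe_mix]
    · simp [hb, mix_self]
  have hex : ∃ r : I, r ≠ κ a ∧ avgCost ω β (Function.update κ a r) ≤ avgCost ω β κ := by
    by_contra hcon
    push Not at hcon
    have h1 := hcon 0 (Ne.symm ha'.1)
    have h2 := hcon 1 (Ne.symm ha'.2)
    have h3 := avgCost_mix (ω := ω) (β := β) (κ a) (Function.update κ a 0) (Function.update κ a 1)
    rw [hmixeq] at h3
    have hx : 0 < 1 - (κ a : ℝ) := sub_pos.2 (unitInterval.lt_one_iff_ne_one.2 ha'.2)
    have : avgCost ω β κ < avgCost ω β κ := by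
      conv_rhs => rw [h3]
      conv_lhs => rw [← ofReal_add_one_sub (κ a) (avgCost ω β κ)]
      refine ENNReal.add_lt_add ?_ ?_
      · exact (ENNReal.mul_lt_mul_iff_right (by simpa using hx) ENNReal.ofReal_ne_top).2 h1
      · exact (ENNReal.mul_lt_mul_iff_right (by simpa using coe_pos_of_ne ha'.1)
          ENNReal.ofReal_ne_top).2 h2
    exact lt_irrefl _ this
  obtain ⟨r, hr, hcost⟩ := hex
  have hE : 0 < ent ω κ := h0.trans hlt
  -- With this t the share (1 - t) of the entropy of κ is exactly h, so concavity keeps the mixture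
  -- feasible.
  let t : I := ⟨1 - h / ent ω κ, by
    rw [sub_nonneg, div_le_one hE]; exact hlt.le, by
    have := div_nonneg h0.le hE.le; linarith⟩
  have ht : t ≠ 0 := by
    intro h1
    have := congrArg Subtype.val h1
    have h2 : h / ent ω κ = 1 := by simp [t] at this; linarith
    rw [div_eq_one_iff_eq hE.ne'] at h2
    exact hlt.ne h2
  have h1 := ent_mix (ω := ω) t κ (Function.update κ a r)
  have h2 : (1 - (t : ℝ)) * ent ω κ = h := by simp [t]; field_simp
  have h3 := mul_nonneg t.2.1 (ent_nonneg (ω := ω) (Function.update κ a r))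
  have h4 := hκ.2 _ (by linarith) (avgCost_mix_le t hcost) a ha
  simp only [Function.update_self] at h4
  exact hr (mix_eq_left ht h4)

theorem ent_half : ent ω (fun _ => half) = ∑ a, (ω a : ℝ) := by
  simp only [ent, bitEnt_eq_one.2 rfl, mul_one]

/-- If the minimum were infinite, the uniform laws would be feasible and no more expensive, so
uniqueness would identify them with κ. Their entropy is the total weight, which exceeds the value h
forced by `IsUMin.ent_eq`. -/
theorem IsUMin.ne_top {h : ℝ} (h0 : 0 < h) (hω : h < ∑ a, (ω a : ℝ)) {κ : A → I}
    (hκ : IsUMin ω β h κ) : avgCost ω β κ ≠ ∞ := by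
  intro htop
  have h1 := hκ.2 (fun _ => half) (by rw [ent_half]; exact hω.le) (by rw [htop]; exact le_top)
  have h2 := ent_congr h1
  rw [ent_half, hκ.ent_eq h0] at h2
  exact hω.ne' h2

theorem meanCost_ne_top_of_avgCost {κ : A → I} (h : avgCost ω β κ ≠ ∞) {a : A} (ha : ω a ≠ 0) :
    meanCost (β a) (κ a) ≠ ∞ := by
  rw [avgCost, ENNReal.sum_ne_top] at h
  intro h0
  refine h a (Finset.mem_univ _) ?_
  rw [h0, ENNReal.mul_top]
  simpa using ha

theorem eq_bias_of_meanCost {β r : I} (h : meanCost β r ≠ ∞) (hβ : β = 0 ∨ β = 1) : r = β := by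
  rcases hβ with rfl | rfl
  · simpa using bern_eq_zero_of_meanCost (u := 1) h (by simp [bitCost, negLog_zero])
  · simpa using bern_eq_zero_of_meanCost (u := 0) h (by simp [bitCost, negLog_zero])

theorem lowerSemicontinuous_avgCost : LowerSemicontinuous (avgCost ω β) := by
  have : avgCost ω β = fun κ => ∑ a, ∑ u : ZMod 2,
      (ω a * ENNReal.ofReal (bern (κ a) u)) * bitCost (β a) u := by
    funext κ
    simp only [avgCost, meanCost, Finset.mul_sum, mul_assoc]
  rw [this]
  refine lowerSemicontinuous_sum fun a _ => lowerSemicontinuous_sum fun u _ =>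
    lowerSemicontinuous_mul_top ?_ _
  refine (ENNReal.continuous_const_mul ENNReal.coe_ne_top).comp
    (ENNReal.continuous_ofReal.comp ?_)
  exact (continuous_bern u).comp (continuous_apply a)

theorem continuous_ent : Continuous (ent ω) := by
  unfold ent
  exact continuous_finsetSum _ fun a _ =>
    continuous_const.mul (continuous_bitEnt.comp (continuous_apply a))

/-- A strict alternative on a closed set holds with a margin. -/
theorem exists_gap {K : Set (A → I)} (hK : IsClosed K) {C : ℝ≥0∞} {h : ℝ}
    (hgap : ∀ κ ∈ K, C < avgCost ω β κ ∨ ent ω κ < h) :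
    ∃ δ : ℝ, 0 < δ ∧ ∀ κ ∈ K, C + ENNReal.ofReal δ < avgCost ω β κ ∨ ent ω κ < h - δ := by
  -- The margins 1/(m+1) give an increasing open cover of the compact set K, the cost part being
  -- open by lower semicontinuity.
  let U : ℕ → Set (A → I) := fun m =>
    {κ | C + ENNReal.ofReal (1 / (m + 1 : ℝ)) < avgCost ω β κ} ∪ {κ | ent ω κ < h - 1 / (m + 1 : ℝ)}
  have hU : ∀ m, IsOpen (U m) := fun m =>
    (lowerSemicontinuous_avgCost.isOpen_preimage _).union
      (isOpen_lt continuous_ent continuous_const)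
  have hmono : Monotone U := by
    intro m m' hm
    have h1 : 1 / (m' + 1 : ℝ) ≤ 1 / (m + 1 : ℝ) := by
      have : (m : ℝ) ≤ m' := by exact_mod_cast hm
      gcongr
    refine Set.union_subset_union (fun κ hκ => ?_) (fun κ hκ => ?_)
    · exact lt_of_le_of_lt (by gcongr) (show C + ENNReal.ofReal (1 / (m + 1 : ℝ)) < _ from hκ)
    · exact lt_of_lt_of_le (show ent ω κ < h - 1 / (m + 1 : ℝ) from hκ) (by linarith)
  have hcov : K ⊆ ⋃ m, U m := by
    intro κ hκ
    have ht : Tendsto (fun m : ℕ => 1 / (m + 1 : ℝ)) atTop (𝓝 0) :=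
      tendsto_one_div_add_atTop_nhds_zero_nat
    rw [Set.mem_iUnion]
    rcases hgap κ hκ with h1 | h1
    · have h2 : Tendsto (fun m : ℕ => C + ENNReal.ofReal (1 / (m + 1 : ℝ))) atTop (𝓝 C) := by
        have := (ENNReal.tendsto_ofReal ht).const_add C
        simpa using this
      obtain ⟨m, hm⟩ := (h2.eventually (gt_mem_nhds h1)).exists
      exact ⟨m, Or.inl hm⟩
    · have h2 : Tendsto (fun m : ℕ => h - 1 / (m + 1 : ℝ)) atTop (𝓝 h) := by
        simpa using ht.const_sub h
      obtain ⟨m, hm⟩ := (h2.eventually (lt_mem_nhds h1)).exists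
      exact ⟨m, Or.inr hm⟩
  obtain ⟨m, hm⟩ := hK.isCompact.elim_directed_cover U hU hcov hmono.directed_le
  exact ⟨1 / (m + 1 : ℝ), by positivity, fun κ hκ => hm hκ⟩

/-- If more weight than needed sits on biases in `(0, 1)`, then a little more cost buys more
entropy. -/
theorem IsUMin.exists_ent_gt {h : ℝ} (h0 : 0 < h) {κ : A → I} (hκ : IsUMin ω β h κ)
    (hfin : avgCost ω β κ ≠ ∞) (hroom : h < ∑ a, if 0 < β a ∧ β a < 1 then (ω a : ℝ) else 0)
    {ε : ℝ≥0∞} (hε : ε ≠ 0) :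
    ∃ κ' : A → I, h < ent ω κ' ∧ avgCost ω β κ' < avgCost ω β κ + ε := by
  classical
  -- Randomizing only the letters with bias in (0,1) keeps the cost finite and already gives entropy
  -- above h. A small admixture of `κf` to κ then does both.
  let κf : A → I := fun a => if 0 < β a ∧ β a < 1 then half else κ a
  have hent : h < ent ω κf := by
    refine hroom.trans_le (Finset.sum_le_sum fun a _ => ?_)
    simp only [κf]
    split_ifs with h1
    · rw [bitEnt_eq_one.2 rfl, mul_one]
    · exact mul_nonneg (ω a).2 (bitEnt_nonneg _)
  have hcf : avgCost ω β κf ≠ ∞ := by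
    rw [avgCost, ENNReal.sum_ne_top] at hfin ⊢
    intro a ha
    simp only [κf]
    split_ifs with h1
    · exact ENNReal.mul_ne_top ENNReal.coe_ne_top (meanCost_ne_top h1.1 h1.2 _)
    · exact hfin a ha
  obtain ⟨τ, hτ0, hτ⟩ := ENNReal.exists_nnreal_pos_mul_lt hcf hε
  let t : I := ⟨min τ 1, le_min τ.2 zero_le_one, min_le_right _ _⟩
  have ht0 : 0 < (t : ℝ) := lt_min hτ0 one_pos
  refine ⟨fun a => mix t (κ a) (κf a), ?_, ?_⟩
  · refine lt_of_lt_of_le ?_ (ent_mix t κ κf)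
    rw [hκ.ent_eq h0]
    nlinarith
  · rw [avgCost_mix]
    refine ENNReal.add_lt_add_of_le_of_lt ?_ ?_ ?_
    · exact ENNReal.mul_ne_top ENNReal.ofReal_ne_top hfin
    · exact mul_le_of_le_one_left' (by simpa using t.2.1)
    · refine lt_of_le_of_lt ?_ hτ
      gcongr
      calc ENNReal.ofReal t ≤ ENNReal.ofReal τ := ENNReal.ofReal_le_ofReal (min_le_left _ _)
        _ = τ := ENNReal.ofReal_coe_nnreal

/-- A bit with bias `1/2` costs nothing to randomize. -/
theorem IsUMin.eq_half {h : ℝ} {κ : A → I} (hκ : IsUMin ω β h κ) {a : A} (ha : ω a ≠ 0)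
    (hβ : β a = half) : κ a = half := by
  classical
  have hh : ∀ r : I, meanCost half r = 1 := by
    intro r
    simp only [meanCost, bitCost_half, mul_one]
    rw [sum_bit, ← ENNReal.ofReal_add (bern r 0).2.1 (bern r 1).2.1, bern_add]; simp
  have hpt : ∀ b, meanCost (β b) (Function.update κ a half b) = meanCost (β b) (κ b) := by
    intro b
    by_cases hb : b = a
    · subst hb; rw [hβ, hh, hh]
    · simp [hb]
  have h1 := hκ.2 (Function.update κ a half) (hκ.1.trans ?_) ?_ a ha
  · simpa using h1.symm
  · refine Finset.sum_le_sum fun b _ => mul_le_mul_of_nonneg_left ?_ (ω b).2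
    by_cases hb : b = a
    · subst hb; simp only [Function.update_self]; rw [bitEnt_eq_one.2 rfl]; exact bitEnt_le_one _
    · simp [hb]
  · simp only [avgCost, hpt, le_refl]

/-- Only one of the two terms of the entropy is kept. The bound shows the infinite slope of the
entropy at a deterministic law: a perturbation of size y gains order y log(1/y). -/
theorem le_bitEnt_mix_half {r : I} (hr : r = 0 ∨ r = 1) (y : I) (hy : 0 < (y : ℝ)) :
    (y / 2 : ℝ) * -Real.logb 2 (y / 2) ≤ bitEnt (mix y r half) := by
  have hy1 := y.2.2
  have key : (y / 2 : ℝ) * -Real.logb 2 (y / 2) ≤ Real.binEntropy (y / 2) / Real.log 2 := by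
    rw [le_div_iff₀ log_two_pos, Real.binEntropy_eq_negMulLog_add_negMulLog_one_sub, Real.logb]
    have h2 : 0 ≤ Real.negMulLog (1 - y / 2) := Real.negMulLog_nonneg (by linarith) (by linarith)
    have h3 : (y / 2 : ℝ) * -(Real.log (y / 2) / Real.log 2) * Real.log 2 =
        Real.negMulLog (y / 2) := by
      have := log_two_pos.ne'
      rw [Real.negMulLog]; field_simp
    linarith
  refine key.trans (le_of_eq ?_)
  rcases hr with rfl | rfl
  · simp only [bitEnt, coe_mix, half]; congr 2; norm_num; ring
  · simp only [bitEnt, coe_mix, half]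
    rw [← Real.binEntropy_one_sub]
    congr 2; norm_num; ring

/-- If the optimum is deterministic at a letter with bias in `(0, 1)`, then it is deterministic at
every letter whose bias is not `1/2`. -/
theorem IsUMin.bitEnt_eq_zero_of {h : ℝ} {κ : A → I} (hκ : IsUMin ω β h κ)
    (hfin : avgCost ω β κ ≠ ∞) {x : A} (hx : ω x ≠ 0) (hκx : bitEnt (κ x) = 0)
    (hβx : 0 < β x ∧ β x < 1) {a : A} (ha : ω a ≠ 0) (hβa : β a ≠ half) : bitEnt (κ a) = 0 := by
  classical
  by_contra hκa
  have hax : a ≠ x := fun h => hκa (h ▸ hκx)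
  have hκa' : ¬ (κ a = 0 ∨ κ a = 1) := fun h => hκa (bitEnt_eq_zero.2 h)
  have hma := meanCost_ne_top_of_avgCost hfin ha
  have hβa01 : ¬ (β a = 0 ∨ β a = 1) := fun h => hκa' (eq_bias_of_meanCost hma h ▸ h)
  rw [not_or] at hκa' hβa01
  have hκa0 := coe_pos_of_ne hκa'.1
  have hκa1 : (κ a : ℝ) < 1 := unitInterval.lt_one_iff_ne_one.2 hκa'.2
  have hβa0 := coe_pos_of_ne hβa01.1
  have hβa1 : (β a : ℝ) < 1 := unitInterval.lt_one_iff_ne_one.2 hβa01.2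
  -- As β a ≠ 1/2, the likelier bit value is strictly cheaper than the random bit.
  obtain ⟨v, hv⟩ : ∃ v : I, meanCost (β a) v < meanCost (β a) (κ a) := by
    have hlt : ∀ s t : I, (0 : ℝ) < s → (s : ℝ) < t → negLog t < negLog s := by
      intro s t hs hst
      have hs' : s ≠ 0 := fun h => by rw [h] at hs; simp at hs
      have ht' : t ≠ 0 := fun h => by rw [h] at hst; simp at hst; linarith
      rw [negLog_of_ne hs', negLog_of_ne ht']
      have h2 := Real.logb_lt_logb (b := 2) (by norm_num) hs hst
      have h3 := neg_logb_nonneg t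
      rw [ENNReal.ofReal_lt_ofReal_iff] <;> linarith
    have hsplit : ∀ c : ℝ≥0∞, c = ENNReal.ofReal (σ (κ a) : I) * c + ENNReal.ofReal (κ a) * c := by
      intro c
      conv_lhs => rw [← ofReal_add_one_sub (κ a) c]
      simp
    have hform : meanCost (β a) (κ a) = ENNReal.ofReal (σ (κ a) : I) * negLog (σ (β a)) +
        ENNReal.ofReal (κ a) * negLog (β a) := by
      simp only [meanCost, sum_bit, bitCost, bern_zero, bern_one]
    have hsne : ENNReal.ofReal (σ (κ a) : I) ≠ 0 := by
      simpa using hκa1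
    have hkne : ENNReal.ofReal (κ a) ≠ 0 := by simpa using hκa0
    have hs0 : (0 : ℝ) < (σ (β a) : I) := by simpa using hβa1
    have hne1 : negLog (σ (β a)) ≠ ∞ := by
      rw [Ne, negLog_eq_top]; intro h; rw [h] at hs0; simp at hs0
    have hne2 : negLog (β a) ≠ ∞ := by
      rw [Ne, negLog_eq_top]; exact hβa01.1
    rcases lt_trichotomy (β a : ℝ) (1 / 2) with hlt' | heq | hgt
    · refine ⟨bitVal 0, ?_⟩
      rw [meanCost_bitVal, bitCost, bern_zero, hform, hsplit (negLog (σ (β a)))]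
      refine ENNReal.add_lt_add_of_le_of_lt (ENNReal.mul_ne_top ENNReal.ofReal_ne_top hne1)
        ?_ ?_
      · rw [← hsplit]
      · exact (ENNReal.mul_lt_mul_iff_right hkne ENNReal.ofReal_ne_top).2
          (hlt _ _ hβa0 (by simp; linarith))
    · exact absurd (Subtype.ext heq) hβa
    · refine ⟨bitVal 1, ?_⟩
      rw [meanCost_bitVal, bitCost, bern_one, hform, hsplit (negLog (β a))]
      refine ENNReal.add_lt_add_of_lt_of_le (ENNReal.mul_ne_top ENNReal.ofReal_ne_top hne2) ?_ ?_
      · exact (ENNReal.mul_lt_mul_iff_right hsne ENNReal.ofReal_ne_top).2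
          (hlt _ _ hs0 (by simp; linarith))
      · rw [← hsplit]
  -- The saving d at the letter a pays for randomizing the letter x by the fraction τ.
  set d : ℝ≥0∞ := ω a * meanCost (β a) (κ a) - ω a * meanCost (β a) v with hd
  have hωa : (ω a : ℝ≥0∞) ≠ 0 := by simpa using ha
  have hlt : ω a * meanCost (β a) v < ω a * meanCost (β a) (κ a) :=
    (ENNReal.mul_lt_mul_iff_right hωa ENNReal.coe_ne_top).2 hv
  have hd0 : d ≠ 0 := (tsub_pos_of_lt hlt).ne'
  obtain ⟨τ', hτ0, hτ⟩ := ENNReal.exists_nnreal_pos_mul_lt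
    (ENNReal.mul_ne_top (ENNReal.coe_ne_top (r := ω x)) (meanCost_ne_top hβx.1 hβx.2 half)) hd0
  let τ : I := ⟨min τ' 1, le_min τ'.2 zero_le_one, min_le_right _ _⟩
  have hτpos : 0 < (τ : ℝ) := lt_min hτ0 one_pos
  let κ' : A → I := Function.update (Function.update κ a v) x (mix τ (κ x) half)
  have hκ'a : κ' a = v := by simp [κ', hax]
  have hκ'x : κ' x = mix τ (κ x) half := by simp [κ']
  have hκ'o : ∀ b, b ≠ a → b ≠ x → κ' b = κ b := by intro b h1 h2; simp [κ', h1, h2]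
  have hxmem : x ∈ Finset.univ.erase a := by simp [hax.symm]
  have hsplit : ∀ f : A → ℝ≥0∞, ∑ b, f b = f a + (f x + ∑ b ∈ (Finset.univ.erase a).erase x, f b) :=
    fun f => by rw [Finset.add_sum_erase _ _ hxmem, Finset.add_sum_erase _ _ (Finset.mem_univ a)]
  have hsplitR : ∀ f : A → ℝ, ∑ b, f b = f a + (f x + ∑ b ∈ (Finset.univ.erase a).erase x, f b) :=
    fun f => by rw [Finset.add_sum_erase _ _ hxmem, Finset.add_sum_erase _ _ (Finset.mem_univ a)]
  have hcost : avgCost ω β κ' ≤ avgCost ω β κ := by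
    unfold avgCost
    rw [hsplit, hsplit (fun b => ω b * meanCost (β b) (κ b)), ← add_assoc, ← add_assoc]
    refine add_le_add ?_ (le_of_eq (Finset.sum_congr rfl fun b hb => ?_))
    · rw [hκ'a, hκ'x]
      have e1 : ω x * meanCost (β x) (mix τ (κ x) half) ≤ ω x * meanCost (β x) (κ x) + d := by
        rw [meanCost_mix, mul_add]
        refine add_le_add ?_ ?_
        · gcongr
          exact mul_le_of_le_one_left' (by simpa using τ.2.1)
        · refine le_trans ?_ hτ.le
          rw [← mul_assoc, mul_comm (ω x : ℝ≥0∞), mul_assoc]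
          gcongr
          calc ENNReal.ofReal τ ≤ ENNReal.ofReal τ' := ENNReal.ofReal_le_ofReal (min_le_left _ _)
            _ = τ' := ENNReal.ofReal_coe_nnreal
      calc _ ≤ ω a * meanCost (β a) v + (ω x * meanCost (β x) (κ x) + d) := by gcongr
        _ = (ω a * meanCost (β a) v + d) + ω x * meanCost (β x) (κ x) := by ring
        _ = _ := by rw [hd, add_tsub_cancel_of_le hlt.le]
    · simp only [Finset.mem_erase] at hb
      rw [hκ'o b hb.2.1 hb.1]
  have hωx : (0 : ℝ) < ω x := by exact_mod_cast pos_iff_ne_zero.2 hx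
  -- Moving a fraction t towards κ' loses at most t ω(a) of entropy at a and gains at least ω(x)
  -- (tτ/2) log₂(2/(tτ)) at x. The gain dominates once this logarithm is at least B, which t =
  -- 2^(-B) ensures.
  set B : ℝ := 2 * ω a / (τ * ω x) with hB
  obtain ⟨t, ht0, htB⟩ : ∃ t : I, 0 < (t : ℝ) ∧ B ≤ -Real.logb 2 (t * τ / 2) := by
    refine ⟨⟨(2 : ℝ) ^ (-B), by positivity, ?_⟩, by positivity, ?_⟩
    · exact Real.rpow_le_one_of_one_le_of_nonpos (by norm_num) (by
        have : 0 ≤ B := by positivity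
        linarith)
    · have h1 : (2 : ℝ) ^ (-B) * τ / 2 ≤ 2 ^ (-B) := by
        have := τ.2.2
        have h3 : (0 : ℝ) < 2 ^ (-B) := by positivity
        nlinarith
      have h2 := Real.logb_le_logb_of_le (b := 2) (by norm_num) (by positivity) h1
      rw [Real.logb_rpow (by norm_num) (by norm_num)] at h2
      linarith
  have hcost' := avgCost_mix_le t hcost
  have hent : ent ω κ ≤ ent ω (fun b => mix t (κ b) (κ' b)) := by
    unfold ent
    rw [hsplitR, hsplitR (fun b => ω b * bitEnt (mix t (κ b) (κ' b))), ← add_assoc, ← add_assoc]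
    refine add_le_add ?_ (le_of_eq (Finset.sum_congr rfl fun b hb => ?_))
    · rw [hκx]
      have e1 := bitEnt_mix t (κ a) (κ' a)
      have e2 : mix t (κ x) (κ' x) = mix (t * τ) (κ x) half := by
        rw [hκ'x]; ext; simp only [coe_mix, Set.Icc.coe_mul]; ring
      have e3 := le_bitEnt_mix_half (bitEnt_eq_zero.1 hκx) (t * τ) (by
        rw [Set.Icc.coe_mul]; positivity)
      rw [← e2, Set.Icc.coe_mul] at e3
      have e4 : (t * τ / 2 : ℝ) * B ≤ bitEnt (mix t (κ x) (κ' x)) :=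
        le_trans (mul_le_mul_of_nonneg_left htB (by positivity)) e3
      have e5 : ω x * ((t * τ / 2 : ℝ) * B) = t * ω a := by
        rw [hB]; field_simp
      have e6 := mul_le_mul_of_nonneg_left e4 hωx.le
      have e7 := mul_le_mul_of_nonneg_left e1 (ω a).2
      have e8 := mul_nonneg (mul_nonneg (ω a).2 t.2.1) (bitEnt_nonneg (κ' a))
      have e9 := mul_nonneg (mul_nonneg (ω a).2 t.2.1) (sub_nonneg.2 (bitEnt_le_one (κ a)))
      change _ ≤ (ω a : ℝ) * _ + (ω x : ℝ) * _
      have e10 : (ω a : ℝ) * ((1 - t) * bitEnt (κ a) + t * bitEnt (κ' a)) =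
        ω a * bitEnt (κ a) - ω a * t + ω a * t * (1 - bitEnt (κ a)) + ω a * t * bitEnt (κ' a) := by
        ring
      simp only [NNReal.val_eq_coe] at e7 e8 e9
      linarith
    · simp only [Finset.mem_erase] at hb
      rw [hκ'o b hb.2.1 hb.1, mix_self]
  have hfinal := hκ.2 _ (hκ.1.trans hent) hcost' x hx
  have ht : t ≠ 0 := fun h => by rw [h] at ht0; simp at ht0
  have hτ1 : τ ≠ 0 := fun h => by rw [h] at hτpos; simp at hτpos
  have h1 := mix_eq_left hτ1 (hκ'x ▸ mix_eq_left ht hfinal)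
  rw [← h1, bitEnt_eq_one.2 rfl] at hκx
  exact one_ne_zero hκx

end alphabet

/-! ### A second moment inequality for product weights -/

section variance

variable {ι α : Type*} [Fintype ι] [Fintype α]

theorem sum_prod_eq [DecidableEq ι] (p : ι → α → ℝ) :
    ∑ u : ι → α, ∏ i, p i (u i) = ∏ i, ∑ a, p i a := (Fintype.prod_sum p).symm

/-- Centering makes the off-diagonal terms vanish. The weights need not be normalized, so the
inequality applies to slices of a joint law, and the bound on g only matters where p is positive. -/
theorem sum_prod_mul_sq_le [DecidableEq ι] {p g : ι → α → ℝ} (hp : ∀ i a, 0 ≤ p i a)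
    (hg : ∀ i, ∑ a, p i a * g i a = 0) {M : ℝ} (hM : ∀ i a, p i a * g i a ^ 2 ≤ M * p i a) :
    ∑ u : ι → α, (∏ i, p i (u i)) * (∑ i, g i (u i)) ^ 2 ≤
      Fintype.card ι * M * ∏ i, ∑ a, p i a := by
  have hexp : ∑ u : ι → α, (∏ i, p i (u i)) * (∑ i, g i (u i)) ^ 2 =
      ∑ i, ∑ j, ∑ u : ι → α, (∏ r, p r (u r)) * (g i (u i) * g j (u j)) := by
    have e : ∀ u : ι → α, (∏ i, p i (u i)) * (∑ i, g i (u i)) ^ 2 =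
        ∑ i, ∑ j, (∏ r, p r (u r)) * (g i (u i) * g j (u j)) := by
      intro u
      rw [sq, Finset.sum_mul_sum]
      simp only [Finset.mul_sum]
    simp only [e]
    rw [Finset.sum_comm]
    exact Finset.sum_congr rfl fun i _ => Finset.sum_comm
  have hoff : ∀ i j, i ≠ j → ∑ u : ι → α, (∏ r, p r (u r)) * (g i (u i) * g j (u j)) = 0 := by
    intro i j hij
    have e : ∀ u : ι → α, (∏ r, p r (u r)) * (g i (u i) * g j (u j)) =
        ∏ r, (p r (u r) * ((if r = i then g i (u r) else 1) * if r = j then g j (u r) else 1)) := by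
      intro u
      rw [Finset.prod_mul_distrib, Finset.prod_mul_distrib]
      simp
    simp only [e]
    rw [sum_prod_eq fun r a => p r a * ((if r = i then g i a else 1) * if r = j then g j a else 1)]
    refine Finset.prod_eq_zero (Finset.mem_univ i) ?_
    simpa [hij] using hg i
  have hdiag : ∀ i, ∑ u : ι → α, (∏ r, p r (u r)) * (g i (u i) * g i (u i)) ≤
      M * ∏ i, ∑ a, p i a := by
    intro i
    rw [← sum_prod_eq, Finset.mul_sum]
    refine Finset.sum_le_sum fun u _ => ?_
    rw [← Finset.mul_prod_erase _ _ (Finset.mem_univ i)]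
    have h0 : 0 ≤ ∏ r ∈ Finset.univ.erase i, p r (u r) := Finset.prod_nonneg fun r _ => hp _ _
    nlinarith [mul_le_mul_of_nonneg_right (hM i (u i)) h0]
  rw [hexp]
  calc ∑ i, ∑ j, ∑ u : ι → α, (∏ r, p r (u r)) * (g i (u i) * g j (u j)) =
      ∑ i, ∑ u : ι → α, (∏ r, p r (u r)) * (g i (u i) * g i (u i)) :=
        Finset.sum_congr rfl fun i _ => Finset.sum_eq_single i (fun j _ hj => hoff i j (Ne.symm hj))
          (fun h => absurd (Finset.mem_univ i) h)
    _ ≤ ∑ _i : ι, M * ∏ i, ∑ a, p i a := Finset.sum_le_sum fun i _ => hdiag i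
    _ = _ := by rw [Finset.sum_const, Finset.card_univ, nsmul_eq_mul, mul_assoc]

open Classical in
/-- Chebyshev's inequality for product weights. -/
theorem sum_filter_prod_le [DecidableEq ι] {p g : ι → α → ℝ} (hp : ∀ i a, 0 ≤ p i a)
    (hg : ∀ i, ∑ a, p i a * g i a = 0) {M : ℝ} (hM : ∀ i a, p i a * g i a ^ 2 ≤ M * p i a)
    {t : ℝ} (ht : 0 < t) :
    ∑ u ∈ Finset.univ.filter (fun u : ι → α => t ≤ |∑ i, g i (u i)|), ∏ i, p i (u i) ≤
      Fintype.card ι * M / t ^ 2 * ∏ i, ∑ a, p i a := by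
  have h := sum_prod_mul_sq_le hp hg hM
  rw [div_mul_eq_mul_div, le_div_iff₀ (by positivity), Finset.sum_mul]
  refine le_trans (le_trans (Finset.sum_le_sum
    (g := fun u => (∏ i, p i (u i)) * (∑ i, g i (u i)) ^ 2) fun u hu => ?_) ?_) h
  · have hu' : t ≤ |∑ i, g i (u i)| := by simpa using hu
    refine mul_le_mul_of_nonneg_left ?_ (Finset.prod_nonneg fun i _ => hp _ _)
    rw [← sq_abs (∑ i, g i (u i))]
    exact pow_le_pow_left₀ ht.le hu' 2
  · exact Finset.sum_le_univ_sum_of_nonneg fun u =>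
      mul_nonneg (Finset.prod_nonneg fun i _ => hp _ _) (sq_nonneg _)

end variance

open Classical in
-- A union bound for the mass outside the good set; points without mass are dropped from that set as
-- well.
theorem sum_le_sum_good_add {U : Type*} [Fintype U] {f : U → ℝ} (hf : ∀ u, 0 ≤ f u) (x y : U → ℝ)
    (t : ℝ) :
    ∑ u, f u ≤ ∑ u ∈ Finset.univ.filter (fun u => f u ≠ 0 ∧ x u < t ∧ y u < t), f u +
      ∑ u ∈ Finset.univ.filter (fun u => t ≤ x u), f u +
      ∑ u ∈ Finset.univ.filter (fun u => t ≤ y u), f u := by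
  simp only [Finset.sum_filter]
  rw [← Finset.sum_add_distrib, ← Finset.sum_add_distrib]
  refine Finset.sum_le_sum fun u _ => ?_
  have h0 := hf u
  by_cases h3 : f u = 0
  · simp [h3]
  rcases lt_or_ge (x u) t with h1 | h1
  · rcases lt_or_ge (y u) t with h2 | h2
    · simp [h1, h2, h3, h1.not_ge, h2.not_ge]
    · simp [h1, h2, h1.not_ge, h2.not_gt]
  · rw [if_neg (fun h => h1.not_gt h.2.1), if_pos h1]
    split_ifs <;> linarith

/-- Makes the polynomial number of types negligible against any exponential margin. -/
theorem eventually_poly_le (c : ℝ) (hc : 0 ≤ c) (d : ℕ) {ε : ℝ} (hε : 0 < ε) :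
    ∀ᶠ n : ℕ in atTop, (c * n + 1) ^ d ≤ (2 : ℝ) ^ (n * ε) := by
  have h1 : (1 : ℝ) < 2 ^ ε := Real.one_lt_rpow (by norm_num) hε
  have h2 := tendsto_pow_const_div_const_pow_of_one_lt d h1
  have h3 : (0 : ℝ) < 1 / (c + 1) ^ d := by positivity
  filter_upwards [h2.eventually (gt_mem_nhds h3), eventually_ge_atTop 1] with n hn hn1
  have h4 : (1 : ℝ) ≤ n := by exact_mod_cast hn1
  have h5 : (2 : ℝ) ^ (n * ε) = ((2 : ℝ) ^ ε) ^ n := by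
    rw [mul_comm, Real.rpow_mul (by norm_num), Real.rpow_natCast]
  rw [h5]
  rw [div_lt_div_iff₀ (by positivity) (by positivity), one_mul] at hn
  calc (c * n + 1) ^ d ≤ ((c + 1) * n) ^ d := by gcongr; nlinarith
    _ = n ^ d * (c + 1) ^ d := by rw [mul_pow, mul_comm]
    _ ≤ _ := hn.le

/-! ### Sequences over an alphabet -/

section counting

variable {A : Type*} {ι : Type*} [Fintype ι]

/-- The cost of the bit sequence `u` when the `i`-th bit has bias `β (s i)`. -/
def seqCost (β : A → I) (s : ι → A) (u : ι → ZMod 2) : ℝ≥0∞ := ∑ i, bitCost (β (s i)) (u i)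

open Classical in
/-- The number of occurrences of the letter `a`. -/
def occ (s : ι → A) (a : A) : ℕ := (Finset.univ.filter fun i => s i = a).card

open Classical in
/-- The number of joint occurrences of the letter `a` and the bit `b`. -/
def jointOcc (s : ι → A) (u : ι → ZMod 2) (a : A) (b : ZMod 2) : ℕ :=
  (Finset.univ.filter fun i => s i = a ∧ u i = b).card

theorem jointOcc_add (s : ι → A) (u : ι → ZMod 2) (a : A) :
    jointOcc s u a 0 + jointOcc s u a 1 = occ s a := by
  classical
  unfold jointOcc occ
  rw [← Finset.card_union_of_disjoint]
  · congr 1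
    ext i
    simp only [Finset.mem_union, Finset.mem_filter, Finset.mem_univ, true_and, ← and_or_left]
    exact and_iff_left (bit_cases _)
  · rw [Finset.disjoint_filter]
    rintro i - ⟨-, h⟩ ⟨-, h'⟩
    rw [h] at h'; exact zero_ne_one h'

/-- The frequency of the bit value `1` at the positions that carry the letter `a`. -/
def freq (s : ι → A) (u : ι → ZMod 2) (a : A) : I :=
  ⟨jointOcc s u a 1 / occ s a, by positivity, by
    refine div_le_one_of_le₀ ?_ (Nat.cast_nonneg _)
    have := jointOcc_add s u a
    exact_mod_cast (by omega : jointOcc s u a 1 ≤ occ s a)⟩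

theorem jointOcc_eq (s : ι → A) (u : ι → ZMod 2) (a : A) (b : ZMod 2) :
    (jointOcc s u a b : ℝ) = occ s a * bern (freq s u a) b := by
  have h := jointOcc_add s u a
  by_cases h0 : occ s a = 0
  · have h1 : jointOcc s u a b = 0 := by
      rcases bit_cases b with rfl | rfl <;> omega
    simp [h0, h1]
  have h0' : (occ s a : ℝ) ≠ 0 := by exact_mod_cast h0
  have h' : (jointOcc s u a 0 : ℝ) + jointOcc s u a 1 = occ s a := by exact_mod_cast h
  rcases bit_cases b with rfl | rfl
  · simp only [bern_zero, unitInterval.coe_symm_eq, freq]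
    field_simp; linarith
  · simp only [bern_one, freq]
    field_simp

/-- The number of occurrences of every letter `a` is within a factor `1 ± δ` of `n ω a`. -/
def Typical (ω : A → ℝ≥0) (δ : ℝ) (n : ℕ) (s : ι → A) : Prop :=
  ∀ a, (1 - δ) * (n * ω a) ≤ occ s a ∧ (occ s a : ℝ) ≤ (1 + δ) * (n * ω a)

theorem Typical.mono {ω : A → ℝ≥0} {δ δ' : ℝ} {n : ℕ} {s : ι → A} (h : Typical ω δ n s)
    (hδ : δ ≤ δ') : Typical ω δ' n s := fun a => by
  obtain ⟨h1, h2⟩ := h a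
  have h3 : (0 : ℝ) ≤ n * ω a := by positivity
  constructor <;> nlinarith

theorem Typical.ne_zero {ω : A → ℝ≥0} {δ : ℝ} {n : ℕ} {s : ι → A} (h : Typical ω δ n s) (i : ι) :
    ω (s i) ≠ 0 := by
  intro h0
  have h1 := (h (s i)).2
  rw [h0] at h1
  have : 0 < occ s (s i) := Finset.card_pos.2 ⟨i, by simp⟩
  have h2 : (0 : ℝ) < occ s (s i) := by exact_mod_cast this
  simp at h1
  linarith

variable [Fintype A]

theorem sum_letters {M : Type*} [AddCommMonoid M] (s : ι → A) (u : ι → ZMod 2)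
    (F : A → ZMod 2 → M) :
    ∑ i, F (s i) (u i) = ∑ a, ∑ b, jointOcc s u a b • F a b := by
  classical
  have h : ∀ a b, jointOcc s u a b • F a b = ∑ i, if s i = a ∧ u i = b then F a b else 0 := by
    intro a b
    rw [← Finset.sum_filter, Finset.sum_const, jointOcc]
  simp only [h]
  symm
  calc ∑ a, ∑ b, ∑ i, (if s i = a ∧ u i = b then F a b else 0) =
      ∑ a, ∑ i, ∑ b, (if s i = a ∧ u i = b then F a b else 0) :=
        Finset.sum_congr rfl fun a _ => Finset.sum_comm
    _ = ∑ i, ∑ a, ∑ b, (if s i = a ∧ u i = b then F a b else 0) := Finset.sum_comm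
    _ = _ := Finset.sum_congr rfl fun i _ => by simp [ite_and]

theorem sum_occ {M : Type*} [AddCommMonoid M] (s : ι → A) (F : A → M) :
    ∑ i, F (s i) = ∑ a, occ s a • F a := by
  rw [sum_letters s (fun _ => 0) (fun a _ => F a)]
  refine Finset.sum_congr rfl fun a _ => ?_
  rw [sum_bit, ← add_smul, jointOcc_add]

theorem card_eq_sum_occ (s : ι → A) : Fintype.card ι = ∑ a, occ s a := by
  have := sum_occ s (fun _ => 1)
  simpa using this

theorem seqCost_eq (β : A → I) (s : ι → A) (u : ι → ZMod 2) :
    seqCost β s u = ∑ a, occ s a * meanCost (β a) (freq s u a) := by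
  unfold seqCost
  rw [sum_letters s u (fun a b => bitCost (β a) b)]
  refine Finset.sum_congr rfl fun a _ => ?_
  rw [meanCost, Finset.mul_sum]
  refine Finset.sum_congr rfl fun b _ => ?_
  rw [nsmul_eq_mul, ← mul_assoc]
  congr 1
  rw [← ENNReal.ofReal_natCast, jointOcc_eq, ENNReal.ofReal_mul (Nat.cast_nonneg _),
    ENNReal.ofReal_natCast]

theorem bitEnt_eq_sum (r : I) : bitEnt r = ∑ b : ZMod 2, (bern r b : ℝ) * -Real.logb 2 (bern r b) := by
  rw [sum_bit, bitEnt, Real.binEntropy]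
  simp only [bern_zero, bern_one, unitInterval.coe_symm_eq, Real.logb, Real.log_inv]
  ring

/-- Under the product law given by its own type, a sequence has probability determined by the type
alone. No factor vanishes, because every pair of letter and bit that occurs has positive frequency.
-/
theorem prod_bern_freq (s : ι → A) (u : ι → ZMod 2) :
    ∏ i, (bern (freq s u (s i)) (u i) : ℝ) = 2 ^ (-∑ a, occ s a * bitEnt (freq s u a)) := by
  have hpos : ∀ i, 0 < (bern (freq s u (s i)) (u i) : ℝ) := by
    intro i
    have h1 : 0 < (jointOcc s u (s i) (u i) : ℝ) := by
      have : 0 < jointOcc s u (s i) (u i) := Finset.card_pos.2 ⟨i, by simp⟩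
      exact_mod_cast this
    rw [jointOcc_eq] at h1
    exact pos_of_mul_pos_right h1 (Nat.cast_nonneg _)
  have h2 : Real.logb 2 (∏ i, (bern (freq s u (s i)) (u i) : ℝ)) =
      -∑ a, occ s a * bitEnt (freq s u a) := by
    rw [Real.logb_prod _ _ fun i _ => (hpos i).ne',
      sum_letters s u fun a b => Real.logb 2 (bern (freq s u a) b), ← Finset.sum_neg_distrib]
    refine Finset.sum_congr rfl fun a _ => ?_
    rw [bitEnt_eq_sum, Finset.mul_sum, ← Finset.sum_neg_distrib]
    refine Finset.sum_congr rfl fun b _ => ?_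
    rw [nsmul_eq_mul, jointOcc_eq]; ring
  rw [← h2, Real.rpow_logb (by norm_num) (by norm_num) (Finset.prod_pos fun i _ => hpos i)]

open Classical in
-- All sequences of type κ have the same probability under the product law of κ, and these
-- probabilities sum to at most 1.
theorem card_freq_le [DecidableEq ι] (s : ι → A) (κ : A → I) :
    ((Finset.univ.filter fun u : ι → ZMod 2 => freq s u = κ).card : ℝ) ≤
      2 ^ (∑ a, occ s a * bitEnt (κ a)) := by
  have h1 : ((Finset.univ.filter fun u : ι → ZMod 2 => freq s u = κ).card : ℝ) *
      2 ^ (-∑ a, occ s a * bitEnt (κ a)) ≤ 1 := by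
    rw [← nsmul_eq_mul, ← Finset.sum_const]
    calc _ = ∑ u ∈ Finset.univ.filter (fun u : ι → ZMod 2 => freq s u = κ),
          ∏ i, (bern (κ (s i)) (u i) : ℝ) := by
          refine Finset.sum_congr rfl fun u hu => ?_
          have : freq s u = κ := by simpa using hu
          rw [← this, prod_bern_freq]
      _ ≤ ∑ u : ι → ZMod 2, ∏ i, (bern (κ (s i)) (u i) : ℝ) :=
          Finset.sum_le_univ_sum_of_nonneg fun u => Finset.prod_nonneg fun i _ => (bern _ _).2.1
      _ = 1 := by
          rw [sum_prod_eq fun i b => (bern (κ (s i)) b : ℝ)]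
          simp only [sum_bit, bern_add, Finset.prod_const_one]
  rwa [Real.rpow_neg (by norm_num), ← div_eq_mul_inv, div_le_one (by positivity)] at h1

open Classical in
-- For fixed s, a type is determined by the number of ones at each letter, an integer between 0 and
-- the length.
theorem card_image_freq_le (s : ι → A) (S : Finset (ι → ZMod 2)) :
    (S.image (freq s)).card ≤ (Fintype.card ι + 1) ^ Fintype.card A := by
  have hlt : ∀ u a, jointOcc s u a 1 < Fintype.card ι + 1 := fun u a =>
    Nat.lt_succ_of_le (Finset.card_le_univ _)
  let φ : (A → Fin (Fintype.card ι + 1)) → A → ℝ := fun N a => (N a : ℕ) / occ s a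
  have h1 : ((S.image (freq s)).image fun κ a => (κ a : ℝ)) ⊆ Finset.univ.image φ := by
    intro x hx
    simp only [Finset.mem_image] at hx
    obtain ⟨κ, ⟨u, -, rfl⟩, rfl⟩ := hx
    exact Finset.mem_image.2 ⟨fun a => ⟨jointOcc s u a 1, hlt u a⟩, Finset.mem_univ _, rfl⟩
  have hinj : Function.Injective fun (κ : A → I) a => (κ a : ℝ) := fun κ κ' h =>
    funext fun a => Subtype.ext (congrFun h a)
  rw [← Finset.card_image_of_injective _ hinj]
  refine (Finset.card_le_card h1).trans (Finset.card_image_le.trans ?_)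
  simp

theorem Typical.card_le {ω : A → ℝ≥0} {δ : ℝ} {n : ℕ} {s : ι → A} (h : Typical ω δ n s)
    (hδ : δ ≤ 1) : (Fintype.card ι : ℝ) ≤ 2 * (∑ a, (ω a : ℝ)) * n := by
  rw [card_eq_sum_occ s, Nat.cast_sum, Finset.mul_sum, Finset.sum_mul]
  refine Finset.sum_le_sum fun a _ => ?_
  have := (h a).2
  have h3 : (0 : ℝ) ≤ n * ω a := by positivity
  nlinarith

theorem Typical.le_seqCost {ω : A → ℝ≥0} {δ : ℝ} (hδ1 : δ ≤ 1) {n : ℕ} {s : ι → A}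
    (h : Typical ω δ n s) (β : A → I) (u : ι → ZMod 2) :
    ENNReal.ofReal ((1 - δ) * n) * avgCost ω β (freq s u) ≤ seqCost β s u := by
  rw [seqCost_eq, avgCost, Finset.mul_sum]
  refine Finset.sum_le_sum fun a _ => ?_
  rw [← mul_assoc]
  gcongr
  rw [← ENNReal.ofReal_coe_nnreal, ← ENNReal.ofReal_mul (by
      have : 0 ≤ 1 - δ := by linarith
      positivity), ← ENNReal.ofReal_natCast (occ s a)]
  exact ENNReal.ofReal_le_ofReal (by linarith [(h a).1])

open Classical in
/-- The number of sequences of small cost whose frequencies lie in a closed set `K`. -/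
theorem exists_card_le {ω : A → ℝ≥0} {β : A → I} {K : Set (A → I)} (hK : IsClosed K) {C : ℝ≥0∞}
    (hC : C ≠ ∞) {h : ℝ} (hgap : ∀ κ ∈ K, C < avgCost ω β κ ∨ ent ω κ < h) :
    ∃ δ : ℝ, 0 < δ ∧ ∀ᶠ n : ℕ in atTop, ∀ {ι : Type} [Fintype ι] [DecidableEq ι] (s : ι → A), Typical ω δ n s →
      ((Finset.univ.filter fun u : ι → ZMod 2 =>
        freq s u ∈ K ∧ seqCost β s u ≤ n * (C + ENNReal.ofReal δ)).card : ℝ) ≤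
          2 ^ (n * (h - δ)) := by
  obtain ⟨δ₁, hδ₁, hg⟩ := exists_gap hK hgap
  set W : ℝ := ∑ a, (ω a : ℝ) with hW
  have hW0 : 0 ≤ W := Finset.sum_nonneg fun a _ => (ω a).2
  set c : ℝ := C.toReal with hc
  have hc0 : 0 ≤ c := ENNReal.toReal_nonneg
  have hCc : C = ENNReal.ofReal c := (ENNReal.ofReal_toReal hC).symm
  -- The gap `δ₁` has to cover three losses: the factor 1 - δ in the cost, the error δ W in the
  -- entropy, and the number of types, which gets the exponent δ₁/4.
  set δ : ℝ := min (1 / 2) (δ₁ / (4 * (c + δ₁ + W + 1))) with hδ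
  have hden : 0 < 4 * (c + δ₁ + W + 1) := by positivity
  have hδ0 : 0 < δ := lt_min (by norm_num) (by positivity)
  have hδhalf : δ ≤ 1 / 2 := min_le_left _ _
  have hδ2 : δ * (4 * (c + δ₁ + W + 1)) ≤ δ₁ := by
    rw [← le_div_iff₀ hden]; exact min_le_right _ _
  refine ⟨δ, hδ0, ?_⟩
  filter_upwards [eventually_poly_le (2 * W) (by positivity) (Fintype.card A)
    (by positivity : 0 < δ₁ / 4), eventually_ge_atTop 1] with n hpoly hn1 ι _ _ s hs
  have hn : (1 : ℝ) ≤ n := by exact_mod_cast hn1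
  set S := Finset.univ.filter fun u : ι → ZMod 2 =>
    freq s u ∈ K ∧ seqCost β s u ≤ n * (C + ENNReal.ofReal δ) with hS
  have hent : ∀ u ∈ S, ∑ a, occ s a * bitEnt (freq s u a) ≤ n * (h - δ - δ₁ / 4) := by
    intro u hu
    simp only [hS, Finset.mem_filter, Finset.mem_univ, true_and] at hu
    have h1 : ent ω (freq s u) < h - δ₁ := by
      -- The cost alternative of the gap contradicts the cost bound in S, so the entropy alternative
      -- remains.
      refine (hg _ hu.1).resolve_left fun hlt => ?_
      have h2 := hs.le_seqCost (by linarith) β u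
      have h3 : ENNReal.ofReal ((1 - δ) * n) * (C + ENNReal.ofReal δ₁) <
          ENNReal.ofReal ((1 - δ) * n) * avgCost ω β (freq s u) := by
        refine (ENNReal.mul_lt_mul_iff_right ?_ ENNReal.ofReal_ne_top).2 hlt
        rw [Ne, ENNReal.ofReal_eq_zero, not_le]
        have : 0 < 1 - δ := by linarith
        positivity
      have h4 := (h3.trans_le h2).trans_le hu.2
      rw [hCc, ← ENNReal.ofReal_add hc0 hδ₁.le, ← ENNReal.ofReal_add hc0 hδ0.le,
        ← ENNReal.ofReal_natCast, ← ENNReal.ofReal_mul (by nlinarith),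
        ← ENNReal.ofReal_mul (by linarith)] at h4
      rw [ENNReal.ofReal_lt_ofReal_iff (by positivity)] at h4
      have h5 : c + δ ≤ (1 - δ) * (c + δ₁) := by nlinarith
      nlinarith
    calc ∑ a, occ s a * bitEnt (freq s u a) ≤ ∑ a, ((n * (ω a * bitEnt (freq s u a))) +
          δ * n * ω a) := by
          refine Finset.sum_le_sum fun a _ => ?_
          have h2 := (hs a).2
          have h3 := bitEnt_nonneg (freq s u a)
          have h4 := bitEnt_le_one (freq s u a)
          have h5 : (0 : ℝ) ≤ δ * (n * ω a) := by positivity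
          nlinarith
      _ = n * ent ω (freq s u) + δ * n * W := by
          rw [Finset.sum_add_distrib, ← Finset.mul_sum, ← Finset.mul_sum]; rfl
      _ ≤ n * (h - δ - δ₁ / 4) := by
          have h6 : δ * W + δ ≤ δ₁ / 4 := by nlinarith
          nlinarith
  have hfib : ∀ κ ∈ S.image (freq s),
      ((S.filter fun u => freq s u = κ).card : ℝ) ≤ 2 ^ (n * (h - δ - δ₁ / 4)) := by
    intro κ hκ
    obtain ⟨u, hu, rfl⟩ := Finset.mem_image.1 hκ
    calc _ ≤ ((Finset.univ.filter fun u' : ι → ZMod 2 => freq s u' = freq s u).card : ℝ) := by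
          exact_mod_cast Finset.card_le_card (Finset.filter_subset_filter _ (Finset.subset_univ _))
      _ ≤ _ := card_freq_le s _
      _ ≤ _ := Real.rpow_le_rpow_of_exponent_le (by norm_num) (hent u hu)
  have hcard : ((S.image (freq s)).card : ℝ) ≤ 2 ^ (n * (δ₁ / 4)) := by
    refine le_trans ?_ hpoly
    calc ((S.image (freq s)).card : ℝ) ≤ ((Fintype.card ι + 1 : ℕ) : ℝ) ^ Fintype.card A := by
          exact_mod_cast card_image_freq_le s S
      _ ≤ _ := by
          push_cast
          have := hs.card_le (by linarith)
          gcongr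
  calc (S.card : ℝ) = ∑ κ ∈ S.image (freq s), ((S.filter fun u => freq s u = κ).card : ℝ) := by
        exact_mod_cast Finset.card_eq_sum_card_image (freq s) S
    _ ≤ ∑ κ ∈ S.image (freq s), (2 : ℝ) ^ (n * (h - δ - δ₁ / 4)) := Finset.sum_le_sum hfib
    _ = (S.image (freq s)).card * (2 : ℝ) ^ (n * (h - δ - δ₁ / 4)) := by
        rw [Finset.sum_const, nsmul_eq_mul]
    _ ≤ 2 ^ (n * (δ₁ / 4)) * (2 : ℝ) ^ (n * (h - δ - δ₁ / 4)) := by gcongr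
    _ = 2 ^ (n * (h - δ)) := by
        rw [← Real.rpow_add (by norm_num)]; congr 1; ring

theorem ofReal_toReal_meanCost {β r : I} (h : meanCost β r ≠ ∞) :
    meanCost β r = ENNReal.ofReal (∑ b : ZMod 2, (bern r b : ℝ) * (bitCost β b).toReal) := by
  rw [ENNReal.ofReal_sum_of_nonneg fun b _ => mul_nonneg (bern r b).2.1 ENNReal.toReal_nonneg,
    meanCost]
  refine Finset.sum_congr rfl fun b _ => ?_
  rw [ENNReal.ofReal_mul (bern r b).2.1]
  by_cases hb : bitCost β b = ∞
  · rw [bern_eq_zero_of_meanCost h hb]; simp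
  · rw [ENNReal.ofReal_toReal hb]

theorem avgCost_eq_ofReal {ω : A → ℝ≥0} {β κ : A → I} (h : avgCost ω β κ ≠ ∞) :
    avgCost ω β κ =
      ENNReal.ofReal (∑ a, ω a * ∑ b : ZMod 2, (bern (κ a) b : ℝ) * (bitCost (β a) b).toReal) := by
  rw [ENNReal.ofReal_sum_of_nonneg fun a _ => mul_nonneg (ω a).coe_nonneg
    (Finset.sum_nonneg fun b _ => mul_nonneg (bern (κ a) b).2.1 ENNReal.toReal_nonneg), avgCost]
  refine Finset.sum_congr rfl fun a _ => ?_
  rw [ENNReal.ofReal_mul (ω a).coe_nonneg]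
  by_cases ha : ω a = 0
  · simp [ha]
  · rw [ofReal_toReal_meanCost (meanCost_ne_top_of_avgCost h ha)]
    simp

set_option maxHeartbeats 400000 in
open Classical in
/-- Many sequences have a cost at most the one attainable with a given entropy. -/
theorem exists_le_card {ω : A → ℝ≥0} {β κ : A → I} {h : ℝ} (hent : h < ent ω κ) {C : ℝ≥0∞}
    (hcost : avgCost ω β κ < C) :
    ∃ δ : ℝ, 0 < δ ∧ ∀ᶠ n : ℕ in atTop, ∀ {ι : Type} [Fintype ι] [DecidableEq ι] (s : ι → A), Typical ω δ n s →
      2 ^ (n * h) ≤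
        ((Finset.univ.filter fun u : ι → ZMod 2 => seqCost β s u ≤ n * C).card : ℝ) := by
  have hfin : avgCost ω β κ ≠ ∞ := hcost.ne_top
  set F : A → ZMod 2 → ℝ := fun a b => (bitCost (β a) b).toReal with hF
  set mF : A → ℝ := fun a => ∑ b : ZMod 2, (bern (κ a) b : ℝ) * F a b with hmF
  set L : A → ZMod 2 → ℝ := fun a b => -Real.logb 2 (bern (κ a) b) with hL
  have hmF0 : ∀ a, 0 ≤ mF a := fun a => Finset.sum_nonneg fun b _ =>
    mul_nonneg (bern _ b).2.1 ENNReal.toReal_nonneg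
  set D : ℝ := ∑ a, ω a * mF a with hD
  have hDc : avgCost ω β κ = ENNReal.ofReal D := avgCost_eq_ofReal hfin
  have hD0 : 0 ≤ D := Finset.sum_nonneg fun a _ => mul_nonneg (ω a).2 (hmF0 a)
  obtain ⟨C', hC', hCC'⟩ : ∃ C' : ℝ, D < C' ∧ ENNReal.ofReal C' ≤ C := by
    obtain ⟨x, hx1, hx2⟩ := ENNReal.lt_iff_exists_nnreal_btwn.1 hcost
    refine ⟨x, ?_, by rw [ENNReal.ofReal_coe_nnreal]; exact hx2.le⟩
    rw [hDc, ← ENNReal.ofReal_coe_nnreal] at hx1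
    exact (ENNReal.ofReal_lt_ofReal_iff_of_nonneg hD0).1 hx1
  set E : ℝ := ent ω κ with hE
  set W : ℝ := ∑ a, (ω a : ℝ) with hW
  have hW0 : 0 ≤ W := Finset.sum_nonneg fun a _ => (ω a).2
  have hE0 : 0 ≤ E := ent_nonneg κ
  -- Half of the cost margin goes to fluctuation and half to imperfect typicality. A third of the
  -- entropy margin goes to each of these, and the last third to constant factors.
  set τ : ℝ := min ((C' - D) / 2) ((E - h) / 3) with hτ
  have hτ0 : 0 < τ := lt_min (by linarith) (by linarith)
  have hτ1 : τ ≤ (C' - D) / 2 := min_le_left _ _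
  have hτ2 : τ ≤ (E - h) / 3 := min_le_right _ _
  set δ : ℝ := min 1 (τ / (D + E + 1)) with hδ
  have hδ0 : 0 < δ := lt_min one_pos (by positivity)
  have hδ1 : δ ≤ 1 := min_le_left _ _
  have hδ2 : δ * (D + E + 1) ≤ τ := by
    rw [← le_div_iff₀ (by positivity)]; exact min_le_right _ _
  set M : ℝ := ∑ a, ∑ b, ((F a b - mF a) ^ 2 + (L a b - bitEnt (κ a)) ^ 2) with hM
  have hMle : ∀ a b, (F a b - mF a) ^ 2 + (L a b - bitEnt (κ a)) ^ 2 ≤ M := by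
    intro a b
    have h1 : ∀ a, 0 ≤ ∑ b, ((F a b - mF a) ^ 2 + (L a b - bitEnt (κ a)) ^ 2) :=
      fun a => Finset.sum_nonneg fun b _ => by positivity
    exact (Finset.single_le_sum (f := fun b => (F a b - mF a) ^ 2 + (L a b - bitEnt (κ a)) ^ 2)
      (fun b _ => by positivity) (Finset.mem_univ b)).trans
      (Finset.single_le_sum (fun a _ => h1 a) (Finset.mem_univ a))
  have hM0 : 0 ≤ M := Finset.sum_nonneg fun a _ => Finset.sum_nonneg fun b _ => by positivity
  refine ⟨δ, hδ0, ?_⟩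
  have hlarge : ∀ᶠ n : ℕ in atTop, 8 * W * M / τ ^ 2 + 1 / τ + 1 ≤ n :=
    tendsto_natCast_atTop_atTop.eventually_ge_atTop _
  filter_upwards [hlarge] with n hn ι _ _ s hs
  have hWM : 0 ≤ 8 * W * M / τ ^ 2 := by positivity
  have h1τ : 0 < 1 / τ := by positivity
  have hn0 : (0 : ℝ) < n := by linarith
  set p : ι → ZMod 2 → ℝ := fun i b => bern (κ (s i)) b with hp
  have hp0 : ∀ i b, 0 ≤ p i b := fun i b => (bern _ b).2.1
  have hpsum : ∀ i, ∑ b, p i b = 1 := fun i => by rw [sum_bit]; exact bern_add _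
  have hsmall : Fintype.card ι * M / (n * τ) ^ 2 ≤ 1 / 4 := by
    have h1 := hs.card_le hδ1
    have h2 : 8 * W * M / τ ^ 2 ≤ n := by linarith
    rw [div_le_iff₀ (by positivity)] at h2 ⊢
    calc Fintype.card ι * M ≤ 2 * W * n * M := by gcongr
      _ = (8 * W * M) * (n / 4) := by ring
      _ ≤ (n * τ ^ 2) * (n / 4) := by gcongr
      _ = _ := by ring
  have hc1 := sum_filter_prod_le (p := p) (g := fun i b => F (s i) b - mF (s i)) hp0
    (fun i => by
      simp only [mul_sub, Finset.sum_sub_distrib, ← Finset.sum_mul, hpsum, one_mul]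
      exact sub_self _) (M := M)
    (fun i b => by
      rw [mul_comm]
      refine mul_le_mul_of_nonneg_right ?_ (hp0 i b)
      nlinarith [hMle (s i) b, sq_nonneg (L (s i) b - bitEnt (κ (s i)))])
    (t := n * τ) (by positivity)
  have hc2 := sum_filter_prod_le (p := p) (g := fun i b => L (s i) b - bitEnt (κ (s i))) hp0
    (fun i => by
      simp only [mul_sub, Finset.sum_sub_distrib, ← Finset.sum_mul, hpsum, one_mul]
      rw [bitEnt_eq_sum]
      exact sub_self _) (M := M)
    (fun i b => by
      rw [mul_comm]
      refine mul_le_mul_of_nonneg_right ?_ (hp0 i b)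
      nlinarith [hMle (s i) b, sq_nonneg (F (s i) b - mF (s i))])
    (t := n * τ) (by positivity)
  simp only [hpsum, Finset.prod_const_one, mul_one] at hc1 hc2
  -- Draw u from the product law of κ. The set G holds the outcomes of positive probability whose
  -- cost and log-probability are near their means; by Chebyshev it has mass at least 1/2.
  set G := Finset.univ.filter fun u : ι → ZMod 2 => (∏ i, p i (u i)) ≠ 0 ∧
    |∑ i, (F (s i) (u i) - mF (s i))| < n * τ ∧
    |∑ i, (L (s i) (u i) - bitEnt (κ (s i)))| < n * τ with hG
  have hGmass : 1 / 2 ≤ ∑ u ∈ G, ∏ i, p i (u i) := by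
    have htot : ∑ u : ι → ZMod 2, ∏ i, p i (u i) = 1 := by
      rw [sum_prod_eq]; simp only [hpsum, Finset.prod_const_one]
    have hcover : ∑ u : ι → ZMod 2, ∏ i, p i (u i) ≤ ∑ u ∈ G, ∏ i, p i (u i) +
        ∑ u ∈ Finset.univ.filter (fun u : ι → ZMod 2 =>
          n * τ ≤ |∑ i, (F (s i) (u i) - mF (s i))|), ∏ i, p i (u i) +
        ∑ u ∈ Finset.univ.filter (fun u : ι → ZMod 2 =>
          n * τ ≤ |∑ i, (L (s i) (u i) - bitEnt (κ (s i)))|), ∏ i, p i (u i) :=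
      sum_le_sum_good_add (fun u => Finset.prod_nonneg fun i _ => hp0 _ _) _ _ _
    linarith
  have hsub : G ⊆ Finset.univ.filter fun u : ι → ZMod 2 => seqCost β s u ≤ n * C := by
    intro u hu
    simp only [hG, Finset.mem_filter, Finset.mem_univ, true_and] at hu ⊢
    obtain ⟨hne, hu1, -⟩ := hu
    -- The real numbers F replace infinite costs by 0. This is harmless because a bit of infinite
    -- cost has probability zero under κ.
    have hfinite : ∀ i, bitCost (β (s i)) (u i) ≠ ∞ := by
      intro i htop
      have h1 := meanCost_ne_top_of_avgCost hfin (hs.ne_zero i)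
      have h2 := bern_eq_zero_of_meanCost h1 htop
      exact hne (Finset.prod_eq_zero (Finset.mem_univ i) (by simp [hp, h2]))
    have h1 : seqCost β s u = ENNReal.ofReal (∑ i, F (s i) (u i)) := by
      rw [ENNReal.ofReal_sum_of_nonneg fun i _ => ENNReal.toReal_nonneg]
      exact Finset.sum_congr rfl fun i _ => (ENNReal.ofReal_toReal (hfinite i)).symm
    have h2 : ∑ i, mF (s i) ≤ (1 + δ) * n * D := by
      rw [sum_occ s mF, hD, Finset.mul_sum]
      refine Finset.sum_le_sum fun a _ => ?_
      rw [nsmul_eq_mul]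
      have := mul_le_mul_of_nonneg_right (hs a).2 (hmF0 a)
      linarith
    rw [Finset.sum_sub_distrib] at hu1
    have h3 := (abs_lt.1 hu1).2
    rw [h1]
    calc _ ≤ ENNReal.ofReal (n * C') := ENNReal.ofReal_le_ofReal (by
          have h4 : δ * D ≤ τ := by nlinarith
          nlinarith)
      _ = n * ENNReal.ofReal C' := by
          rw [ENNReal.ofReal_mul hn0.le, ENNReal.ofReal_natCast]
      _ ≤ _ := by gcongr
  -- Each member of G has exponentially small probability, so a set of mass 1/2 must have many
  -- members.
  have hup : ∀ u ∈ G, ∏ i, p i (u i) ≤ 2 ^ (-(n * (h + τ))) := by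
    intro u hu
    simp only [hG, Finset.mem_filter, Finset.mem_univ, true_and] at hu
    obtain ⟨hne, -, hu2⟩ := hu
    have hpos : ∀ i, 0 < p i (u i) := fun i => lt_of_le_of_ne (hp0 _ _)
      (Ne.symm (Finset.prod_ne_zero_iff.1 hne i (Finset.mem_univ i)))
    have h1 : Real.logb 2 (∏ i, p i (u i)) = -∑ i, L (s i) (u i) := by
      rw [Real.logb_prod _ _ fun i _ => (hpos i).ne', ← Finset.sum_neg_distrib]
      exact Finset.sum_congr rfl fun i _ => by simp [hL, hp]
    have h2 : (1 - δ) * n * E ≤ ∑ i, bitEnt (κ (s i)) := by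
      rw [sum_occ s fun a => bitEnt (κ a), hE, ent, Finset.mul_sum]
      refine Finset.sum_le_sum fun a _ => ?_
      rw [nsmul_eq_mul]
      have := mul_le_mul_of_nonneg_right (hs a).1 (bitEnt_nonneg (κ a))
      linarith
    rw [Finset.sum_sub_distrib] at hu2
    have h3 := (abs_lt.1 hu2).1
    rw [← Real.rpow_logb (by norm_num : (0 : ℝ) < 2) (by norm_num)
      (Finset.prod_pos fun i _ => hpos i), h1]
    refine Real.rpow_le_rpow_of_exponent_le (by norm_num) (neg_le_neg ?_)
    have h4 : δ * E ≤ τ := by nlinarith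
    nlinarith
  have hcardG : (1 / 2 : ℝ) ≤ G.card * 2 ^ (-(n * (h + τ))) := by
    refine hGmass.trans ((Finset.sum_le_sum hup).trans (le_of_eq ?_))
    rw [Finset.sum_const, nsmul_eq_mul]
  rw [Real.rpow_neg (by norm_num), ← div_eq_mul_inv, le_div_iff₀ (by positivity)] at hcardG
  calc (2 : ℝ) ^ (n * h) ≤ 2 ^ (n * (h + τ) - 1) := by
        refine Real.rpow_le_rpow_of_exponent_le (by norm_num) ?_
        have : 1 / τ ≤ n := by linarith
        rw [div_le_iff₀ hτ0] at this
        linarith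
    _ = 1 / 2 * 2 ^ (n * (h + τ)) := by
        rw [Real.rpow_sub (by norm_num)]; norm_num; ring
    _ ≤ G.card := hcardG
    _ ≤ _ := by exact_mod_cast Finset.card_le_card hsub

end counting

/-! ### Independent samples -/

theorem iid_apply {α : Type*} (p : PMF α) : ∀ (n : ℕ) (v : Fin n → α), iid p n v = ∏ i, p (v i)
  | 0, v => by
    have : v = Fin.elim0 := Subsingleton.elim _ _
    simp [iid, this]
  | n + 1, v => by
    classical
    rw [iid, PMF.bind_apply, tsum_eq_single (v 0), PMF.bind_apply, tsum_eq_single (Fin.tail v),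
      iid_apply p n, Fin.prod_univ_succ]
    · simp [Fin.tail, Fin.cons_self_tail]
    · intro w hw
      rw [PMF.pure_apply, if_neg, mul_zero]
      intro h
      exact hw (by rw [h, Fin.tail_cons])
    · intro a ha
      rw [PMF.bind_apply, ENNReal.tsum_eq_zero.2, mul_zero]
      intro w
      rw [PMF.pure_apply, if_neg, mul_zero]
      intro h
      exact ha (by rw [h, Fin.cons_zero])

theorem iid_map {α γ : Type*} (p : PMF α) (g : α → γ) :
    ∀ n : ℕ, (iid p n).map (fun v i => g (v i)) = iid (p.map g) n
  | 0 => by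
    rw [iid, iid, PMF.pure_map]
    congr 1
    exact Subsingleton.elim _ _
  | n + 1 => by
    rw [iid, iid, PMF.map_bind, PMF.bind_map]
    congr 1
    funext a
    rw [PMF.map_bind, Function.comp_apply, ← iid_map p g n, PMF.bind_map]
    congr 1
    funext v
    rw [PMF.pure_map, Function.comp_apply]
    congr 1
    funext i
    refine Fin.cases ?_ (fun i => ?_) i <;> simp

open Classical in
theorem iid_toOuterMeasure {α : Type*} [Fintype α] (p : PMF α) (n : ℕ) (E : Set (Fin n → α)) :
    (iid p n).toOuterMeasure E =
      ENNReal.ofReal (∑ v ∈ Finset.univ.filter (· ∈ E), ∏ i, (p (v i)).toReal) := by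
  rw [PMF.toOuterMeasure_apply_fintype, ENNReal.ofReal_sum_of_nonneg
    fun v _ => Finset.prod_nonneg fun i _ => ENNReal.toReal_nonneg, Finset.sum_filter]
  refine Finset.sum_congr rfl fun v _ => ?_
  rw [Set.indicator_apply, iid_apply]
  refine if_congr Iff.rfl ?_ rfl
  rw [← ENNReal.toReal_prod, ENNReal.ofReal_toReal]
  exact ENNReal.prod_ne_top fun i _ => p.apply_ne_top _

theorem sum_toReal {α : Type*} [Fintype α] (p : PMF α) : ∑ a, (p a).toReal = 1 := by
  rw [← ENNReal.toReal_sum fun a _ => p.apply_ne_top a, ← tsum_fintype (L := .unconditional α), p.tsum_coe,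
    ENNReal.toReal_one]

/-- Chebyshev's inequality for independent samples. -/
theorem iid_chebyshev {α : Type*} [Fintype α] (p : PMF α) {n : ℕ} {g : Fin n → α → ℝ}
    (hg : ∀ i, ∑ a, (p a).toReal * g i a = 0) {M : ℝ}
    (hM : ∀ i a, (p a).toReal * g i a ^ 2 ≤ M * (p a).toReal) {t : ℝ} (ht : 0 < t) :
    (iid p n).toOuterMeasure {v | t ≤ |∑ i, g i (v i)|} ≤ ENNReal.ofReal (n * M / t ^ 2) := by
  classical
  rw [iid_toOuterMeasure]
  refine ENNReal.ofReal_le_ofReal ?_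
  have h := sum_filter_prod_le (p := fun (_ : Fin n) a => (p a).toReal) (g := g)
    (fun _ _ => ENNReal.toReal_nonneg) hg hM ht
  simp only [sum_toReal, Finset.prod_const_one, mul_one, Fintype.card_fin] at h
  exact h

/-- Chebyshev's inequality for the second coordinates of independent pairs, given the first
ones. -/
theorem iid_conditional_chebyshev {X Y B : Type*} [Fintype X] [Fintype Y] (P : PMF (X × Y)) {n : ℕ}
    (z : (Fin n → X) → Fin n → B) {g : X → B → Y → ℝ}
    (hg : ∀ x b, ∑ y, (P (x, y)).toReal * g x b y = 0) {M : ℝ}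
    (hM : ∀ x b y, (P (x, y)).toReal * g x b y ^ 2 ≤ M * (P (x, y)).toReal) {t : ℝ} (ht : 0 < t) :
    (iid P n).toOuterMeasure
      {s | t ≤ |∑ i, g (s i).1 (z (fun j => (s j).1) i) (s i).2|} ≤
        ENNReal.ofReal (n * M / t ^ 2) := by
  classical
  rw [iid_toOuterMeasure]
  refine ENNReal.ofReal_le_ofReal ?_
  rw [Finset.sum_filter, ← (Equiv.arrowProdEquivProdArrow (Fin n) (fun _ => X) (fun _ => Y)).symm.sum_comp,
    Fintype.sum_prod_type]
  simp only [Equiv.arrowProdEquivProdArrow, Equiv.coe_fn_symm_mk, Set.mem_ofPred_eq]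
  -- For fixed x the sequence z x is fixed too, and Chebyshev applies to the unnormalized weights
  -- P(x i, ·). It does not matter that each z i depends on all of x.
  calc _ ≤ ∑ x : Fin n → X, n * M / t ^ 2 * ∏ i, ∑ y, (P (x i, y)).toReal := by
        refine Finset.sum_le_sum fun x _ => ?_
        have h := sum_filter_prod_le (p := fun (i : Fin n) y => (P (x i, y)).toReal)
          (g := fun i y => g (x i) (z x i) y) (fun _ _ => ENNReal.toReal_nonneg)
          (fun i => hg _ _) (fun i y => hM _ _ _) ht
        rw [Finset.sum_filter, Fintype.card_fin] at h
        exact h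
    _ = n * M / t ^ 2 := by
        rw [← Finset.mul_sum, sum_prod_eq fun (_ : Fin n) x => ∑ y, (P (x, y)).toReal]
        simp only [← Fintype.sum_prod_type fun s : X × Y => (P s).toReal]
        simp [sum_toReal]

/-- The point masses of a distribution, as nonnegative reals. -/
def mass {α : Type*} (p : PMF α) (a : α) : ℝ≥0 := (p a).toNNReal

theorem coe_mass {α : Type*} (p : PMF α) (a : α) : (mass p a : ℝ≥0∞) = p a :=
  ENNReal.coe_toNNReal (p.apply_ne_top a)

theorem mass_toReal {α : Type*} (p : PMF α) (a : α) : (mass p a : ℝ) = (p a).toReal := rfl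

theorem mass_eq_zero {α : Type*} {p : PMF α} {a : α} : mass p a = 0 ↔ p a = 0 := by
  rw [← ENNReal.coe_eq_zero, coe_mass]

/-- The law of large numbers for the letter counts. -/
theorem eventually_typical {α : Type*} [Fintype α] (p : PMF α) {δ : ℝ} (hδ : 0 < δ) {η : ℝ≥0∞}
    (hη : η ≠ 0) :
    ∀ᶠ n : ℕ in atTop, (iid p n).toOuterMeasure {v | ¬ Typical (mass p) δ n v} ≤ η := by
  classical
  -- A letter of mass zero contributes 1/0 = 0. Such letters almost surely do not occur, so they are
  -- left out of the union bound below.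
  set S : ℝ := ∑ a, 1 / (δ * (p a).toReal) ^ 2 with hS
  have hS0 : 0 ≤ S := Finset.sum_nonneg fun a _ => by positivity
  have hlim : Tendsto (fun n : ℕ => ENNReal.ofReal (S / n)) atTop (𝓝 0) := by
    have := ENNReal.tendsto_ofReal (tendsto_const_div_atTop_nhds_zero_nat S)
    simpa using this
  filter_upwards [hlim.eventually (gt_mem_nhds (pos_iff_ne_zero.2 hη)), eventually_ge_atTop 1]
    with n hn hn1
  have hn0 : (0 : ℝ) < n := by exact_mod_cast hn1
  refine le_trans ?_ hn.le
  let g : α → α → ℝ := fun a b => (if b = a then 1 else 0) - (p a).toReal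
  have hgsum : ∀ (a : α) (v : Fin n → α), ∑ i, g a (v i) = occ v a - n * (p a).toReal := by
    intro a v
    simp only [g, Finset.sum_sub_distrib, Finset.sum_const, Finset.card_univ, Fintype.card_fin,
      nsmul_eq_mul, occ, Finset.card_filter, Nat.cast_sum]
    simp
  calc (iid p n).toOuterMeasure {v | ¬ Typical (mass p) δ n v} ≤
        (iid p n).toOuterMeasure (⋃ a ∈ Finset.univ.filter (fun a => p a ≠ 0),
          {v | n * (δ * (p a).toReal) ≤ |∑ i, g a (v i)|}) := by
        refine PMF.toOuterMeasure_mono _ ?_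
        rintro v ⟨hv, hsupp⟩
        rw [PMF.mem_support_iff, iid_apply, Finset.prod_ne_zero_iff] at hsupp
        by_contra hcon
        simp only [Finset.mem_filter, Finset.mem_univ, true_and, Set.mem_iUnion,
          Set.mem_ofPred_eq, not_exists, not_le] at hcon
        refine hv fun a => ?_
        by_cases ha : p a = 0
        · have h0 : occ v a = 0 := by
            rw [occ, Finset.card_eq_zero, Finset.filter_eq_empty_iff]
            rintro i - h
            exact hsupp i (Finset.mem_univ i) (h ▸ ha)
          simp [h0, mass, ha]
        · have h1 := hcon a ha
          rw [hgsum, abs_lt] at h1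
          rw [mass_toReal]
          constructor <;> nlinarith [h1.1, h1.2]
    _ ≤ ∑ a ∈ Finset.univ.filter (fun a => p a ≠ 0),
          (iid p n).toOuterMeasure {v | n * (δ * (p a).toReal) ≤ |∑ i, g a (v i)|} :=
        MeasureTheory.measure_biUnion_finset_le _ _
    _ ≤ ∑ a ∈ Finset.univ.filter (fun a => p a ≠ 0),
          ENNReal.ofReal (1 / (δ * (p a).toReal) ^ 2 / n) := by
        refine Finset.sum_le_sum fun a ha => ?_
        have ha' : p a ≠ 0 := by simpa using ha
        have hpos : 0 < (p a).toReal := ENNReal.toReal_pos ha' (p.apply_ne_top a)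
        have hle : (p a).toReal ≤ 1 := by
          rw [← sum_toReal p]
          exact Finset.single_le_sum (f := fun a => (p a).toReal)
            (fun _ _ => ENNReal.toReal_nonneg) (Finset.mem_univ a)
        refine (iid_chebyshev p (g := fun _ => g a) (M := 1) (fun _ => ?_) (fun _ b => ?_)
          (by positivity)).trans (ENNReal.ofReal_le_ofReal (le_of_eq ?_))
        · simp only [g, mul_sub, Finset.sum_sub_distrib, ← Finset.sum_mul, sum_toReal]
          simp
        · rw [mul_comm]
          refine mul_le_mul_of_nonneg_right ?_ ENNReal.toReal_nonneg
          rw [sq_le_one_iff_abs_le_one, abs_le]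
          simp only [g]
          split_ifs <;> constructor <;> linarith
        · field_simp
    _ ≤ ∑ a, ENNReal.ofReal (1 / (δ * (p a).toReal) ^ 2 / n) :=
        Finset.sum_le_sum_of_subset (Finset.filter_subset _ _)
    _ = ENNReal.ofReal (S / n) := by
        rw [← ENNReal.ofReal_sum_of_nonneg fun a _ => by positivity, hS, Finset.sum_div]

/-! ### Independent triples -/

section joint

variable {α γ θ : Type*}

/-- The law of three independent random variables. -/
def jointLaw (p : PMF α) (q : PMF γ) (r : PMF θ) : PMF (α × γ × θ) :=
  p.bind fun a => q.bind fun b => r.bind fun c => PMF.pure (a, b, c)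

theorem bind_toOuterMeasure_le {p : PMF α} {f : α → PMF γ} {E : Set γ} {ε : ℝ≥0∞}
    (h : ∀ a, (f a).toOuterMeasure E ≤ ε) : (p.bind f).toOuterMeasure E ≤ ε := by
  rw [PMF.toOuterMeasure_bind_apply]
  calc _ ≤ ∑' a, p a * ε := ENNReal.tsum_le_tsum fun a => by gcongr; exact h a
    _ = ε := by rw [ENNReal.tsum_mul_right, p.tsum_coe, one_mul]

/-- Conditioning on the other two variables: by independence a bound that is uniform in them passes
to the joint law. -/
theorem jointLaw_le_first {p : PMF α} {q : PMF γ} {r : PMF θ} {E : Set (α × γ × θ)} {ε : ℝ≥0∞}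
    (h : ∀ b c, p.toOuterMeasure {a | (a, b, c) ∈ E} ≤ ε) :
    (jointLaw p q r).toOuterMeasure E ≤ ε := by
  have : jointLaw p q r = q.bind fun b => r.bind fun c => p.map fun a => (a, b, c) := by
    rw [jointLaw, PMF.bind_comm]
    congr 1; funext b
    rw [PMF.bind_comm]; rfl
  rw [this]
  refine bind_toOuterMeasure_le fun b => bind_toOuterMeasure_le fun c => ?_
  rw [PMF.toOuterMeasure_map_apply]
  exact h b c

theorem jointLaw_le_second {p : PMF α} {q : PMF γ} {r : PMF θ} {E : Set (α × γ × θ)} {ε : ℝ≥0∞}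
    (h : ∀ a c, q.toOuterMeasure {b | (a, b, c) ∈ E} ≤ ε) :
    (jointLaw p q r).toOuterMeasure E ≤ ε := by
  have : jointLaw p q r = p.bind fun a => r.bind fun c => q.map fun b => (a, b, c) := by
    rw [jointLaw]
    congr 1; funext a
    rw [PMF.bind_comm]; rfl
  rw [this]
  refine bind_toOuterMeasure_le fun b => bind_toOuterMeasure_le fun c => ?_
  rw [PMF.toOuterMeasure_map_apply]
  exact h b c

theorem jointLaw_le_third {p : PMF α} {q : PMF γ} {r : PMF θ} {E : Set (α × γ × θ)} {ε : ℝ≥0∞}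
    (h : ∀ a b, r.toOuterMeasure {c | (a, b, c) ∈ E} ≤ ε) :
    (jointLaw p q r).toOuterMeasure E ≤ ε := by
  have : jointLaw p q r = p.bind fun a => q.bind fun b => r.map fun c => (a, b, c) := rfl
  rw [this]
  refine bind_toOuterMeasure_le fun b => bind_toOuterMeasure_le fun c => ?_
  rw [PMF.toOuterMeasure_map_apply]
  exact h b c

theorem jointLaw_map_third {θ' : Type*} (p : PMF α) (q : PMF γ) (r : PMF θ) (g : θ → θ') :
    jointLaw p q (r.map g) = (jointLaw p q r).map fun w => (w.1, w.2.1, g w.2.2) := by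
  simp only [jointLaw, PMF.map_bind, PMF.bind_map, PMF.pure_map]
  rfl

end joint

theorem uniform_toOuterMeasure {n : ℕ} (q : GL (Fin n) (ZMod 2) → Prop) [DecidablePred q] :
    (PMF.uniformOfFintype (GL (Fin n) (ZMod 2))).toOuterMeasure {H | q H} =
      ENNReal.ofReal (glProb q) := by
  rw [PMF.toOuterMeasure_uniformOfFintype_apply, glProb, ENNReal.ofReal_div_of_pos card_GL_pos,
    ENNReal.ofReal_natCast, ENNReal.ofReal_natCast, Fintype.card_subtype]
  rfl

/-! ### Random coding bounds -/

section coding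

variable {k l : ℕ}

/-- The parity bits of `z`: the last `l` bits of `z Hᵀ`. -/
def parity (H : GL (Fin (k + l)) (ZMod 2)) (z : Fin (k + l) → ZMod 2) : Fin l → ZMod 2 :=
  fun j => ((H : Matrix (Fin (k + l)) (Fin (k + l)) (ZMod 2)) *ᵥ z) (Fin.natAdd k j)

/-- The message bits of `z`: the first `k` bits of `z Hᵀ`. -/
def messageBits (H : GL (Fin (k + l)) (ZMod 2)) (z : Fin (k + l) → ZMod 2) : Fin k → ZMod 2 :=
  fun i => ((H : Matrix (Fin (k + l)) (Fin (k + l)) (ZMod 2)) *ᵥ z) (Fin.castAdd l i)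

/-- The bits of `z`, followed by its parity bits. -/
def word (H : GL (Fin (k + l)) (ZMod 2)) (z : Fin (k + l) → ZMod 2) :
    Fin (k + l) ⊕ Fin l → ZMod 2 :=
  Sum.elim z (parity H z)

/-- The bits of `z`, followed by the last `l` bits of `w`. -/
def pairWord (t : (Fin (k + l) → ZMod 2) × (Fin (k + l) → ZMod 2)) :
    Fin (k + l) ⊕ Fin l → ZMod 2 :=
  Sum.elim t.1 fun j => t.2 (Fin.natAdd k j)

theorem pairWord_ext {t t' : (Fin (k + l) → ZMod 2) × (Fin (k + l) → ZMod 2)}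
    (h : pairWord t = pairWord t') (h' : ∀ i, t.2 (Fin.castAdd l i) = t'.2 (Fin.castAdd l i)) :
    t = t' := by
  refine Prod.ext (funext fun i => congrFun h (Sum.inl i)) (funext fun i => ?_)
  refine Fin.addCases (fun i => h' i) (fun j => ?_) i
  exact congrFun h (Sum.inr j)

/-- A word fixes z and the last l bits of its image; the first k bits, which form the message, are
free. -/
theorem card_pairWord (U : Finset (Fin (k + l) ⊕ Fin l → ZMod 2)) :
    (Finset.univ.filter fun t : (Fin (k + l) → ZMod 2) × (Fin (k + l) → ZMod 2) =>
      pairWord t ∈ U).card = U.card * 2 ^ k := by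
  have : (U ×ˢ (Finset.univ : Finset (Fin k → ZMod 2))).card = U.card * 2 ^ k := by
    rw [Finset.card_product, Finset.card_univ]; simp
  rw [← this]
  refine Finset.card_bij (fun t _ => (pairWord t, fun i => t.2 (Fin.castAdd l i))) ?_ ?_ ?_
  · intro t ht
    simpa using ht
  · intro t _ t' _ h
    rw [Prod.mk.injEq] at h
    exact pairWord_ext h.1 (congrFun h.2)
  · rintro ⟨u, m⟩ hu
    simp only [Finset.mem_product, Finset.mem_univ, and_true] at hu
    have hw : pairWord (k := k) (fun i => u (Sum.inl i), Fin.append m fun j => u (Sum.inr j)) = u := by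
      funext i
      rcases i with i | j <;> simp [pairWord]
    refine ⟨(fun i => u (Sum.inl i), Fin.append m fun j => u (Sum.inr j)), ?_, ?_⟩
    · simpa [hw] using hu
    · simp only [hw, Prod.mk.injEq, true_and]
      funext i; simp

theorem measure_exists_word_le (hn : 1 ≤ k + l) (U : Finset (Fin (k + l) ⊕ Fin l → ZMod 2)) :
    (PMF.uniformOfFintype (GL (Fin (k + l)) (ZMod 2))).toOuterMeasure
      {H | ∃ z, z ≠ 0 ∧ word H z ∈ U} ≤
        ENNReal.ofReal (U.card * 2 ^ k / (2 ^ (k + l) - 1)) := by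
  classical
  rw [uniform_toOuterMeasure]
  refine ENNReal.ofReal_le_ofReal ?_
  have h2 : (2 : ℝ) ^ (k + l) ≥ 2 := by
    simpa using pow_le_pow_right₀ (by norm_num : (1 : ℝ) ≤ 2) hn
  set T := Finset.univ.filter fun t : (Fin (k + l) → ZMod 2) × (Fin (k + l) → ZMod 2) =>
    t.1 ≠ 0 ∧ pairWord t ∈ U with hT
  have h := glProb_exists_le hn T (fun t ht => by
    simp only [hT, Finset.mem_filter, Finset.mem_univ, true_and] at ht; exact ht.1)
  refine le_trans (le_of_eq ?_) (h.trans ?_)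
  · congr 1
    ext H
    constructor
    · rintro ⟨z, hz, hzU⟩
      exact ⟨(z, (H : Matrix _ _ (ZMod 2)) *ᵥ z), by
        simp only [hT, Finset.mem_filter, Finset.mem_univ, true_and]
        exact ⟨hz, hzU⟩, rfl⟩
    · rintro ⟨⟨z, w⟩, ht, hw⟩
      simp only [hT, Finset.mem_filter, Finset.mem_univ, true_and] at ht
      refine ⟨z, ht.1, ?_⟩
      have := ht.2
      simp only at hw
      rw [← hw] at this
      exact this
  · refine div_le_div_of_nonneg_right ?_ (by linarith)
    have : T.card ≤ U.card * 2 ^ k := by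
      rw [← card_pairWord U]
      exact Finset.card_le_card fun t => by
        simp only [hT, Finset.mem_filter, Finset.mem_univ, true_and]; exact fun h => h.2
    exact_mod_cast this

/-- With the message prescribed, the word determines the whole image, so the factor 2^k disappears.
This covers the pairs of vectors one of which is zero. -/
theorem measure_exists_word_zero_message_le (hn : 1 ≤ k + l)
    (U : Finset (Fin (k + l) ⊕ Fin l → ZMod 2)) :
    (PMF.uniformOfFintype (GL (Fin (k + l)) (ZMod 2))).toOuterMeasure
      {H | ∃ z, z ≠ 0 ∧ word H z ∈ U ∧ messageBits H z = 0} ≤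
        ENNReal.ofReal (U.card / (2 ^ (k + l) - 1)) := by
  classical
  rw [uniform_toOuterMeasure]
  refine ENNReal.ofReal_le_ofReal ?_
  have h2 : (2 : ℝ) ^ (k + l) ≥ 2 := by
    simpa using pow_le_pow_right₀ (by norm_num : (1 : ℝ) ≤ 2) hn
  set T := Finset.univ.filter fun t : (Fin (k + l) → ZMod 2) × (Fin (k + l) → ZMod 2) =>
    t.1 ≠ 0 ∧ pairWord t ∈ U ∧ ∀ i, t.2 (Fin.castAdd l i) = 0 with hT
  have h := glProb_exists_le hn T (fun t ht => by
    simp only [hT, Finset.mem_filter, Finset.mem_univ, true_and] at ht; exact ht.1)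
  refine le_trans (le_of_eq ?_) (h.trans ?_)
  · congr 1
    ext H
    constructor
    · rintro ⟨z, hz, hzU, hm⟩
      refine ⟨(z, (H : Matrix _ _ (ZMod 2)) *ᵥ z), ?_, rfl⟩
      simp only [hT, Finset.mem_filter, Finset.mem_univ, true_and]
      exact ⟨hz, hzU, fun i => congrFun hm i⟩
    · rintro ⟨⟨z, w⟩, ht, hw⟩
      simp only [hT, Finset.mem_filter, Finset.mem_univ, true_and] at ht hw
      subst hw
      exact ⟨z, ht.1, ht.2.1, funext ht.2.2⟩
  · refine div_le_div_of_nonneg_right ?_ (by linarith)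
    have : T.card ≤ U.card := by
      refine Finset.card_le_card_of_injOn pairWord (fun t ht => ?_) (fun t ht t' ht' htt => ?_)
      · simp only [hT, Finset.coe_filter, Finset.mem_univ, true_and, Set.mem_ofPred_eq] at ht
        exact ht.2.1
      · simp only [hT, Finset.coe_filter, Finset.mem_univ, true_and, Set.mem_ofPred_eq] at ht ht'
        exact pairWord_ext htt fun i => (ht.2.2 i).trans (ht'.2.2 i).symm
    exact_mod_cast this

/-- The two images share their message bits, so the free choice of these bits counts once. -/
theorem measure_exists_two_words_le (hn : 2 ≤ k + l)
    (U U' : Finset (Fin (k + l) ⊕ Fin l → ZMod 2)) :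
    (PMF.uniformOfFintype (GL (Fin (k + l)) (ZMod 2))).toOuterMeasure
      {H | ∃ z z', z ≠ 0 ∧ z' ≠ 0 ∧ z ≠ z' ∧ word H z ∈ U ∧ word H z' ∈ U' ∧
        messageBits H z = messageBits H z'} ≤
        ENNReal.ofReal (U.card * U'.card * 2 ^ k / ((2 ^ (k + l) - 1) * (2 ^ (k + l) - 2))) := by
  classical
  rw [uniform_toOuterMeasure]
  refine ENNReal.ofReal_le_ofReal ?_
  have h4 : (2 : ℝ) ^ (k + l) ≥ 4 := by
    have := pow_le_pow_right₀ (by norm_num : (1 : ℝ) ≤ 2) hn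
    norm_num at this ⊢; exact this
  set T := Finset.univ.filter fun t : ((Fin (k + l) → ZMod 2) × (Fin (k + l) → ZMod 2)) ×
      ((Fin (k + l) → ZMod 2) × (Fin (k + l) → ZMod 2)) =>
    (t.1.1 ≠ 0 ∧ t.2.1 ≠ 0 ∧ t.1.1 ≠ t.2.1) ∧ pairWord t.1 ∈ U ∧ pairWord t.2 ∈ U' ∧
      ∀ i, t.1.2 (Fin.castAdd l i) = t.2.2 (Fin.castAdd l i) with hT
  have h := glProb_exists_pair_le hn T (fun t ht => by
    simp only [hT, Finset.mem_filter, Finset.mem_univ, true_and] at ht; exact ht.1)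
  refine le_trans (le_of_eq ?_) (h.trans ?_)
  · congr 1
    ext H
    constructor
    · rintro ⟨z, z', hz, hz', hne, hU, hU', hm⟩
      refine ⟨((z, (H : Matrix _ _ (ZMod 2)) *ᵥ z), (z', (H : Matrix _ _ (ZMod 2)) *ᵥ z')), ?_,
        rfl, rfl⟩
      simp only [hT, Finset.mem_filter, Finset.mem_univ, true_and]
      exact ⟨⟨hz, hz', hne⟩, hU, hU', fun i => congrFun hm i⟩
    · rintro ⟨⟨⟨z, w⟩, ⟨z', w'⟩⟩, ht, hw, hw'⟩
      simp only [hT, Finset.mem_filter, Finset.mem_univ, true_and] at ht hw hw'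
      subst hw
      subst hw'
      exact ⟨z, z', ht.1.1, ht.1.2.1, ht.1.2.2, ht.2.1, ht.2.2.1, funext ht.2.2.2⟩
  · refine div_le_div_of_nonneg_right ?_ (mul_nonneg (by linarith) (by linarith))
    have : T.card ≤ U.card * U'.card * 2 ^ k := by
      have hc : ((U ×ˢ U') ×ˢ (Finset.univ : Finset (Fin k → ZMod 2))).card =
          U.card * U'.card * 2 ^ k := by
        rw [Finset.card_product, Finset.card_product, Finset.card_univ]; simp
      rw [← hc]
      refine Finset.card_le_card_of_injOn
        (fun t => ((pairWord t.1, pairWord t.2), fun i => t.1.2 (Fin.castAdd l i)))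
        (fun t ht => ?_) (fun t ht t' ht' htt => ?_)
      · simp only [hT, Finset.coe_filter, Finset.mem_univ, true_and, Set.mem_ofPred_eq] at ht
        simp [ht.2.1, ht.2.2.1]
      · simp only [hT, Finset.coe_filter, Finset.mem_univ, true_and, Set.mem_ofPred_eq] at ht ht'
        simp only [Prod.mk.injEq] at htt
        have h1 := congrFun htt.2
        exact Prod.ext (pairWord_ext htt.1.1 h1) (pairWord_ext htt.1.2 fun i =>
          (ht.2.2.2 i).symm.trans ((h1 i).trans (ht'.2.2.2 i)))
    exact_mod_cast this

theorem measure_forall_word_le (hn : 2 ≤ k + l) (U : Finset (Fin (k + l) ⊕ Fin l → ZMod 2))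
    (hU : (2 : ℝ) * 2 ^ (k + l) < U.card * 2 ^ k) :
    (PMF.uniformOfFintype (GL (Fin (k + l)) (ZMod 2))).toOuterMeasure
      {H | ∀ z, word H z ∉ U} ≤
        ENNReal.ofReal ((2 ^ (k + l) - 1) / (U.card * 2 ^ k - 2 * 2 ^ (k + l)) +
          1 / (2 ^ (k + l) - 2)) := by
  classical
  rw [uniform_toOuterMeasure]
  refine ENNReal.ofReal_le_ofReal ?_
  have h4 : (2 : ℝ) ^ (k + l) ≥ 4 := by
    have := pow_le_pow_right₀ (by norm_num : (1 : ℝ) ≤ 2) hn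
    norm_num at this ⊢; exact this
  set T := Finset.univ.filter fun t : (Fin (k + l) → ZMod 2) × (Fin (k + l) → ZMod 2) =>
    (t.1 ≠ 0 ∧ t.2 ≠ 0) ∧ pairWord t ∈ U with hT
  -- The second moment bound requires nonzero vectors and nonzero images. Discarding the other pairs
  -- costs at most 2 · 2^n.
  have hcard : U.card * 2 ^ k ≤ T.card + 2 * 2 ^ (k + l) := by
    rw [← card_pairWord U]
    have hV : (Finset.univ : Finset (Fin (k + l) → ZMod 2)).card = 2 ^ (k + l) := by
      rw [Finset.card_univ]; simp
    have h1 : (({0} : Finset (Fin (k + l) → ZMod 2)) ×ˢ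
        (Finset.univ : Finset (Fin (k + l) → ZMod 2))).card = 2 ^ (k + l) := by
      rw [Finset.card_product, hV]; simp
    have h2 : ((Finset.univ : Finset (Fin (k + l) → ZMod 2)) ×ˢ
        ({0} : Finset (Fin (k + l) → ZMod 2))).card = 2 ^ (k + l) := by
      rw [Finset.card_product, hV]; simp
    calc _ ≤ (T ∪ (({0} : Finset (Fin (k + l) → ZMod 2)) ×ˢ Finset.univ ∪
          Finset.univ ×ˢ ({0} : Finset (Fin (k + l) → ZMod 2)))).card := by
          refine Finset.card_le_card fun t => ?_
          simp only [hT, Finset.mem_filter, Finset.mem_univ, true_and, Finset.mem_union,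
            Finset.mem_product, Finset.mem_singleton, and_true]
          tauto
      _ ≤ T.card + (2 ^ (k + l) + 2 ^ (k + l)) := by
          refine (Finset.card_union_le _ _).trans ?_
          gcongr
          refine (Finset.card_union_le _ _).trans ?_
          rw [h1, h2]
      _ = _ := by ring
  have hcard' : (U.card : ℝ) * 2 ^ k ≤ T.card + 2 * 2 ^ (k + l) := by exact_mod_cast hcard
  have hTpos : (0 : ℝ) < T.card := by linarith
  have h := glProb_forall_ne_le hn T (fun t ht => by
    simp only [hT, Finset.mem_filter, Finset.mem_univ, true_and] at ht; exact ht.1)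
    (by exact_mod_cast hTpos)
  refine le_trans ?_ (h.trans ?_)
  · unfold glProb
    refine div_le_div_of_nonneg_right ?_ card_GL_pos.le
    have : ∀ H : GL (Fin (k + l)) (ZMod 2), (∀ z, word H z ∉ U) → ∀ t ∈ T,
        (H : Matrix (Fin (k + l)) (Fin (k + l)) (ZMod 2)) *ᵥ t.1 ≠ t.2 := by
      rintro H hH ⟨z, w⟩ ht hw
      simp only [hT, Finset.mem_filter, Finset.mem_univ, true_and] at ht hw
      subst hw
      exact hH z ht.2
    exact_mod_cast Finset.card_le_card (Finset.monotone_filter_right _ fun H _ => this H)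
  · gcongr
    · linarith
    · linarith

end coding

/-! ### Optimality of the selected vectors -/

section query

variable {f : (n : ℕ) → GL (Fin n) (ZMod 2) → (Fin n → I) → (Fin n → I) → Fin n → ZMod 2} {k l : ℕ}

theorem weight_eq {n : ℕ} (q : Fin n → I) (u : Fin n → ZMod 2) :
    weight q u = ((∏ i, bern (q i) (u i) : I) : ℝ) := by
  rw [weight]
  exact (map_prod (⟨⟨fun x : I => (x : ℝ), rfl⟩, fun _ _ => rfl⟩ : I →* ℝ) _ _).symm

/-- The total cost is `-log₂` of the product of the two weights, and `-log₂` is antitone on [0,1],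
with value ∞ at weight zero. -/
theorem query_cost_le (hf : IsQuery f) (H : GL (Fin (k + l)) (ZMod 2)) (p : Fin (k + l) → I)
    (b : Fin k → I) (q : Fin l → I) (z : Fin (k + l) → ZMod 2) :
    (∑ i, bitCost (p i) (f (k + l) H p (Fin.append b q) i)) +
      (∑ i, bitCost (b i) (messageBits H (f (k + l) H p (Fin.append b q)) i) +
        ∑ j, bitCost (q j) (parity H (f (k + l) H p (Fin.append b q)) j)) ≤
    (∑ i, bitCost (p i) (z i)) +
      (∑ i, bitCost (b i) (messageBits H z i) + ∑ j, bitCost (q j) (parity H z j)) := by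
  have key : ∀ z : Fin (k + l) → ZMod 2, (∑ i, bitCost (p i) (z i)) +
      (∑ i, bitCost (b i) (messageBits H z i) + ∑ j, bitCost (q j) (parity H z j)) =
      negLog ((∏ i, bern (p i) (z i)) * ∏ i, bern (Fin.append b q i)
        ((z ᵥ* (H : Matrix (Fin (k + l)) (Fin (k + l)) (ZMod 2))ᵀ) i)) := by
    intro z
    rw [negLog_mul, negLog_prod, negLog_prod, Matrix.vecMul_transpose]
    congr 1
    rw [Fin.sum_univ_add]
    simp only [Fin.append_left, Fin.append_right]
    rfl
  rw [key, key]
  refine negLog_antitone ?_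
  have h := hf (k + l) H p (Fin.append b q) z
  rw [weight_eq, weight_eq, weight_eq, weight_eq] at h
  exact_mod_cast h

end query

/-! ### Asymptotic form of the random coding bounds -/

/-- `k` message bits at rate `R` and block length `n = k + l`. -/
def Scale (R : ℝ) (n k l : ℕ) : Prop := k + l = n ∧ (k : ℝ) ≤ n * R ∧ n * R ≤ k + 1

theorem eventually_le_two_rpow (B : ℝ) {δ : ℝ} (hδ : 0 < δ) :
    ∀ᶠ n : ℕ in atTop, B ≤ (2 : ℝ) ^ (n * δ) := by
  have h1 : (1 : ℝ) < 2 ^ δ := Real.one_lt_rpow (by norm_num) hδ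
  filter_upwards [(tendsto_pow_atTop_atTop_of_one_lt h1).eventually_ge_atTop B] with n hn
  rwa [mul_comm, Real.rpow_mul (by norm_num), Real.rpow_natCast]

theorem Scale.le_length {R : ℝ} {n k l : ℕ} (h : Scale R n k l) : n * (1 - R) ≤ l := by
  have : (n : ℝ) = k + l := by exact_mod_cast h.1.symm
  linarith [h.2.1]

theorem Scale.length_le {R : ℝ} {n k l : ℕ} (h : Scale R n k l) : (l : ℝ) ≤ n * (1 - R) + 1 := by
  have : (n : ℝ) = k + l := by exact_mod_cast h.1.symm
  linarith [h.2.2]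

theorem Scale.two_pow_le {R : ℝ} {n k l : ℕ} (h : Scale R n k l) :
    (2 : ℝ) ^ k ≤ 2 ^ (n * R) := by
  rw [← Real.rpow_natCast]
  exact Real.rpow_le_rpow_of_exponent_le (by norm_num) h.2.1

theorem Scale.le_two_pow {R : ℝ} {n k l : ℕ} (h : Scale R n k l) :
    (2 : ℝ) ^ (n * R) / 2 ≤ 2 ^ k := by
  have : (2 : ℝ) ^ (n * R - 1) ≤ 2 ^ k := by
    rw [← Real.rpow_natCast 2 k]
    exact Real.rpow_le_rpow_of_exponent_le (by norm_num) (by linarith [h.2.2])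
  rwa [Real.rpow_sub (by norm_num), Real.rpow_one] at this

theorem two_rpow_mul (n : ℕ) (a b : ℝ) :
    (2 : ℝ) ^ (n * a) * 2 ^ (n * b) = 2 ^ (n * (a + b)) := by
  rw [← Real.rpow_add (by norm_num), mul_add]

theorem two_rpow_one_sub (n : ℕ) (δ : ℝ) :
    (2 : ℝ) ^ (n * (1 - δ)) = 2 ^ n / 2 ^ (n * δ) := by
  rw [mul_sub, Real.rpow_sub (by norm_num), mul_one, Real.rpow_natCast]

theorem two_rpow_one_add (n : ℕ) (δ : ℝ) :
    (2 : ℝ) ^ (n * (1 + δ)) = 2 ^ n * 2 ^ (n * δ) := by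
  rw [mul_add, Real.rpow_add (by norm_num), mul_one, Real.rpow_natCast]

theorem two_rpow_one_sub_le {n : ℕ} {δ η : ℝ} (hη : 0 < η) (h : 1 / η ≤ (2 : ℝ) ^ (n * δ)) :
    (2 : ℝ) ^ (n * (1 - δ)) ≤ 2 ^ n * η := by
  rw [two_rpow_one_sub, div_le_iff₀ (by positivity), mul_assoc]
  rw [div_le_iff₀ hη] at h
  nlinarith [pow_pos (two_pos : (0 : ℝ) < 2) n]

theorem four_le_two_pow {n : ℕ} (hn : 2 ≤ n) : (4 : ℝ) ≤ 2 ^ n := by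
  have := pow_le_pow_right₀ (by norm_num : (1 : ℝ) ≤ 2) hn
  norm_num at this ⊢; exact this

theorem eventually_exists_word_le {R δ η : ℝ} (hδ : 0 < δ) (hη : 0 < η) :
    ∀ᶠ n : ℕ in atTop, ∀ k l, Scale R n k l → ∀ U : Finset (Fin (k + l) ⊕ Fin l → ZMod 2),
      (U.card : ℝ) ≤ 2 ^ (n * (1 - R - δ)) →
      (PMF.uniformOfFintype (GL (Fin (k + l)) (ZMod 2))).toOuterMeasure
        {H | ∃ z, z ≠ 0 ∧ word H z ∈ U} ≤ ENNReal.ofReal η := by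
  filter_upwards [eventually_le_two_rpow (1 / (η / 2)) hδ, eventually_ge_atTop 2]
    with n hn hn2 k l hs U hU
  have h4 := four_le_two_pow hn2
  obtain rfl := hs.1
  refine (measure_exists_word_le (by omega) U).trans (ENNReal.ofReal_le_ofReal ?_)
  rw [div_le_iff₀ (by linarith)]
  calc (U.card : ℝ) * 2 ^ k ≤ 2 ^ (((k + l : ℕ) : ℝ) * (1 - R - δ)) * 2 ^ (((k + l : ℕ) : ℝ) * R) :=
        mul_le_mul hU hs.two_pow_le (by positivity) (by positivity)
    _ = 2 ^ (((k + l : ℕ) : ℝ) * (1 - δ)) := by rw [two_rpow_mul]; congr 2; ring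
    _ ≤ 2 ^ (k + l) * (η / 2) := two_rpow_one_sub_le (by positivity) hn
    _ ≤ _ := by nlinarith

theorem eventually_forall_word_le {R δ η : ℝ} (hδ : 0 < δ) (hη : 0 < η) :
    ∀ᶠ n : ℕ in atTop, ∀ k l, Scale R n k l → ∀ U : Finset (Fin (k + l) ⊕ Fin l → ZMod 2),
      2 ^ (n * (1 - R + δ)) ≤ (U.card : ℝ) →
      (PMF.uniformOfFintype (GL (Fin (k + l)) (ZMod 2))).toOuterMeasure
        {H | ∀ z, word H z ∉ U} ≤ ENNReal.ofReal η := by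
  filter_upwards [eventually_le_two_rpow (4 + 4 / η) hδ,
    eventually_le_two_rpow (2 + 2 / η) one_pos, eventually_ge_atTop 2] with n hn hn1 hn2 k l hs U hU
  have h4 := four_le_two_pow hn2
  rw [mul_one, Real.rpow_natCast] at hn1
  obtain rfl := hs.1
  have hη4 : 0 < 4 / η := by positivity
  have h1 : (2 : ℝ) ^ (k + l) * (4 + 4 / η) / 2 ≤ U.card * 2 ^ k := by
    calc (2 : ℝ) ^ (k + l) * (4 + 4 / η) / 2 ≤ 2 ^ (k + l) * 2 ^ (((k + l : ℕ) : ℝ) * δ) / 2 := by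
          gcongr
      _ = 2 ^ (((k + l : ℕ) : ℝ) * (1 - R + δ)) * (2 ^ (((k + l : ℕ) : ℝ) * R) / 2) := by
          rw [← mul_div_assoc, two_rpow_mul, ← two_rpow_one_add]; congr 3; ring
      _ ≤ _ := mul_le_mul hU hs.le_two_pow (by positivity) (by positivity)
  have h2 : (2 : ℝ) ^ (k + l) * (2 / η) ≤ U.card * 2 ^ k - 2 * 2 ^ (k + l) := by
    have : (2 : ℝ) ^ (k + l) * (4 + 4 / η) / 2 = 2 * 2 ^ (k + l) + 2 ^ (k + l) * (2 / η) := by ring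
    linarith
  have h3 : 0 < (2 : ℝ) ^ (k + l) * (2 / η) := by positivity
  refine (measure_forall_word_le (by omega) U (by linarith)).trans (ENNReal.ofReal_le_ofReal ?_)
  have e1 : (2 ^ (k + l) - 1) / ((U.card : ℝ) * 2 ^ k - 2 * 2 ^ (k + l)) ≤ η / 2 := by
    rw [div_le_iff₀ (by linarith)]
    have : η / 2 * (2 ^ (k + l) * (2 / η)) = (2 : ℝ) ^ (k + l) := by field_simp
    nlinarith
  have e2 : 1 / ((2 : ℝ) ^ (k + l) - 2) ≤ η / 2 := by
    have h5 : 2 / η ≤ (2 : ℝ) ^ (k + l) - 2 := by linarith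
    rw [div_le_iff₀ (by linarith)]
    rw [div_le_iff₀ hη] at h5
    linarith
  linarith

/-- For nonzero vectors the expected number of pairs has exponent η₁ - δ < 0. The condition η₁ < R
serves the case z' = 0, and δ > 0 serves the case z = 0. -/
theorem eventually_two_words_le {R η₁ δ η : ℝ} (h1 : η₁ < δ) (h2 : η₁ < R) (hδ : 0 < δ)
    (hη : 0 < η) :
    ∀ᶠ n : ℕ in atTop, ∀ k l, Scale R n k l → ∀ U U' : Finset (Fin (k + l) ⊕ Fin l → ZMod 2),
      (U.card : ℝ) ≤ 2 ^ (n * (1 - R + η₁)) → (U'.card : ℝ) ≤ 2 ^ (n * (1 - δ)) →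
      (PMF.uniformOfFintype (GL (Fin (k + l)) (ZMod 2))).toOuterMeasure
        {H | ∃ z z', z ≠ z' ∧ word H z ∈ U ∧ word H z' ∈ U' ∧
          messageBits H z = messageBits H z'} ≤ ENNReal.ofReal η := by
  -- Each of three events gets η/3; the further factor 4 absorbs the passage from (2^n - 1)(2^n - 2)
  -- to 4^n.
  filter_upwards [eventually_le_two_rpow (1 / (η / 12)) (sub_pos.2 h1),
    eventually_le_two_rpow (1 / (η / 12)) (sub_pos.2 h2),
    eventually_le_two_rpow (1 / (η / 12)) hδ, eventually_ge_atTop 2]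
    with n hn hn' hn'' hn2 k l hs U U' hU hU'
  have h4 := four_le_two_pow hn2
  obtain rfl := hs.1
  have hη12 : 0 < η / 12 := by positivity
  set μ := (PMF.uniformOfFintype (GL (Fin (k + l)) (ZMod 2))).toOuterMeasure with hμ
  have hsub : {H : GL (Fin (k + l)) (ZMod 2) | ∃ z z', z ≠ z' ∧ word H z ∈ U ∧ word H z' ∈ U' ∧
      messageBits H z = messageBits H z'} ⊆
      {H | ∃ z z', z ≠ 0 ∧ z' ≠ 0 ∧ z ≠ z' ∧ word H z ∈ U ∧ word H z' ∈ U' ∧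
        messageBits H z = messageBits H z'} ∪
      ({H | ∃ z, z ≠ 0 ∧ word H z ∈ U ∧ messageBits H z = 0} ∪
        {H | ∃ z, z ≠ 0 ∧ word H z ∈ U' ∧ messageBits H z = 0}) := by
    rintro H ⟨z, z', hne, hz, hz', hm⟩
    have h0 : messageBits H 0 = 0 := by
      funext i; simp [messageBits]
    by_cases hz0 : z = 0
    · subst hz0
      exact Or.inr (Or.inr ⟨z', hne.symm, hz', by rw [← hm, h0]⟩)
    by_cases hz0' : z' = 0
    · subst hz0'
      exact Or.inr (Or.inl ⟨z, hz0, hz, by rw [hm, h0]⟩)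
    exact Or.inl ⟨z, z', hz0, hz0', hne, hz, hz', hm⟩
  refine (MeasureTheory.measure_mono hsub).trans ((MeasureTheory.measure_union_le _ _).trans
    ((add_le_add le_rfl (MeasureTheory.measure_union_le _ _)).trans ?_))
  have e1 : μ {H | ∃ z z', z ≠ 0 ∧ z' ≠ 0 ∧ z ≠ z' ∧ word H z ∈ U ∧ word H z' ∈ U' ∧
      messageBits H z = messageBits H z'} ≤ ENNReal.ofReal (η / 3) := by
    refine (measure_exists_two_words_le (by omega) U U').trans (ENNReal.ofReal_le_ofReal ?_)
    rw [div_le_iff₀ (mul_pos (by linarith) (by linarith))]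
    calc (U.card : ℝ) * U'.card * 2 ^ k ≤ 2 ^ (((k + l : ℕ) : ℝ) * (1 - R + η₁)) *
          2 ^ (((k + l : ℕ) : ℝ) * (1 - δ)) * 2 ^ (((k + l : ℕ) : ℝ) * R) :=
          mul_le_mul (mul_le_mul hU hU' (by positivity) (by positivity)) hs.two_pow_le
            (by positivity) (by positivity)
      _ = 2 ^ (((k + l : ℕ) : ℝ) * (1 + (1 - (δ - η₁)))) := by
          rw [two_rpow_mul, two_rpow_mul]; congr 2; ring
      _ = 2 ^ (k + l) * 2 ^ (((k + l : ℕ) : ℝ) * (1 - (δ - η₁))) := two_rpow_one_add _ _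
      _ ≤ 2 ^ (k + l) * (2 ^ (k + l) * (η / 12)) := by
          gcongr; exact two_rpow_one_sub_le hη12 hn
      _ ≤ _ := by
          have : (2 : ℝ) ^ (k + l) * 2 ^ (k + l) ≤
            4 * ((2 ^ (k + l) - 1) * (2 ^ (k + l) - 2)) := by nlinarith
          nlinarith
  have e2 : μ {H | ∃ z, z ≠ 0 ∧ word H z ∈ U ∧ messageBits H z = 0} ≤ ENNReal.ofReal (η / 3) := by
    refine (measure_exists_word_zero_message_le (by omega) U).trans (ENNReal.ofReal_le_ofReal ?_)
    rw [div_le_iff₀ (by linarith)]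
    calc (U.card : ℝ) ≤ 2 ^ (((k + l : ℕ) : ℝ) * (1 - (R - η₁))) := by
          refine hU.trans (le_of_eq ?_); congr 2; ring
      _ ≤ 2 ^ (k + l) * (η / 12) := two_rpow_one_sub_le hη12 hn'
      _ ≤ _ := by nlinarith
  have e3 : μ {H | ∃ z, z ≠ 0 ∧ word H z ∈ U' ∧ messageBits H z = 0} ≤ ENNReal.ofReal (η / 3) := by
    refine (measure_exists_word_zero_message_le (by omega) U').trans (ENNReal.ofReal_le_ofReal ?_)
    rw [div_le_iff₀ (by linarith)]
    calc (U'.card : ℝ) ≤ _ := hU'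
      _ ≤ 2 ^ (k + l) * (η / 12) := two_rpow_one_sub_le hη12 hn''
      _ ≤ _ := by nlinarith
  refine (add_le_add e1 (add_le_add e2 e3)).trans (le_of_eq ?_)
  rw [← ENNReal.ofReal_add (by positivity) (by positivity),
    ← ENNReal.ofReal_add (by positivity) (by positivity)]
  congr 1; ring

/-! ### Typicality of the source sequence and the parity biases -/

section typical

variable {X Y S : Type*}

theorem occ_map_inl {m m' : ℕ} (x : Fin m → X) (q : Fin m' → S) (a : X) :
    occ (Sum.map x q) (Sum.inl a) = occ x a := by
  classical
  simp only [occ, Finset.card_filter, Fintype.sum_sum_type]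
  simp

theorem occ_map_inr {m m' : ℕ} (x : Fin m → X) (q : Fin m' → S) (c : S) :
    occ (Sum.map x q) (Sum.inr c) = occ q c := by
  classical
  simp only [occ, Finset.card_filter, Fintype.sum_sum_type]
  simp

/-- The weights of the letters of the combined alphabet: source symbols and parity biases. -/
def sumWeight (p : PMF X) (r : ℝ≥0) (pS : PMF S) : X ⊕ S → ℝ≥0 :=
  Sum.elim (mass p) fun c => r * mass pS c

/-- The number l of parity bits exceeds n(1-R) by at most 1. Typicality of q within δ/2 leaves room
for this difference once n is large. -/
theorem eventually_typical_sum {R : ℝ} (hR1 : R < 1) (p : PMF X) (pS : PMF S) {δ : ℝ} (hδ : 0 < δ)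
    (hδ1 : δ ≤ 1) :
    ∀ᶠ n : ℕ in atTop, ∀ k l, Scale R n k l → ∀ (x : Fin (k + l) → X) (q : Fin l → S),
      Typical (mass p) δ n x → Typical (mass pS) (δ / 2) l q →
        Typical (sumWeight p (1 - R).toNNReal pS) δ n (Sum.map x q) := by
  have hR : 0 < 1 - R := by linarith
  have hcast : ((1 - R).toNNReal : ℝ) = 1 - R := Real.coe_toNNReal _ hR.le
  filter_upwards [tendsto_natCast_atTop_atTop.eventually_ge_atTop (3 / (δ * (1 - R)))]
    with n hn k l hs x q hx hq a
  rw [div_le_iff₀ (by positivity)] at hn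
  have h1 := hs.le_length
  have h2 := hs.length_le
  rcases a with a | c
  · rw [occ_map_inl]
    exact hx a
  · rw [occ_map_inr]
    obtain ⟨h3, h4⟩ := hq c
    simp only [sumWeight, Sum.elim_inr, NNReal.coe_mul, hcast]
    have h5 : (0 : ℝ) ≤ mass pS c := (mass pS c).2
    constructor
    · calc (1 - δ) * (n * ((1 - R) * mass pS c)) = (1 - δ) * (n * (1 - R)) * mass pS c := by ring
        _ ≤ (1 - δ / 2) * l * mass pS c := by
            refine mul_le_mul_of_nonneg_right ?_ h5
            have : (0 : ℝ) ≤ n * (1 - R) := by positivity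
            nlinarith
        _ ≤ _ := by linarith
    · calc (occ q c : ℝ) ≤ (1 + δ / 2) * l * mass pS c := by linarith
        _ ≤ (1 + δ) * (n * (1 - R)) * mass pS c := by
            refine mul_le_mul_of_nonneg_right ?_ h5
            nlinarith
        _ = _ := by ring

variable [Fintype X] [Fintype Y] [Fintype S]

theorem map_fst_apply (P : PMF (X × Y)) (a : X) : P.map Prod.fst a = ∑ y, P (a, y) := by
  classical
  rw [PMF.map_apply, tsum_fintype, Fintype.sum_prod_type, Finset.sum_eq_single a]
  · simp
  · intro b _ hb
    simp [Ne.symm hb]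
  · simp

theorem map_snd_apply (P : PMF (X × Y)) (a : Y) : P.map Prod.snd a = ∑ x, P (x, a) := by
  classical
  rw [PMF.map_apply, tsum_fintype, Fintype.sum_prod_type_right, Finset.sum_eq_single a]
  · simp
  · intro b _ hb
    simp [Ne.symm hb]
  · simp

theorem toReal_map_fst (P : PMF (X × Y)) (a : X) :
    (P.map Prod.fst a).toReal = ∑ y, (P (a, y)).toReal := by
  rw [map_fst_apply, ENNReal.toReal_sum fun y _ => P.apply_ne_top _]

theorem toReal_map_snd (P : PMF (X × Y)) (a : Y) :
    (P.map Prod.snd a).toReal = ∑ x, (P (x, a)).toReal := by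
  rw [map_snd_apply, ENNReal.toReal_sum fun y _ => P.apply_ne_top _]

/-- The bounds are multiplicative, so they add up over the second coordinate with the same δ. -/
theorem Typical.fst {P : PMF (X × Y)} {δ : ℝ} {m n : ℕ} {s : Fin m → X × Y}
    (h : Typical (mass P) δ n s) :
    Typical (mass (P.map Prod.fst)) δ n fun i => (s i).1 := by
  classical
  intro a
  have h1 : occ (fun i => (s i).1) a = ∑ y, occ s (a, y) := by
    simp only [occ, Finset.card_filter]
    rw [Finset.sum_comm]
    refine Finset.sum_congr rfl fun i _ => ?_
    simp only [Prod.ext_iff, ite_and]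
    simp
  rw [h1, mass_toReal, toReal_map_fst, Nat.cast_sum, Finset.mul_sum, Finset.mul_sum, Finset.mul_sum]
  exact ⟨Finset.sum_le_sum fun y _ => (h (a, y)).1, Finset.sum_le_sum fun y _ => (h (a, y)).2⟩

theorem Typical.snd {P : PMF (X × Y)} {δ : ℝ} {m n : ℕ} {s : Fin m → X × Y}
    (h : Typical (mass P) δ n s) :
    Typical (mass (P.map Prod.snd)) δ n fun i => (s i).2 := by
  classical
  intro a
  have h1 : occ (fun i => (s i).2) a = ∑ x, occ s (x, a) := by
    simp only [occ, Finset.card_filter]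
    rw [Finset.sum_comm]
    refine Finset.sum_congr rfl fun i _ => ?_
    simp only [Prod.ext_iff, ite_and]
    simp
  rw [h1, mass_toReal, toReal_map_snd, Nat.cast_sum, Finset.mul_sum, Finset.mul_sum, Finset.mul_sum]
  exact ⟨Finset.sum_le_sum fun y _ => (h (y, a)).1, Finset.sum_le_sum fun y _ => (h (y, a)).2⟩

theorem eventually_typical_length {R : ℝ} (hR1 : R < 1) (pS : PMF S) {δ η : ℝ} (hδ : 0 < δ)
    (hη : 0 < η) :
    ∀ᶠ n : ℕ in atTop, ∀ k l, Scale R n k l →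
      (iid pS l).toOuterMeasure {q | ¬ Typical (mass pS) δ l q} ≤ ENNReal.ofReal η := by
  have hR : 0 < 1 - R := by linarith
  obtain ⟨m, hm⟩ := eventually_atTop.1 (eventually_typical pS hδ (ENNReal.ofReal_pos.2 hη).ne')
  filter_upwards [tendsto_natCast_atTop_atTop.eventually_ge_atTop ((m : ℝ) / (1 - R))]
    with n hn k l hs
  rw [div_le_iff₀ hR] at hn
  exact hm l (by exact_mod_cast hn.trans hs.le_length)

end typical

/-! ### Costs of the vectors selected by the encoder and the decoder -/

theorem seqCost_sum {X S : Type*} {m m' : ℕ} (β : X → I) (b : S → I) (x : Fin m → X)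
    (q : Fin m' → S) (z : Fin m → ZMod 2) (v : Fin m' → ZMod 2) :
    seqCost (Sum.elim β b) (Sum.map x q) (Sum.elim z v) =
      ∑ i, bitCost (β (x i)) (z i) + ∑ j, bitCost (b (q j)) (v j) := by
  simp [seqCost, Fintype.sum_sum_type]

theorem jointOcc_sum_inl {X S : Type*} {m m' : ℕ} (x : Fin m → X) (q : Fin m' → S)
    (z : Fin m → ZMod 2) (v : Fin m' → ZMod 2) (a : X) (u : ZMod 2) :
    jointOcc (Sum.map x q) (Sum.elim z v) (Sum.inl a) u = jointOcc x z a u := by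
  classical
  simp only [jointOcc, Finset.card_filter, Fintype.sum_sum_type]
  simp

section selected

variable {X Y S : Type*}
  {f : (n : ℕ) → GL (Fin n) (ZMod 2) → (Fin n → I) → (Fin n → I) → Fin n → ZMod 2}
  {pe : X → I} {pd : Y → I} {b : S → I} {k l : ℕ}

theorem message_eq (H : GL (Fin (k + l)) (ZMod 2)) (q : Fin l → I) (x : Fin (k + l) → X) :
    message f pe H q x = messageBits H (encWord f pe H q x) := by
  funext i
  rw [message, messageBits, Matrix.vecMul_transpose]

/-- The k message bits have bias 1/2 and cost exactly k for every vector; this finite constant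
cancels. -/
theorem encWord_cost_le (hf : IsQuery f) (H : GL (Fin (k + l)) (ZMod 2)) (x : Fin (k + l) → X)
    (q : Fin l → S) (z : Fin (k + l) → ZMod 2) :
    seqCost (Sum.elim pe b) (Sum.map x q) (word H (encWord f pe H (fun j => b (q j)) x)) ≤
      seqCost (Sum.elim pe b) (Sum.map x q) (word H z) := by
  have h := query_cost_le hf H (fun i => pe (x i)) (fun _ => half) (fun j => b (q j)) z
  simp only [bitCost_half, Finset.sum_const, Finset.card_univ, Fintype.card_fin, nsmul_eq_mul,
    mul_one] at h
  simp only [word, seqCost_sum]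
  rw [add_left_comm, add_left_comm _ (k : ℝ≥0∞)] at h
  exact (ENNReal.add_le_add_iff_left (ENNReal.natCast_ne_top k)).1 h

theorem bitCost_bitVal_self (u : ZMod 2) : bitCost (bitVal u) u = 0 := by
  rw [bitCost, bern_bitVal, if_pos rfl, negLog_one]

theorem bitCost_bitVal_of_ne {u v : ZMod 2} (h : v ≠ u) : bitCost (bitVal u) v = ∞ := by
  rw [bitCost, bern_bitVal, if_neg h, negLog_zero]

/-- With deterministic message biases a single wrong message bit costs ∞. Since z itself has the
right message and finite cost, the decoder's choice has the right message as well. -/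
theorem decWord_cost_le (hf : IsQuery f) (H : GL (Fin (k + l)) (ZMod 2)) (y : Fin (k + l) → Y)
    (q : Fin l → S) (z : Fin (k + l) → ZMod 2)
    (hz : seqCost (Sum.elim pd b) (Sum.map y q) (word H z) ≠ ∞) :
    messageBits H (decWord f pd H (fun j => b (q j)) (messageBits H z) y) = messageBits H z ∧
      seqCost (Sum.elim pd b) (Sum.map y q)
        (word H (decWord f pd H (fun j => b (q j)) (messageBits H z) y)) ≤
          seqCost (Sum.elim pd b) (Sum.map y q) (word H z) := by
  have h := query_cost_le hf H (fun i => pd (y i)) (fun i => bitVal (messageBits H z i))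
    (fun j => b (q j)) z
  simp only [bitCost_bitVal_self, Finset.sum_const_zero] at h
  simp only [word, seqCost_sum] at hz ⊢
  rw [add_left_comm, zero_add] at h
  have hsum := ne_top_of_le_ne_top hz (le_self_add.trans h)
  rw [ENNReal.sum_ne_top] at hsum
  refine ⟨funext fun i => ?_, le_add_self.trans h⟩
  by_contra hne
  exact hsum i (Finset.mem_univ i) (bitCost_bitVal_of_ne hne)

end selected

theorem eq_bitVal_of_bern {r : I} {u : ZMod 2} (h : bern r u = 0) : r = bitVal (u + 1) := by
  rcases bit_cases u with rfl | rfl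
  · have : r = 1 := by simpa using h
    rw [this]; simp [bitVal]
  · have : r = 0 := by simpa using h
    rw [this]; exact (if_neg (by decide)).symm

theorem bitEnt_bitVal (u : ZMod 2) : bitEnt (bitVal u) = 0 := by
  rw [bitEnt_eq_zero]
  rcases bit_cases u with rfl | rfl
  · left; simp [bitVal]
  · right; simp [bitVal]

/-- A deterministic letter of the optimum takes the strictly cheaper value. -/
theorem IsUMin.bitCost_lt {A : Type*} [Fintype A] {ω : A → ℝ≥0} {β κ : A → I} {h : ℝ}
    (hκ : IsUMin ω β h κ) {a : A} (ha : ω a ≠ 0) {u : ZMod 2} (hu : bern (κ a) u = 0) :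
    bitCost (β a) (u + 1) < bitCost (β a) u := by
  classical
  by_contra hle
  rw [not_lt] at hle
  have hκa := eq_bitVal_of_bern hu
  have h1 := hκ.2 (Function.update κ a (bitVal u)) (hκ.1.trans (le_of_eq ?_)) ?_ a ha
  · rw [Function.update_self] at h1
    rw [← h1, bern_bitVal, if_pos rfl] at hu
    exact one_ne_zero hu
  · refine Finset.sum_congr rfl fun c _ => ?_
    by_cases hc : c = a
    · subst hc
      rw [Function.update_self, hκa, bitEnt_bitVal, bitEnt_bitVal]
    · rw [Function.update_of_ne hc]
  · refine Finset.sum_le_sum fun c _ => ?_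
    by_cases hc : c = a
    · subst hc
      rw [Function.update_self, hκa, meanCost_bitVal, meanCost_bitVal]
      gcongr
    · rw [Function.update_of_ne hc]

/-! ### Existence of a vector of nearly optimal cost -/

section achievability

variable {X Y S : Type*} [Fintype X] [Fintype S]

theorem ent_sumWeight (p : PMF X) {R : ℝ} (hR1 : R < 1) (pS : PMF S) (κ : X ⊕ S → I) :
    ent (sumWeight p (1 - R).toNNReal pS) κ =
      ∑ a, (p a).toReal * bitEnt (κ (Sum.inl a)) +
        (1 - R) * ∑ c, (pS c).toReal * bitEnt (κ (Sum.inr c)) := by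
  have hcast : ((1 - R).toNNReal : ℝ) = 1 - R := Real.coe_toNNReal _ (by linarith)
  simp only [ent, sumWeight, Fintype.sum_sum_type, Sum.elim_inl, Sum.elim_inr, mass_toReal,
    NNReal.coe_mul, hcast, Finset.mul_sum, mul_assoc]

theorem avgCost_sumWeight (p : PMF X) (r : ℝ≥0) (pS : PMF S) (pe : X → I) (b : S → I)
    (κ : X ⊕ S → I) :
    avgCost (sumWeight p r pS) (Sum.elim pe b) κ =
      ∑ a, p a * meanCost (pe a) (κ (Sum.inl a)) +
        r * ∑ c, pS c * meanCost (b c) (κ (Sum.inr c)) := by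
  simp only [avgCost, sumWeight, Fintype.sum_sum_type, Sum.elim_inl, Sum.elim_inr, coe_mass,
    ENNReal.coe_mul, Finset.mul_sum, mul_assoc]

theorem sum_sumWeight_ite (p : PMF X) {R : ℝ} (hR1 : R < 1) (pS : PMF S) (q : X ⊕ S → Prop)
    [DecidablePred q] :
    (∑ a, if q a then (sumWeight p (1 - R).toNNReal pS a : ℝ) else 0) =
      (∑ a, if q (Sum.inl a) then (p a).toReal else 0) +
        (1 - R) * ∑ c, if q (Sum.inr c) then (pS c).toReal else 0 := by
  have hcast : ((1 - R).toNNReal : ℝ) = 1 - R := Real.coe_toNNReal _ (by linarith)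
  simp only [sumWeight, Fintype.sum_sum_type, Sum.elim_inl, Sum.elim_inr, mass_toReal,
    NNReal.coe_mul, hcast, Finset.mul_sum, mul_ite, mul_zero]

open Classical in
/-- If the weight of the biases in `(0, 1)` equals the entropy requirement, then `p_e` takes the
values `0`, `1`, and the parity biases lie in `(0, 1)`. In this case the cost of the vector given
by `p_e` concentrates, since the law of the parity biases is symmetric. -/
theorem measure_parity_cost_le {R : ℝ} (hR1 : R < 1) {p : PMF X} {pS : PMF S} {pe : X → I}
    {b : S → I} {κ : X ⊕ S → I} {C : ℝ≥0∞}
    (hU : IsUMin (sumWeight p (1 - R).toNNReal pS) (Sum.elim pe b) (1 - R) κ)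
    (hC : avgCost (sumWeight p (1 - R).toNNReal pS) (Sum.elim pe b) κ = C) (hfin : C ≠ ∞)
    (hsymm : ∑ c, pS c * bitCost (b c) 0 = ∑ c, pS c * bitCost (b c) 1)
    (hb : ∀ c, pS c ≠ 0 → 0 < b c ∧ b c < 1) (hp : ∀ a, p a ≠ 0 → pe a = 0 ∨ pe a = 1)
    {δ η : ℝ} (hδ : 0 < δ) (hη : 0 < η) :
    ∀ᶠ n : ℕ in atTop, ∀ k l, Scale R n k l → ∀ (x : Fin (k + l) → X), (∀ i, p (x i) ≠ 0) →
      ∀ H : GL (Fin (k + l)) (ZMod 2),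
      (iid pS l).toOuterMeasure {q | (∀ j, pS (q j) ≠ 0) ∧ ∀ z, n * (C + ENNReal.ofReal δ) <
        seqCost (Sum.elim pe b) (Sum.map x q) (word H z)} ≤ ENNReal.ofReal η := by
  have hR : 0 < 1 - R := by linarith
  set F : S → ZMod 2 → ℝ := fun c u => (bitCost (b c) u).toReal with hF
  have hF0 : ∀ c u, 0 ≤ F c u := fun c u => ENNReal.toReal_nonneg
  have hFc : ∀ c u, pS c ≠ 0 → bitCost (b c) u = ENNReal.ofReal (F c u) := fun c u hc =>
    (ENNReal.ofReal_toReal (bitCost_ne_top (hb c hc).1 (hb c hc).2 u)).symm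
  have hFsum : ∀ u, ∑ c, pS c * bitCost (b c) u = ENNReal.ofReal (∑ c, (pS c).toReal * F c u) := by
    intro u
    rw [ENNReal.ofReal_sum_of_nonneg fun c _ => mul_nonneg ENNReal.toReal_nonneg (hF0 c u)]
    refine Finset.sum_congr rfl fun c _ => ?_
    rw [ENNReal.ofReal_mul ENNReal.toReal_nonneg, ENNReal.ofReal_toReal (pS.apply_ne_top c)]
    by_cases hc : pS c = 0
    · simp [hc]
    · rw [hFc c u hc]
  set m : ℝ := ∑ c, (pS c).toReal * F c 0 with hm
  have hm0 : 0 ≤ m := Finset.sum_nonneg fun c _ => mul_nonneg ENNReal.toReal_nonneg (hF0 c 0)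
  have hmu : ∀ u, ∑ c, (pS c).toReal * F c u = m := by
    intro u
    rcases bit_cases u with rfl | rfl
    · rfl
    · rw [hFsum, hFsum] at hsymm
      exact ((ENNReal.ofReal_eq_ofReal_iff hm0 (Finset.sum_nonneg fun c _ =>
        mul_nonneg ENNReal.toReal_nonneg (hF0 c 1))).1 hsymm).symm
  -- Deterministic source biases force deterministic source bits, so the parity bits have to supply
  -- the whole entropy 1-R, a full bit each.
  have hnu : ∀ c, pS c ≠ 0 → κ (Sum.inr c) = half := by
    have h1 := hU.1
    rw [ent_sumWeight p hR1] at h1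
    have h2 : ∑ a, (p a).toReal * bitEnt (κ (Sum.inl a)) = 0 := by
      refine Finset.sum_eq_zero fun a _ => ?_
      by_cases ha : p a = 0
      · simp [ha]
      · have hω : sumWeight p (1 - R).toNNReal pS (Sum.inl a) ≠ 0 := by
          simpa [sumWeight, mass_eq_zero] using ha
        have h3 := eq_bias_of_meanCost (meanCost_ne_top_of_avgCost (hC ▸ hfin) hω) (hp a ha)
        rw [h3, Sum.elim_inl, bitEnt_eq_zero.2 (hp a ha), mul_zero]
    rw [h2, zero_add] at h1
    have h4 : 1 ≤ ∑ c, (pS c).toReal * bitEnt (κ (Sum.inr c)) := by nlinarith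
    intro c hc
    by_contra hne
    have h5 : ∑ c, (pS c).toReal * bitEnt (κ (Sum.inr c)) < ∑ c, (pS c).toReal := by
      refine Finset.sum_lt_sum (fun c _ => mul_le_of_le_one_right ENNReal.toReal_nonneg
        (bitEnt_le_one _)) ⟨c, Finset.mem_univ c, ?_⟩
      have h6 : bitEnt (κ (Sum.inr c)) < 1 :=
        lt_of_le_of_ne (bitEnt_le_one _) fun h => hne (bitEnt_eq_one.1 h)
      exact mul_lt_of_lt_one_right (ENNReal.toReal_pos hc (pS.apply_ne_top c)) h6
    rw [sum_toReal] at h5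
    linarith
  -- By symmetry both bit values have mean cost m, so uniform parity bits cost (1-R) m.
  have hCle : ENNReal.ofReal ((1 - R) * m) ≤ C := by
    rw [← hC, avgCost_sumWeight]
    refine le_trans (le_of_eq ?_) le_add_self
    rw [ENNReal.ofReal_mul hR.le, hm, ← hFsum]
    congr 1
    have h7 : ∀ c, pS c * meanCost (b c) (κ (Sum.inr c)) =
        ENNReal.ofReal (1 / 2) * (pS c * bitCost (b c) 0) +
          ENNReal.ofReal (1 / 2) * (pS c * bitCost (b c) 1) := by
      intro c
      by_cases hc : pS c = 0
      · simp [hc]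
      · rw [hnu c hc, meanCost, sum_bit, bern_half, bern_half, half]
        ring
    simp only [h7, Finset.sum_add_distrib, ← Finset.mul_sum]
    rw [← hsymm, ← add_mul, ← ENNReal.ofReal_add (by norm_num) (by norm_num)]
    norm_num
  set M : ℝ := ∑ c, ∑ u, (F c u - m) ^ 2 with hM
  have hMle : ∀ c u, (F c u - m) ^ 2 ≤ M := fun c u =>
    (Finset.single_le_sum (f := fun u => (F c u - m) ^ 2) (fun _ _ => sq_nonneg _)
      (Finset.mem_univ u)).trans (Finset.single_le_sum (f := fun c => ∑ u, (F c u - m) ^ 2)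
      (fun c _ => Finset.sum_nonneg fun _ _ => sq_nonneg _) (Finset.mem_univ c))
  have hM0 : 0 ≤ M := Finset.sum_nonneg fun c _ => Finset.sum_nonneg fun _ _ => sq_nonneg _
  filter_upwards [tendsto_natCast_atTop_atTop.eventually_ge_atTop (2 * m / δ),
    tendsto_natCast_atTop_atTop.eventually_ge_atTop (4 * M / (δ ^ 2 * η)),
    eventually_ge_atTop 1] with n hn hn' hn1 k l hs x hx H
  have hn0 : (0 : ℝ) < n := by exact_mod_cast hn1
  -- The vector dictated by the deterministic biases costs nothing on the source part. Its parity
  -- bits depend on H, but each has mean cost m whatever its value.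
  let z₀ : Fin (k + l) → ZMod 2 := fun i => if pe (x i) = 1 then 1 else 0
  have hz₀ : ∀ i, bitCost (pe (x i)) (z₀ i) = 0 := by
    intro i
    rcases hp _ (hx i) with h | h
    · have : z₀ i = 0 := by simp [z₀, h]
      rw [this, h, bitCost, bern_zero]; simp [negLog_one]
    · have : z₀ i = 1 := by simp [z₀, h]
      rw [this, h, bitCost, bern_one]; exact negLog_one
  refine le_trans (PMF.toOuterMeasure_mono _ (t := {q | n * (δ / 2) ≤
    |∑ j, (F (q j) (parity H z₀ j) - m)|}) ?_) (le_trans (iid_chebyshev pS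
      (g := fun j c => F c (parity H z₀ j) - m) (M := M) (fun j => ?_) (fun j c => ?_)
      (by positivity)) (ENNReal.ofReal_le_ofReal ?_))
  · rintro q ⟨⟨hq, hall⟩, -⟩
    have h1 := hall z₀
    rw [word, seqCost_sum] at h1
    simp only [hz₀, Finset.sum_const_zero, zero_add] at h1
    rw [Finset.sum_congr rfl fun j _ => hFc (q j) (parity H z₀ j) (hq j),
      ← ENNReal.ofReal_sum_of_nonneg fun j _ => hF0 _ _] at h1
    have h2 : ENNReal.ofReal (n * ((1 - R) * m + δ)) <
        ENNReal.ofReal (∑ j, F (q j) (parity H z₀ j)) := by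
      refine lt_of_le_of_lt ?_ h1
      rw [ENNReal.ofReal_mul hn0.le, ENNReal.ofReal_natCast, ENNReal.ofReal_add (by positivity)
        hδ.le]
      gcongr
    have h3 := (ENNReal.ofReal_lt_ofReal_iff_of_nonneg (by positivity)).1 h2
    change n * (δ / 2) ≤ |_|
    refine le_trans ?_ (le_abs_self _)
    rw [Finset.sum_sub_distrib, Finset.sum_const, Finset.card_univ, Fintype.card_fin, nsmul_eq_mul]
    have h4 := mul_le_mul_of_nonneg_right hs.length_le hm0
    rw [div_le_iff₀ hδ] at hn
    linarith
  · simp only [mul_sub, Finset.sum_sub_distrib, ← Finset.sum_mul, sum_toReal, hmu]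
    ring
  · rw [mul_comm]
    exact mul_le_mul_of_nonneg_right (hMle _ _) ENNReal.toReal_nonneg
  · rw [div_le_iff₀ (by positivity)]
    rw [div_le_iff₀ (by positivity)] at hn'
    have hl : (l : ℝ) ≤ n := by
      have : (n : ℝ) = k + l := by exact_mod_cast hs.1.symm
      have : (0 : ℝ) ≤ k := Nat.cast_nonneg k
      linarith
    calc (l : ℝ) * M ≤ n * M := by gcongr
      _ ≤ n * (n * (δ ^ 2 * η) / 4) := by gcongr; linarith
      _ = _ := by ring

open Classical in
-- If biases in (0,1) have weight above 1-R, slightly more cost buys entropy above 1-R, and the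
-- second moment method over the random matrix gives a cheap word. In the case of equality the
-- randomness of the parity biases is used instead.
theorem eventually_exists_cost_le {R : ℝ} (hR1 : R < 1) {P : PMF (X × Y)} {pS : PMF S}
    {pe : X → I} {b : S → I} {κ : X ⊕ S → I} {C : ℝ≥0∞}
    (hU : IsUMin (sumWeight (P.map Prod.fst) (1 - R).toNNReal pS) (Sum.elim pe b) (1 - R) κ)
    (hC : avgCost (sumWeight (P.map Prod.fst) (1 - R).toNNReal pS) (Sum.elim pe b) κ = C)
    (hfin : C ≠ ∞) (hsymm : ∑ c, pS c * bitCost (b c) 0 = ∑ c, pS c * bitCost (b c) 1)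
    (hb₁ : (∑ a, if 0 < Sum.elim pe b a ∧ Sum.elim pe b a < 1 then
        (sumWeight (P.map Prod.fst) (1 - R).toNNReal pS a : ℝ) else 0) = 1 - R →
      ∀ c, pS c ≠ 0 → 0 < b c ∧ b c < 1)
    {δ η : ℝ} (hδ : 0 < δ) (hη : 0 < η) :
    ∃ δ' : ℝ, 0 < δ' ∧ ∀ᶠ n : ℕ in atTop, ∀ k l, Scale R n k l →
      (jointLaw (PMF.uniformOfFintype (GL (Fin (k + l)) (ZMod 2))) (iid P (k + l))
        (iid pS l)).toOuterMeasure {ω |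
          Typical (sumWeight (P.map Prod.fst) (1 - R).toNNReal pS) δ' n
            (Sum.map (fun i => (ω.2.1 i).1) ω.2.2) ∧
          ∀ z, n * (C + ENNReal.ofReal δ) < seqCost (Sum.elim pe b)
            (Sum.map (fun i => (ω.2.1 i).1) ω.2.2) (word ω.1 z)} ≤ ENNReal.ofReal η := by
  have hR : 0 < 1 - R := by linarith
  set ω₀ := sumWeight (P.map Prod.fst) (1 - R).toNNReal pS with hω₀
  -- At finite cost, letters with bias 0 or 1 carry no entropy, so the others must supply all of it,
  -- at most one bit each.
  have hle : 1 - R ≤ ∑ a, if 0 < Sum.elim pe b a ∧ Sum.elim pe b a < 1 then (ω₀ a : ℝ) else 0 := by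
    refine hU.1.trans (Finset.sum_le_sum fun a _ => ?_)
    by_cases ha : ω₀ a = 0
    · simp [ha]
    split_ifs with h
    · exact mul_le_of_le_one_right (ω₀ a).2 (bitEnt_le_one _)
    · have h01 : Sum.elim pe b a = 0 ∨ Sum.elim pe b a = 1 := by
        by_contra hcon
        rw [not_or] at hcon
        exact h ⟨unitInterval.pos_iff_ne_zero.2 hcon.1, unitInterval.lt_one_iff_ne_one.2 hcon.2⟩
      have h3 := eq_bias_of_meanCost (meanCost_ne_top_of_avgCost (hC ▸ hfin) ha) h01
      rw [h3, bitEnt_eq_zero.2 h01, mul_zero]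
  rcases lt_or_eq_of_le hle with hlt | heq
  · obtain ⟨κ', hκ'1, hκ'2⟩ := hU.exists_ent_gt hR (hC ▸ hfin) hlt (ENNReal.ofReal_pos.2 hδ).ne'
    rw [hC] at hκ'2
    obtain ⟨δ', hδ', hev⟩ := exists_le_card (h := 1 - R + (ent ω₀ κ' - (1 - R)) / 2)
      (by linarith) hκ'2
    refine ⟨δ', hδ', ?_⟩
    filter_upwards [hev, eventually_forall_word_le (R := R) (δ := (ent ω₀ κ' - (1 - R)) / 2)
      (by linarith) hη] with n h1 h2 k l hs
    refine jointLaw_le_first fun s q => ?_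
    by_cases htyp : Typical ω₀ δ' n (Sum.map (fun i => (s i).1) q)
    · refine le_trans (PMF.toOuterMeasure_mono _ ?_) (h2 k l hs _ (h1 _ htyp))
      rintro H ⟨⟨-, hH⟩, -⟩ z hz
      simp only [Finset.mem_filter, Finset.mem_univ, true_and] at hz
      exact (hH z).not_ge hz
    · refine le_trans (PMF.toOuterMeasure_mono _ (t := ∅) ?_) (by simp)
      rintro H ⟨⟨h, -⟩, -⟩
      exact htyp h
  · have hb := hb₁ heq.symm
    have hp : ∀ a, P.map Prod.fst a ≠ 0 → pe a = 0 ∨ pe a = 1 := by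
      rw [hω₀, sum_sumWeight_ite _ hR1] at heq
      have h1 : (∑ c, if 0 < Sum.elim pe b (Sum.inr c) ∧ Sum.elim pe b (Sum.inr c) < 1 then
          (pS c).toReal else 0) = 1 := by
        rw [← sum_toReal pS]
        refine Finset.sum_congr rfl fun c _ => ?_
        by_cases hc : pS c = 0
        · simp [hc]
        · simp [hb c hc]
      rw [h1, mul_one] at heq
      have h2 : (∑ a, if 0 < Sum.elim pe b (Sum.inl a) ∧ Sum.elim pe b (Sum.inl a) < 1 then
          (P.map Prod.fst a).toReal else 0) = 0 := by linarith
      rw [Finset.sum_eq_zero_iff_of_nonneg fun a _ => by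
        split_ifs
        · exact ENNReal.toReal_nonneg
        · exact le_rfl] at h2
      intro a ha
      have h3 := h2 a (Finset.mem_univ a)
      by_contra hcon
      rw [not_or] at hcon
      rw [if_pos ⟨unitInterval.pos_iff_ne_zero.2 hcon.1,
        unitInterval.lt_one_iff_ne_one.2 hcon.2⟩] at h3
      exact (ENNReal.toReal_pos ha ((P.map Prod.fst).apply_ne_top a)).ne' h3
    -- The tolerance is irrelevant here: typicality only serves to exclude letters of probability
    -- zero.
    refine ⟨1, one_pos, ?_⟩
    filter_upwards [measure_parity_cost_le hR1 hU hC hfin hsymm hb hp hδ hη] with n hn k l hs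
    refine jointLaw_le_third fun H s => ?_
    by_cases hx : ∀ i, P.map Prod.fst (s i).1 ≠ 0
    · refine le_trans (PMF.toOuterMeasure_mono _ ?_) (hn k l hs (fun i => (s i).1) hx H)
      rintro q ⟨⟨h1, h2⟩, -⟩
      refine ⟨fun j hj => ?_, h2⟩
      have := h1.ne_zero (Sum.inr j)
      simp [hω₀, sumWeight, mass_eq_zero, hj] at this
    · refine le_trans (PMF.toOuterMeasure_mono _ (t := ∅) ?_) (by simp)
      rintro q ⟨⟨h1, -⟩, -⟩
      refine hx fun i hi => ?_
      have := h1.ne_zero (Sum.inl i)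
      simp [hω₀, sumWeight, mass_eq_zero, hi] at this

end achievability

/-! ### The decoder recovers the vector of the encoder -/

section recovery

variable {X Y S : Type*} [Fintype X] [Fintype Y] [Fintype S]

/-- The vector of the encoder never contradicts a deterministic bias of the decoder. -/
theorem bitCost_encWord_ne_top
    {f : (n : ℕ) → GL (Fin n) (ZMod 2) → (Fin n → I) → (Fin n → I) → Fin n → ZMod 2}
    (hf : IsQuery f) {R : ℝ} (hR1 : R < 1) {P : PMF (X × Y)} {pS : PMF S} {pe : X → I}
    {pd : Y → I} {b : S → I} {κ : X ⊕ S → I}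
    (hU : IsUMin (sumWeight (P.map Prod.fst) (1 - R).toNNReal pS) (Sum.elim pe b) (1 - R) κ)
    (hfin : avgCost (sumWeight (P.map Prod.fst) (1 - R).toNNReal pS) (Sum.elim pe b) κ ≠ ∞)
    (hfin' : ∀ x y, P (x, y) ≠ 0 → meanCost (pd y) (κ (Sum.inl x)) ≠ ∞)
    (hb₂ : ent (sumWeight (P.map Prod.fst) (1 - R).toNNReal pS) (fun a =>
        if Sum.elim pe b a = half then half else 0) = 1 - R →
      (∀ c, pS c ≠ 0 → b c = half) ∨
        ∀ x y, P (x, y) ≠ 0 → (pd y = 0 ∨ pd y = 1) → pe x = pd y)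
    {k l : ℕ} (H : GL (Fin (k + l)) (ZMod 2)) (x : Fin (k + l) → X) (q : Fin l → S)
    (hq : ∀ j, pS (q j) ≠ 0)
    (hz : seqCost (Sum.elim pe b) (Sum.map x q)
      (word H (encWord f pe H (fun j => b (q j)) x)) ≠ ∞)
    (i : Fin (k + l)) (y : Y) (hxy : P (x i, y) ≠ 0) :
    bitCost (pd y) (encWord f pe H (fun j => b (q j)) x i) ≠ ∞ := by
  classical
  intro htop
  set ω₀ := sumWeight (P.map Prod.fst) (1 - R).toNNReal pS with hω₀
  set z := encWord f pe H (fun j => b (q j)) x with hzdef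
  have hx : ω₀ (Sum.inl (x i)) ≠ 0 := by
    simp only [hω₀, sumWeight, Sum.elim_inl, Ne, mass_eq_zero, map_fst_apply, Finset.sum_eq_zero_iff,
      not_forall]
    exact ⟨y, Finset.mem_univ y, hxy⟩
  -- The decoder's mean cost under the minimizer is finite, so a bit value of infinite decoder cost
  -- has probability zero under the minimizer. The opposite value is then strictly cheaper for the
  -- encoder.
  have hbern := bern_eq_zero_of_meanCost (hfin' _ _ hxy) htop
  have hlt : bitCost (pe (x i)) (z i + 1) < bitCost (pe (x i)) (z i) := hU.bitCost_lt hx hbern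
  have hz' := hz
  rw [word, seqCost_sum, ENNReal.add_ne_top, ENNReal.sum_ne_top, ENNReal.sum_ne_top] at hz'
  by_cases h01 : pe (x i) = 0 ∨ pe (x i) = 1
  · have h1 : κ (Sum.inl (x i)) = pe (x i) :=
      eq_bias_of_meanCost (meanCost_ne_top_of_avgCost hfin hx) h01
    rw [h1] at hbern
    exact hz'.1 i (Finset.mem_univ i) (by rw [bitCost, hbern, negLog_zero])
  have hκ0 : bitEnt (κ (Sum.inl (x i))) = 0 := bitEnt_eq_zero.2 (bern_eq_zero_or hbern)
  -- The bit at `x i` is deterministic although its bias is not. By `IsUMin.bitEnt_eq_zero_of` only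
  -- letters of bias 1/2 carry entropy, so their weight is exactly 1-R: the second coincidence.
  have hent : ent ω₀ (fun a => if Sum.elim pe b a = half then half else 0) = 1 - R := by
    rw [← hU.ent_eq (by linarith)]
    refine Finset.sum_congr rfl fun a _ => ?_
    by_cases ha : ω₀ a = 0
    · simp [ha]
    congr 1
    change bitEnt (if Sum.elim pe b a = half then half else 0) = bitEnt (κ a)
    split_ifs with h
    · rw [hU.eq_half ha h]
    · rw [not_or] at h01
      rw [hU.bitEnt_eq_zero_of hfin hx hκ0 ⟨unitInterval.pos_iff_ne_zero.2 h01.1,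
        unitInterval.lt_one_iff_ne_one.2 h01.2⟩ ha h, bitEnt_eq_zero.2 (Or.inl rfl)]
  rcases hb₂ hent with hhalf | hpd
  · have hopt := encWord_cost_le (pe := pe) (b := b) hf H x q (Function.update z i (z i + 1))
    rw [← hzdef, word, word, seqCost_sum, seqCost_sum] at hopt
    simp only [hhalf _ (hq _), bitCost_half] at hopt
    rw [ENNReal.add_le_add_iff_right (by simp), ← Finset.add_sum_erase _ _ (Finset.mem_univ i),
      ← Finset.add_sum_erase Finset.univ _ (Finset.mem_univ i), Function.update_self,
      Finset.sum_congr rfl (fun j hj => by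
        rw [Function.update_of_ne (Finset.ne_of_mem_erase hj)] :
          ∀ j ∈ Finset.univ.erase i, bitCost (pe (x j)) (Function.update z i (z i + 1) j) =
            bitCost (pe (x j)) (z j)), ENNReal.add_le_add_iff_right] at hopt
    · exact hlt.not_ge hopt
    · rw [ENNReal.sum_ne_top]
      exact fun j _ => hz'.1 j (Finset.mem_univ j)
  · rw [bitCost, negLog_eq_top] at htop
    have h2 := bern_eq_zero_or htop
    rw [← hpd _ _ hxy h2] at h2
    exact h01 h2

omit [Fintype Y] [Fintype S] in
/-- The cost for the decoder of a vector whose joint type with the source is close to the one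
prescribed by `w`. -/
theorem decoder_cost_le {m l n : ℕ} {pe : X → I} {pd : Y → I} {b : S → I} (x : Fin m → X)
    (y : Fin m → Y) (q : Fin l → S) (z : Fin m → ZMod 2) (v : Fin l → ZMod 2)
    {w : X → ZMod 2 → ℝ} (hw : ∀ a u, 0 ≤ w a u) {g : X → ZMod 2 → ℝ} (hg : ∀ a u, 0 ≤ g a u)
    {ε δ τ : ℝ} (hε : 0 ≤ ε) (hδ : 0 ≤ δ) (hτ : 0 ≤ τ) {D₂ : ℝ≥0∞} (hD₂ : D₂ ≠ ∞)
    (hocc : ∀ a u, |(jointOcc x z a u : ℝ) - n * w a u| ≤ n * ε)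
    (hfe : ∀ i, bitCost (pe (x i)) (z i) ≠ ∞) (hfd : ∀ i, bitCost (pd (y i)) (z i) ≠ ∞)
    (henc : ∑ i, bitCost (pe (x i)) (z i) + ∑ j, bitCost (b (q j)) (v j) ≤
      n * (ENNReal.ofReal (∑ a, ∑ u, w a u * (bitCost (pe a) u).toReal) + D₂ + ENNReal.ofReal δ))
    (hdev : |∑ i, ((bitCost (pd (y i)) (z i)).toReal - g (x i) (z i))| < n * τ) :
    seqCost (Sum.elim pd b) (Sum.map y q) (Sum.elim z v) ≤
      n * (ENNReal.ofReal (∑ a, ∑ u, w a u * g a u) + D₂ +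
        ENNReal.ofReal (τ + ε * (∑ a, ∑ u, g a u + ∑ a, ∑ u, (bitCost (pe a) u).toReal) + δ)) := by
  set Fe : X → ZMod 2 → ℝ := fun a u => (bitCost (pe a) u).toReal with hFe
  have hFe0 : ∀ a u, 0 ≤ Fe a u := fun _ _ => ENNReal.toReal_nonneg
  set C₁ := ∑ a, ∑ u, w a u * Fe a u with hC₁
  have hC₁0 : 0 ≤ C₁ := Finset.sum_nonneg fun a _ => Finset.sum_nonneg fun u _ =>
    mul_nonneg (hw a u) (hFe0 a u)
  set D₁ := ∑ a, ∑ u, w a u * g a u with hD₁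
  have hD₁0 : 0 ≤ D₁ := Finset.sum_nonneg fun a _ => Finset.sum_nonneg fun u _ =>
    mul_nonneg (hw a u) (hg a u)
  set G₁ := ∑ a, ∑ u, g a u with hG₁
  have hG₁0 : 0 ≤ G₁ := Finset.sum_nonneg fun a _ => Finset.sum_nonneg fun u _ => hg a u
  set G₂ := ∑ a, ∑ u, Fe a u with hG₂
  have hG₂0 : 0 ≤ G₂ := Finset.sum_nonneg fun a _ => Finset.sum_nonneg fun u _ => hFe0 a u
  have hn0 : (0 : ℝ) ≤ n := Nat.cast_nonneg n
  have hbound : ∀ φ : X → ZMod 2 → ℝ, (∀ a u, 0 ≤ φ a u) →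
      |∑ i, φ (x i) (z i) - n * ∑ a, ∑ u, w a u * φ a u| ≤ n * (ε * ∑ a, ∑ u, φ a u) := by
    intro φ hφ
    rw [sum_letters x z φ]
    simp only [Finset.mul_sum, ← Finset.sum_sub_distrib]
    refine (Finset.abs_sum_le_sum_abs _ _).trans (Finset.sum_le_sum fun a _ =>
      (Finset.abs_sum_le_sum_abs _ _).trans (Finset.sum_le_sum fun u _ => ?_))
    have : jointOcc x z a u • φ a u - n * (w a u * φ a u) =
        (jointOcc x z a u - n * w a u) * φ a u := by rw [nsmul_eq_mul]; ring
    rw [this, abs_mul, abs_of_nonneg (hφ a u), ← mul_assoc]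
    exact mul_le_mul_of_nonneg_right (hocc a u) (hφ a u)
  have h1 := (abs_le.1 (hbound Fe hFe0)).1
  have h2 := (abs_le.1 (hbound g hg)).2
  rw [Finset.sum_sub_distrib] at hdev
  have h3 := (abs_lt.1 hdev).2
  -- The parity cost Q is common to encoder and decoder. It is bounded by the encoder's total cost
  -- minus its source cost, so the type of the parity bits is not needed.
  set Q := ∑ j, bitCost (b (q j)) (v j) with hQ
  have hrhs : (n : ℝ≥0∞) * (ENNReal.ofReal C₁ + D₂ + ENNReal.ofReal δ) =
      ENNReal.ofReal (n * (C₁ + D₂.toReal + δ)) := by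
    rw [ENNReal.ofReal_mul hn0, ENNReal.ofReal_natCast, ENNReal.ofReal_add (by positivity) hδ,
      ENNReal.ofReal_add hC₁0 ENNReal.toReal_nonneg, ENNReal.ofReal_toReal hD₂]
  have hFesum : ∑ i, bitCost (pe (x i)) (z i) = ENNReal.ofReal (∑ i, Fe (x i) (z i)) := by
    rw [ENNReal.ofReal_sum_of_nonneg fun i _ => hFe0 _ _]
    exact Finset.sum_congr rfl fun i _ => (ENNReal.ofReal_toReal (hfe i)).symm
  rw [hrhs, hFesum] at henc
  have hQtop : Q ≠ ∞ := ne_top_of_le_ne_top ENNReal.ofReal_ne_top (le_add_self.trans henc)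
  rw [← ENNReal.ofReal_toReal hQtop, ← ENNReal.ofReal_add (Finset.sum_nonneg fun i _ => hFe0 _ _)
    ENNReal.toReal_nonneg, ENNReal.ofReal_le_ofReal_iff (by positivity)] at henc
  have hFdsum : ∑ i, bitCost (pd (y i)) (z i) =
      ENNReal.ofReal (∑ i, (bitCost (pd (y i)) (z i)).toReal) := by
    rw [ENNReal.ofReal_sum_of_nonneg fun i _ => ENNReal.toReal_nonneg]
    exact Finset.sum_congr rfl fun i _ => (ENNReal.ofReal_toReal (hfd i)).symm
  rw [seqCost_sum, hFdsum, ← hQ, ← ENNReal.ofReal_toReal hQtop,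
    ← ENNReal.ofReal_add (Finset.sum_nonneg fun i _ => ENNReal.toReal_nonneg)
    ENNReal.toReal_nonneg]
  have hrhs' : (n : ℝ≥0∞) * (ENNReal.ofReal D₁ + D₂ + ENNReal.ofReal (τ + ε * (G₁ + G₂) + δ)) =
      ENNReal.ofReal (n * (D₁ + D₂.toReal + (τ + ε * (G₁ + G₂) + δ))) := by
    rw [ENNReal.ofReal_mul hn0, ENNReal.ofReal_natCast,
      ENNReal.ofReal_add (p := D₁ + D₂.toReal) (by positivity) (by positivity), ENNReal.ofReal_add hD₁0 ENNReal.toReal_nonneg, ENNReal.ofReal_toReal hD₂]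
  rw [hrhs']
  refine ENNReal.ofReal_le_ofReal ?_
  nlinarith

end recovery

/-! ### Joint types of cheap vectors -/

section types

variable {X Y S : Type*} [Fintype X] [Fintype Y] [Fintype S]

theorem word_zero {k l : ℕ} (H : GL (Fin (k + l)) (ZMod 2)) : word H 0 = 0 := by
  funext i
  rcases i with i | i <;> simp [word, parity]

theorem freq_zero {A ι : Type*} [Fintype ι] (s : ι → A) : freq s 0 = 0 := by
  funext a
  ext
  simp [freq, jointOcc]

/-- With a symmetric parity bias, the zero vector is more expensive than the minimum unless the
minimizer vanishes on the source symbols. -/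
theorem IsUMin.lt_avgCost_zero {p : PMF X} {R : ℝ} (hR1 : R < 1) {pS : PMF S} {pe : X → I}
    {b : S → I} {κ : X ⊕ S → I}
    (hU : IsUMin (sumWeight p (1 - R).toNNReal pS) (Sum.elim pe b) (1 - R) κ)
    (hsymm : ∑ c, pS c * bitCost (b c) 0 = ∑ c, pS c * bitCost (b c) 1) {a : X} (ha : p a ≠ 0)
    (hκa : κ (Sum.inl a) ≠ 0) :
    avgCost (sumWeight p (1 - R).toNNReal pS) (Sum.elim pe b) κ <
      avgCost (sumWeight p (1 - R).toNNReal pS) (Sum.elim pe b) 0 := by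
  -- By symmetry, uniform parity bits cost as much on average as zero parity bits, and they make the
  -- point feasible. So the zero point is compared with a competitor in the minimization.
  set κ' : X ⊕ S → I := Sum.elim 0 fun _ => half with hκ'
  have hent : 1 - R ≤ ent (sumWeight p (1 - R).toNNReal pS) κ' := by
    rw [ent_sumWeight p hR1]
    have h1 : ∀ c : S, bitEnt (κ' (Sum.inr c)) = 1 := fun c => bitEnt_eq_one.2 rfl
    have h2 : 0 ≤ ∑ a, (p a).toReal * bitEnt (κ' (Sum.inl a)) :=
      Finset.sum_nonneg fun a _ => mul_nonneg ENNReal.toReal_nonneg (bitEnt_nonneg _)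
    simp only [h1, mul_one, sum_toReal]
    linarith
  have hcost : avgCost (sumWeight p (1 - R).toNNReal pS) (Sum.elim pe b) κ' =
      avgCost (sumWeight p (1 - R).toNNReal pS) (Sum.elim pe b) 0 := by
    rw [avgCost_sumWeight, avgCost_sumWeight]
    congr 2
    have h1 : ∀ c, pS c * meanCost (b c) (κ' (Sum.inr c)) =
        ENNReal.ofReal (1 / 2) * (pS c * bitCost (b c) 0) +
          ENNReal.ofReal (1 / 2) * (pS c * bitCost (b c) 1) := by
      intro c
      simp only [hκ', Sum.elim_inr]
      rw [meanCost, sum_bit, bern_half, bern_half, half]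
      ring
    have h2 : ∀ c, meanCost (b c) ((0 : X ⊕ S → I) (Sum.inr c)) = bitCost (b c) 0 := by
      intro c
      rw [← meanCost_bitVal]
      rfl
    simp only [h1, h2, Finset.sum_add_distrib, ← Finset.mul_sum]
    rw [← hsymm, ← add_mul, ← ENNReal.ofReal_add (by norm_num) (by norm_num)]
    norm_num
  rw [← hcost]
  refine lt_of_not_ge fun hle => hκa ?_
  rw [← hU.2 κ' hent hle (Sum.inl a) (by simpa [sumWeight, mass_eq_zero] using ha)]
  rfl

open Classical in
-- Types in the closed set K, at distance at least ε from the minimizer, have either larger cost or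
-- entropy below 1-R. By the gap there are fewer than 2^(n(1-R-δ)) cheap sequences of such types,
-- too few for any of them to be the word of a nonzero vector.
theorem eventually_type_near {R : ℝ} (hR1 : R < 1) {P : PMF (X × Y)} {pS : PMF S}
    {pe : X → I} {b : S → I} {κ : X ⊕ S → I} {C : ℝ≥0∞}
    (hU : IsUMin (sumWeight (P.map Prod.fst) (1 - R).toNNReal pS) (Sum.elim pe b) (1 - R) κ)
    (hC : avgCost (sumWeight (P.map Prod.fst) (1 - R).toNNReal pS) (Sum.elim pe b) κ = C)
    (hfin : C ≠ ∞) (hsymm : ∑ c, pS c * bitCost (b c) 0 = ∑ c, pS c * bitCost (b c) 1)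
    {ε η : ℝ} (hε : 0 < ε) (hη : 0 < η) :
    ∃ δ : ℝ, 0 < δ ∧ ∀ᶠ n : ℕ in atTop, ∀ k l, Scale R n k l →
      (jointLaw (PMF.uniformOfFintype (GL (Fin (k + l)) (ZMod 2))) (iid P (k + l))
        (iid pS l)).toOuterMeasure {ω |
          Typical (sumWeight (P.map Prod.fst) (1 - R).toNNReal pS) δ n
            (Sum.map (fun i => (ω.2.1 i).1) ω.2.2) ∧
          ∃ z, seqCost (Sum.elim pe b) (Sum.map (fun i => (ω.2.1 i).1) ω.2.2) (word ω.1 z) ≤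
              n * (C + ENNReal.ofReal δ) ∧
            ∃ a u, ε ≤ (P.map Prod.fst a).toReal *
              |(bern (freq (Sum.map (fun i => (ω.2.1 i).1) ω.2.2) (word ω.1 z) (Sum.inl a)) u : ℝ)
                - bern (κ (Sum.inl a)) u|} ≤ ENNReal.ofReal η := by
  have hR : 0 < 1 - R := by linarith
  set ω₀ := sumWeight (P.map Prod.fst) (1 - R).toNNReal pS with hω₀
  set K : Set (X ⊕ S → I) := {κ' | ∃ a u, ε ≤ (P.map Prod.fst a).toReal *
    |(bern (κ' (Sum.inl a)) u : ℝ) - bern (κ (Sum.inl a)) u|} with hKdef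
  have hK : IsClosed K := by
    have : K = ⋃ a, ⋃ u, {κ' | ε ≤ (P.map Prod.fst a).toReal *
        |(bern (κ' (Sum.inl a)) u : ℝ) - bern (κ (Sum.inl a)) u|} := by
      ext; simp [hKdef]
    rw [this]
    refine isClosed_iUnion_of_finite fun a => isClosed_iUnion_of_finite fun u =>
      isClosed_le continuous_const ?_
    exact continuous_const.mul
      ((((continuous_bern u).comp (continuous_apply (Sum.inl a))).sub continuous_const).abs)
  have hne : ∀ κ' ∈ K, ∃ a, P.map Prod.fst a ≠ 0 ∧ κ' (Sum.inl a) ≠ κ (Sum.inl a) := by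
    rintro κ' ⟨a, u, h⟩
    refine ⟨a, fun h0 => ?_, fun h0 => ?_⟩
    · rw [h0] at h; simp at h; linarith
    · rw [h0] at h; simp at h; linarith
  have hgap : ∀ κ' ∈ K, C < avgCost ω₀ (Sum.elim pe b) κ' ∨ ent ω₀ κ' < 1 - R := by
    intro κ' hκ'
    by_contra! hcon
    obtain ⟨a, ha, hne⟩ := hne κ' hκ'
    exact hne (hU.2 κ' hcon.2 (hC ▸ hcon.1) _ (by simpa [hω₀, sumWeight, mass_eq_zero] using ha))
  -- The zero vector has the zero word for every matrix, so random coding says nothing about it. If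
  -- its type lies in K it is too expensive. The entropy threshold -1 makes the count below 1, which
  -- means that no such sequence is cheap.
  have hgap0 : ∀ κ' ∈ K ∩ {0}, C < avgCost ω₀ (Sum.elim pe b) κ' ∨ ent ω₀ κ' < -1 := by
    rintro κ' ⟨hκ', rfl⟩
    obtain ⟨a, ha, hne⟩ := hne 0 hκ'
    exact Or.inl (hC ▸ hU.lt_avgCost_zero hR1 hsymm ha (Ne.symm hne))
  obtain ⟨δ₁, hδ₁, hev₁⟩ := exists_card_le hK hfin hgap
  obtain ⟨δ₂, hδ₂, hev₂⟩ := exists_card_le (hK.inter isClosed_singleton) hfin hgap0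
  refine ⟨min δ₁ δ₂, lt_min hδ₁ hδ₂, ?_⟩
  filter_upwards [hev₁, hev₂, eventually_exists_word_le (R := R) hδ₁ hη, eventually_ge_atTop 1]
    with n h1 h2 h3 hn k l hs
  refine jointLaw_le_first fun s q => ?_
  by_cases htyp : Typical ω₀ (min δ₁ δ₂) n (Sum.map (fun i => (s i).1) q)
  · refine le_trans (PMF.toOuterMeasure_mono _ ?_)
      (h3 k l hs _ (h1 _ (htyp.mono (min_le_left _ _))))
    rintro H ⟨⟨-, z, hz, hdev⟩, -⟩
    have hle : ∀ δ, min δ₁ δ₂ ≤ δ → n * (C + ENNReal.ofReal (min δ₁ δ₂)) ≤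
        n * (C + ENNReal.ofReal δ) := fun δ hδ => by gcongr
    refine ⟨z, ?_, ?_⟩
    · rintro rfl
      have h4 := h2 _ (htyp.mono (min_le_right _ _))
      have h5 : (2 : ℝ) ^ (n * (-1 - δ₂)) < 1 := by
        have hn0 : (0 : ℝ) < n := by exact_mod_cast hn
        exact Real.rpow_lt_one_of_one_lt_of_neg (by norm_num)
          (mul_neg_of_pos_of_neg hn0 (by linarith))
      have h6 := h4.trans_lt h5
      rw [Nat.cast_lt_one, Finset.card_eq_zero] at h6
      refine Finset.notMem_empty 0 (h6.subset ((@Finset.mem_filter _ _ (_) _ _).2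
        ⟨Finset.mem_univ 0, ⟨?_, freq_zero _⟩, ?_⟩))
      · rw [← word_zero H]; exact hdev
      · rw [← word_zero H]; exact hz.trans (hle _ (min_le_right _ _))
    · exact (@Finset.mem_filter _ _ (_) _ _).2 ⟨Finset.mem_univ _, hdev, hz.trans (hle _ (min_le_left _ _))⟩
  · refine le_trans (PMF.toOuterMeasure_mono _ (t := ∅) ?_) (by simp)
    rintro H ⟨⟨h, -⟩, -⟩
    exact htyp h

open Classical in
-- Sequences cheap for the encoder number about 2^(n(1-R)) and those cheap for the decoder at most
-- 2^(n(1-δ₁)). The expected number of pairs of distinct vectors with equal message is therefore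
-- exponentially small.
theorem eventually_unique_le {R : ℝ} (hR0 : 0 < R) (hR1 : R < 1) {P : PMF (X × Y)} {pS : PMF S}
    {pe : X → I} {pd : Y → I} {b : S → I} {κ : X ⊕ S → I} {C D : ℝ≥0∞}
    (hU : IsUMin (sumWeight (P.map Prod.fst) (1 - R).toNNReal pS) (Sum.elim pe b) (1 - R) κ)
    (hC : avgCost (sumWeight (P.map Prod.fst) (1 - R).toNNReal pS) (Sum.elim pe b) κ = C)
    (hCfin : C ≠ ∞)
    (hdec : ∀ κ', 1 ≤ ent (sumWeight (P.map Prod.snd) (1 - R).toNNReal pS) κ' →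
      D < avgCost (sumWeight (P.map Prod.snd) (1 - R).toNNReal pS) (Sum.elim pd b) κ')
    (hDfin : D ≠ ∞) :
    ∃ δ : ℝ, 0 < δ ∧ ∀ η : ℝ, 0 < η → ∀ᶠ n : ℕ in atTop, ∀ k l, Scale R n k l →
      (jointLaw (PMF.uniformOfFintype (GL (Fin (k + l)) (ZMod 2))) (iid P (k + l))
        (iid pS l)).toOuterMeasure {ω |
          Typical (sumWeight (P.map Prod.fst) (1 - R).toNNReal pS) δ n
            (Sum.map (fun i => (ω.2.1 i).1) ω.2.2) ∧
          Typical (sumWeight (P.map Prod.snd) (1 - R).toNNReal pS) δ n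
            (Sum.map (fun i => (ω.2.1 i).2) ω.2.2) ∧
          ∃ z z', z ≠ z' ∧
            seqCost (Sum.elim pe b) (Sum.map (fun i => (ω.2.1 i).1) ω.2.2) (word ω.1 z) ≤
              n * (C + ENNReal.ofReal δ) ∧
            seqCost (Sum.elim pd b) (Sum.map (fun i => (ω.2.1 i).2) ω.2.2) (word ω.1 z') ≤
              n * (D + ENNReal.ofReal δ) ∧
            messageBits ω.1 z = messageBits ω.1 z'} ≤ ENNReal.ofReal η := by
  have hR : 0 < 1 - R := by linarith
  set ω₀ := sumWeight (P.map Prod.fst) (1 - R).toNNReal pS with hω₀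
  obtain ⟨δ₁, hδ₁, hev₁⟩ := exists_card_le (K := Set.univ) isClosed_univ hDfin (h := 1)
    (β := Sum.elim pd b) (ω := sumWeight (P.map Prod.snd) (1 - R).toNNReal pS)
    fun κ' _ => (le_or_gt 1 (ent _ κ')).imp (hdec κ') id
  set η₁ := min (δ₁ / 2) (R / 2) with hη₁
  have hη₁0 : 0 < η₁ := lt_min (by linarith) (by linarith)
  -- A feasible point of cost at most C agrees with the minimizer on positive weights and has
  -- entropy exactly 1-R, so the threshold 1 - R + η₁ lies strictly above it.
  obtain ⟨δ₂, hδ₂, hev₂⟩ := exists_card_le (K := Set.univ) isClosed_univ hCfin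
    (h := 1 - R + η₁) (β := Sum.elim pe b) (ω := ω₀) fun κ' _ => by
      by_contra! hcon
      have h1 := ent_congr (hU.2 κ' (by linarith [hcon.2]) (hC ▸ hcon.1))
      rw [hU.ent_eq hR] at h1
      linarith [hcon.2]
  refine ⟨min δ₁ δ₂, lt_min hδ₁ hδ₂, fun η hη => ?_⟩
  filter_upwards [hev₁, hev₂, eventually_two_words_le (R := R) (η₁ := η₁) (δ := δ₁)
    ((min_le_left _ _).trans_lt (by linarith)) ((min_le_right _ _).trans_lt (by linarith))
    hδ₁ hη] with n h1 h2 h3 k l hs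
  refine jointLaw_le_first fun s q => ?_
  by_cases htyp : Typical ω₀ (min δ₁ δ₂) n (Sum.map (fun i => (s i).1) q) ∧
      Typical (sumWeight (P.map Prod.snd) (1 - R).toNNReal pS) (min δ₁ δ₂) n
        (Sum.map (fun i => (s i).2) q)
  · refine le_trans (PMF.toOuterMeasure_mono _ ?_)
      (h3 k l hs _ _ ((h2 _ (htyp.1.mono (min_le_right _ _))).trans ?_)
        (h1 _ (htyp.2.mono (min_le_left _ _))))
    · rintro H ⟨⟨-, -, z, z', hne, hz, hz', hm⟩, -⟩
      refine ⟨z, z', hne, ?_, ?_, hm⟩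
      · refine (@Finset.mem_filter _ _ (_) _ _).2 ⟨Finset.mem_univ _, trivial, hz.trans ?_⟩
        gcongr
        exact min_le_right _ _
      · refine (@Finset.mem_filter _ _ (_) _ _).2 ⟨Finset.mem_univ _, trivial, hz'.trans ?_⟩
        gcongr
        exact min_le_left _ _
    · refine Real.rpow_le_rpow_of_exponent_le (by norm_num) ?_
      have hn0 : (0 : ℝ) ≤ n := Nat.cast_nonneg n
      nlinarith
  · refine le_trans (PMF.toOuterMeasure_mono _ (t := ∅) ?_) (by simp)
    rintro H ⟨⟨h, h', -⟩, -⟩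
    exact htyp ⟨h, h'⟩

omit [Fintype S] in
-- Given H, q and x the encoder's vector is fixed, while the y i are still independent with laws P(Y
-- | x i). The function g is the conditional mean of F.
theorem eventually_decoder_dev_le
    {f : (n : ℕ) → GL (Fin n) (ZMod 2) → (Fin n → I) → (Fin n → I) → Fin n → ZMod 2} {R : ℝ}
    {P : PMF (X × Y)} {pS : PMF S} {pe : X → I} {b : S → I} (F : Y → ZMod 2 → ℝ)
    {g : X → ZMod 2 → ℝ} (hg : ∀ a u, (P.map Prod.fst a).toReal * g a u =
      ∑ y, (P (a, y)).toReal * F y u) {τ η : ℝ} (hτ : 0 < τ) (hη : 0 < η) :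
    ∀ᶠ n : ℕ in atTop, ∀ k l, Scale R n k l →
      (jointLaw (PMF.uniformOfFintype (GL (Fin (k + l)) (ZMod 2))) (iid P (k + l))
        (iid pS l)).toOuterMeasure {ω | n * τ ≤
          |∑ i, (F (ω.2.1 i).2 (encWord f pe ω.1 (fun j => b (ω.2.2 j))
              (fun i => (ω.2.1 i).1) i) -
            g (ω.2.1 i).1 (encWord f pe ω.1 (fun j => b (ω.2.2 j))
              (fun i => (ω.2.1 i).1) i))|} ≤ ENNReal.ofReal η := by
  set M : ℝ := ∑ a, ∑ u, ∑ y, (F y u - g a u) ^ 2 with hM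
  have hMle : ∀ a u y, (F y u - g a u) ^ 2 ≤ M := fun a u y =>
    ((Finset.single_le_sum (f := fun y => (F y u - g a u) ^ 2) (fun _ _ => sq_nonneg _)
      (Finset.mem_univ y)).trans (Finset.single_le_sum (f := fun u => ∑ y, (F y u - g a u) ^ 2)
      (fun _ _ => Finset.sum_nonneg fun _ _ => sq_nonneg _) (Finset.mem_univ u))).trans
      (Finset.single_le_sum (f := fun a => ∑ u, ∑ y, (F y u - g a u) ^ 2)
      (fun _ _ => Finset.sum_nonneg fun _ _ => Finset.sum_nonneg fun _ _ => sq_nonneg _)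
      (Finset.mem_univ a))
  filter_upwards [tendsto_natCast_atTop_atTop.eventually_ge_atTop (M / (τ ^ 2 * η)),
    eventually_ge_atTop 1] with n hn hn1 k l hs
  have hn0 : (0 : ℝ) < n := by exact_mod_cast hn1
  obtain rfl := hs.1
  refine jointLaw_le_second fun H q => ?_
  refine (iid_conditional_chebyshev P (z := fun x => encWord f pe H (fun j => b (q j)) x)
    (g := fun a u y => F y u - g a u) (M := M) (fun a u => ?_) (fun a u y => ?_)
    (by positivity)).trans (ENNReal.ofReal_le_ofReal ?_)
  · simp only [mul_sub, Finset.sum_sub_distrib, ← Finset.sum_mul]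
    rw [← hg, toReal_map_fst, sub_self]
  · rw [mul_comm]
    exact mul_le_mul_of_nonneg_right (hMle _ _ _) ENNReal.toReal_nonneg
  · rw [div_le_iff₀ (by positivity)] at hn ⊢
    nlinarith

end types

/-! ### The theorem for parity biases in a finite alphabet -/

section finite

variable {X Y S : Type*} [Fintype X] [Fintype Y] [Fintype S]

theorem sum_mul_meanCost {A : Type*} [Fintype A] {p : A → ℝ≥0∞} (hp : ∀ a, p a ≠ ∞) {β κ : A → I}
    (h : ∑ a, p a * meanCost (β a) (κ a) ≠ ∞) :
    ∑ a, p a * meanCost (β a) (κ a) =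
      ENNReal.ofReal (∑ a, (p a).toReal * ∑ u, (bern (κ a) u : ℝ) * (bitCost (β a) u).toReal) := by
  have h0 : ∀ a, 0 ≤ ∑ u, (bern (κ a) u : ℝ) * (bitCost (β a) u).toReal := fun a =>
    Finset.sum_nonneg fun u _ => mul_nonneg (bern _ u).2.1 ENNReal.toReal_nonneg
  rw [ENNReal.ofReal_sum_of_nonneg fun a _ => mul_nonneg ENNReal.toReal_nonneg (h0 a)]
  refine Finset.sum_congr rfl fun a _ => ?_
  rw [ENNReal.ofReal_mul ENNReal.toReal_nonneg, ENNReal.ofReal_toReal (hp a)]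
  by_cases ha : p a = 0
  · simp [ha]
  congr 1
  refine ofReal_toReal_meanCost fun htop => ?_
  rw [ENNReal.sum_ne_top] at h
  exact h a (Finset.mem_univ a) (by rw [htop, ENNReal.mul_top ha])

open Classical in
/-- The probability that the empirical distribution of the source symbols and the decoder outputs
deviates from the law prescribed by the minimizer tends to zero. -/
theorem eventually_deviation_le
    {f : (n : ℕ) → GL (Fin n) (ZMod 2) → (Fin n → I) → (Fin n → I) → Fin n → ZMod 2}
    (hf : IsQuery f) {R : ℝ} (hR0 : 0 < R) (hR1 : R < 1) {P : PMF (X × Y)} {pS : PMF S}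
    {pe : X → I} {pd : Y → I} {b : S → I} {κ : X → I} {ν : S → I}
    (hU : IsUMin (sumWeight (P.map Prod.fst) (1 - R).toNNReal pS) (Sum.elim pe b) (1 - R)
      (Sum.elim κ ν))
    (hsymm : ∑ c, pS c * bitCost (b c) 0 = ∑ c, pS c * bitCost (b c) 1)
    (hdec : ∀ κ', 1 ≤ ent (sumWeight (P.map Prod.snd) (1 - R).toNNReal pS) κ' →
      ∑ s, P s * meanCost (pd s.2) (κ s.1) +
          (1 - R).toNNReal * ∑ c, pS c * meanCost (b c) (ν c) <
        avgCost (sumWeight (P.map Prod.snd) (1 - R).toNNReal pS) (Sum.elim pd b) κ')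
    (hb₁ : (∑ a, if 0 < Sum.elim pe b a ∧ Sum.elim pe b a < 1 then
        (sumWeight (P.map Prod.fst) (1 - R).toNNReal pS a : ℝ) else 0) = 1 - R →
      ∀ c, pS c ≠ 0 → 0 < b c ∧ b c < 1)
    (hb₂ : ent (sumWeight (P.map Prod.fst) (1 - R).toNNReal pS) (fun a =>
        if Sum.elim pe b a = half then half else 0) = 1 - R →
      (∀ c, pS c ≠ 0 → b c = half) ∨
        ∀ x y, P (x, y) ≠ 0 → (pd y = 0 ∨ pd y = 1) → pe x = pd y)
    {ε η : ℝ} (hε : 0 < ε) (hη : 0 < η) :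
    ∀ᶠ n : ℕ in atTop, ∀ k l, Scale R n k l →
      (jointLaw (PMF.uniformOfFintype (GL (Fin (k + l)) (ZMod 2))) (iid P (k + l))
        (iid pS l)).toOuterMeasure {ω | ∃ a u, ε ≤
          |empirical (fun i => (ω.2.1 i).1)
            (decWord f pd ω.1 (fun j => b (ω.2.2 j))
              (message f pe ω.1 (fun j => b (ω.2.2 j)) fun i => (ω.2.1 i).1)
              fun i => (ω.2.1 i).2) a u - (P.map Prod.fst a).toReal * bern (κ a) u|} ≤
        ENNReal.ofReal η := by
  have hR : 0 < 1 - R := by linarith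
  set ω₀ := sumWeight (P.map Prod.fst) (1 - R).toNNReal pS with hω₀
  set ω₁ := sumWeight (P.map Prod.snd) (1 - R).toNNReal pS with hω₁
  set D₂ : ℝ≥0∞ := (1 - R).toNNReal * ∑ c, pS c * meanCost (b c) (ν c) with hD₂
  set D : ℝ≥0∞ := ∑ s, P s * meanCost (pd s.2) (κ s.1) + D₂ with hD
  obtain ⟨C, hC⟩ : ∃ C, avgCost ω₀ (Sum.elim pe b) (Sum.elim κ ν) = C := ⟨_, rfl⟩
  have hCfin : C ≠ ∞ := by
    rw [← hC]
    refine hU.ne_top hR ?_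
    rw [← ent_half, hω₀, ent_sumWeight _ hR1]
    simp only [bitEnt_eq_one.2 rfl, mul_one, sum_toReal]
    linarith
  have hDfin : D ≠ ∞ := by
    refine (hdec (fun _ => half) ?_).ne_top
    rw [hω₁, ent_sumWeight _ hR1]
    simp only [bitEnt_eq_one.2 rfl, mul_one, sum_toReal]
    linarith
  have hDfin' := hDfin
  rw [hD, ENNReal.add_ne_top] at hDfin'
  obtain ⟨hD₁fin, hD₂fin⟩ := hDfin'
  have hmd : ∀ x y, P (x, y) ≠ 0 → meanCost (pd y) (κ x) ≠ ∞ := by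
    intro x y hxy htop
    rw [ENNReal.sum_ne_top] at hD₁fin
    exact hD₁fin (x, y) (Finset.mem_univ _) (by rw [htop, ENNReal.mul_top hxy])
  set F : Y → ZMod 2 → ℝ := fun y u => (bitCost (pd y) u).toReal with hF
  -- The conditional mean, given X = a, of the decoder's cost of the bit u; infinite costs count as
  -- 0, and so does a letter of probability zero.
  set g : X → ZMod 2 → ℝ := fun a u =>
    (∑ y, (P (a, y)).toReal * F y u) / (P.map Prod.fst a).toReal with hgdef
  have hg0 : ∀ a u, 0 ≤ g a u := fun a u => div_nonneg (Finset.sum_nonneg fun y _ =>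
    mul_nonneg ENNReal.toReal_nonneg ENNReal.toReal_nonneg) ENNReal.toReal_nonneg
  have hg : ∀ a u, (P.map Prod.fst a).toReal * g a u = ∑ y, (P (a, y)).toReal * F y u := by
    intro a u
    by_cases ha : (P.map Prod.fst a).toReal = 0
    · have h1 := ha
      rw [toReal_map_fst, Finset.sum_eq_zero_iff_of_nonneg fun _ _ => ENNReal.toReal_nonneg] at h1
      rw [ha, zero_mul, Finset.sum_eq_zero fun y hy => by rw [h1 y hy, zero_mul]]
    · exact mul_div_cancel₀ _ ha
  set w : X → ZMod 2 → ℝ := fun a u => (P.map Prod.fst a).toReal * bern (κ a) u with hw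
  have hw0 : ∀ a u, 0 ≤ w a u := fun a u => mul_nonneg ENNReal.toReal_nonneg (bern _ u).2.1
  have hCeq : C = ENNReal.ofReal (∑ a, ∑ u, w a u * (bitCost (pe a) u).toReal) + D₂ := by
    rw [hω₀, avgCost_sumWeight] at hC
    rw [← hC, ENNReal.add_ne_top] at hCfin
    rw [← hC]
    congr 1
    refine (sum_mul_meanCost (fun a => PMF.apply_ne_top _ a) hCfin.1).trans ?_
    simp only [Finset.mul_sum, hw, mul_assoc, Sum.elim_inl]
  have hDeq : D = ENNReal.ofReal (∑ a, ∑ u, w a u * g a u) + D₂ := by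
    rw [hD]
    congr 1
    refine (sum_mul_meanCost (fun a => PMF.apply_ne_top _ a) hD₁fin).trans ?_
    congr 1
    rw [Fintype.sum_prod_type]
    refine Finset.sum_congr rfl fun a _ => ?_
    have h1 : ∀ u, w a u * g a u = ∑ y, (P (a, y)).toReal * ((bern (κ a) u : ℝ) * F y u) := by
      intro u
      rw [hw, mul_right_comm, hg, Finset.sum_mul]
      exact Finset.sum_congr rfl fun y _ => by ring
    simp only [h1]
    rw [Finset.sum_comm]
    exact Finset.sum_congr rfl fun y _ => Finset.mul_sum _ _ _
  set G : ℝ := ∑ a, ∑ u, g a u + ∑ a, ∑ u, (bitCost (pe a) u).toReal with hG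
  have hG0 : 0 ≤ G := add_nonneg
    (Finset.sum_nonneg fun a _ => Finset.sum_nonneg fun u _ => hg0 a u)
    (Finset.sum_nonneg fun a _ => Finset.sum_nonneg fun u _ => ENNReal.toReal_nonneg)
  obtain ⟨δ₁, hδ₁, hev₁⟩ := eventually_unique_le hR0 hR1 hU hC hCfin hdec hDfin
  -- A type error `ε₂` changes the costs by at most ε₂ G ≤ δ₁/4. The fluctuation of Y and the slack
  -- of the encoder's cost take another δ₁/4 each, which stays within `δ₁`.
  set ε₂ : ℝ := min (ε / 2) (δ₁ / (4 * (G + 1))) with hε₂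
  have hε₂0 : 0 < ε₂ := lt_min (by linarith) (by positivity)
  have hε₂G : ε₂ * G ≤ δ₁ / 4 := by
    have h1 : ε₂ * (4 * (G + 1)) ≤ δ₁ := (le_div_iff₀ (by positivity)).1 (min_le_right _ _)
    nlinarith
  obtain ⟨δ₂, hδ₂, hev₂⟩ := eventually_type_near hR1 hU hC hCfin hsymm (half_pos hε₂0)
    (by positivity : 0 < η / 6)
  set δc : ℝ := min (δ₁ / 4) δ₂ with hδc
  have hδc0 : 0 < δc := lt_min (by linarith) hδ₂
  obtain ⟨δ₃, hδ₃, hev₃⟩ := eventually_exists_cost_le hR1 hU hC hCfin hsymm hb₁ hδc0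
    (by positivity : 0 < η / 6)
  set δt : ℝ := min (min δ₁ δ₂) (min δ₃ (min (ε₂ / 2) 1)) with hδt
  have hδt0 : 0 < δt := lt_min (lt_min hδ₁ hδ₂) (lt_min hδ₃ (lt_min (half_pos hε₂0) one_pos))
  have hδt1 : δt ≤ δ₁ := (min_le_left _ _).trans (min_le_left _ _)
  have hδt2 : δt ≤ δ₂ := (min_le_left _ _).trans (min_le_right _ _)
  have hδt3 : δt ≤ δ₃ := (min_le_right _ _).trans (min_le_left _ _)
  have hδt4 : δt ≤ ε₂ / 2 := (min_le_right _ _).trans ((min_le_right _ _).trans (min_le_left _ _))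
  have hδt5 : δt ≤ 1 := (min_le_right _ _).trans ((min_le_right _ _).trans (min_le_right _ _))
  filter_upwards [hev₁ (η / 6) (by positivity), hev₂, hev₃,
    eventually_typical P hδt0 (ENNReal.ofReal_pos.2 (by positivity : 0 < η / 6)).ne',
    eventually_typical_length hR1 pS (half_pos hδt0) (by positivity : 0 < η / 6),
    eventually_decoder_dev_le (f := f) (R := R) (pS := pS) (pe := pe) (b := b) F hg
      (by positivity : 0 < δ₁ / 4) (by positivity : 0 < η / 6),
    eventually_typical_sum hR1 (P.map Prod.fst) pS hδt0 hδt5,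
    eventually_typical_sum hR1 (P.map Prod.snd) pS hδt0 hδt5, eventually_ge_atTop 1]
    with n h1 h2 h3 h4 h5 h6 hx hy hn k l hs
  specialize h1 k l hs
  specialize h2 k l hs
  specialize h3 k l hs
  specialize h5 k l hs
  specialize h6 k l hs
  set μ := (jointLaw (PMF.uniformOfFintype (GL (Fin (k + l)) (ZMod 2))) (iid P (k + l))
    (iid pS l)).toOuterMeasure with hμ
  have h4' : μ {ω | ¬ Typical (mass P) δt n ω.2.1} ≤ ENNReal.ofReal (η / 6) := by
    obtain rfl := hs.1
    exact jointLaw_le_second fun _ _ => h4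
  have h5' : μ {ω | ¬ Typical (mass pS) (δt / 2) l ω.2.2} ≤ ENNReal.ofReal (η / 6) :=
    jointLaw_le_third fun _ _ => h5
  have hsum : ENNReal.ofReal η = ENNReal.ofReal (η / 6) + (ENNReal.ofReal (η / 6) +
      (ENNReal.ofReal (η / 6) + (ENNReal.ofReal (η / 6) +
        (ENNReal.ofReal (η / 6) + ENNReal.ofReal (η / 6))))) := by
    simp only [← two_mul, ← add_assoc]
    rw [show η = 6 * (η / 6) by ring, ENNReal.ofReal_mul (by norm_num)]
    norm_num
    ring
  rw [hsum]
  -- Six bad events: a competing vector, a wrong type, no cheap vector, an atypical source, atypical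
  -- parity biases, an atypical decoder cost. Outside them the conclusion is deterministic.
  refine le_trans ?_ (add_le_add h1 (add_le_add h2 (add_le_add h3
    (add_le_add h4' (add_le_add h5' h6)))))
  refine le_trans ?_ (add_le_add le_rfl (add_le_add le_rfl (add_le_add le_rfl
    (add_le_add le_rfl (MeasureTheory.measure_union_le _ _)))))
  refine le_trans ?_ (add_le_add le_rfl (add_le_add le_rfl (add_le_add le_rfl
    (MeasureTheory.measure_union_le _ _))))
  refine le_trans ?_ (add_le_add le_rfl (add_le_add le_rfl (MeasureTheory.measure_union_le _ _)))
  refine le_trans ?_ (add_le_add le_rfl (MeasureTheory.measure_union_le _ _))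
  refine le_trans ?_ (MeasureTheory.measure_union_le _ _)
  refine MeasureTheory.measure_mono fun ω hω => ?_
  by_contra hcon
  simp only [Set.mem_union, not_or] at hcon
  obtain ⟨e1, e2, e3, e4, e5, e6⟩ := hcon
  obtain ⟨H, s, q⟩ := ω
  simp only [Set.mem_ofPred_eq, not_not, not_le] at e1 e2 e3 e4 e5 e6 hω
  have hxt := hx k l hs _ q e4.fst e5
  have hyt := hy k l hs _ q e4.snd e5
  set x : Fin (k + l) → X := fun i => (s i).1 with hxdef
  set y : Fin (k + l) → Y := fun i => (s i).2 with hydef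
  set z := encWord f pe H (fun j => b (q j)) x with hz
  have hnn : (0 : ℝ) < n := by exact_mod_cast hn
  have hcost : seqCost (Sum.elim pe b) (Sum.map x q) (word H z) ≤
      n * (C + ENNReal.ofReal δc) := by
    by_contra hlt
    exact e3 ⟨hxt.mono hδt3, fun z' => (not_le.1 hlt).trans_le (encWord_cost_le hf H x q z')⟩
  have hcfin : seqCost (Sum.elim pe b) (Sum.map x q) (word H z) ≠ ∞ :=
    ne_top_of_le_ne_top (ENNReal.mul_ne_top (ENNReal.natCast_ne_top n)
      (ENNReal.add_ne_top.2 ⟨hCfin, ENNReal.ofReal_ne_top⟩)) hcost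
  have hocc : ∀ a u, |(jointOcc x z a u : ℝ) - n * w a u| ≤ n * ε₂ := by
    intro a u
    have hnear : (P.map Prod.fst a).toReal *
        |(bern (freq (Sum.map x q) (word H z) (Sum.inl a)) u : ℝ) - bern (κ a) u| < ε₂ / 2 := by
      by_contra hge
      refine e2 ⟨hxt.mono hδt2, z, hcost.trans ?_, a, u, not_lt.1 hge⟩
      gcongr
      exact min_le_right _ _
    have hj := jointOcc_eq (Sum.map x q) (word H z) (Sum.inl a) u
    rw [word, jointOcc_sum_inl, occ_map_inl] at hj
    rw [hj, ← word]
    set r : I := bern (freq (Sum.map x q) (word H z) (Sum.inl a)) u with hr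
    set p := (P.map Prod.fst a).toReal with hp
    have hp0 : 0 ≤ p := ENNReal.toReal_nonneg
    have hp1 : p ≤ 1 := by
      rw [hp, ← sum_toReal (P.map Prod.fst)]
      exact Finset.single_le_sum (f := fun a => (P.map Prod.fst a).toReal)
        (fun _ _ => ENNReal.toReal_nonneg) (Finset.mem_univ a)
    obtain ⟨t1, t2⟩ := hxt (Sum.inl a)
    rw [occ_map_inl, sumWeight, Sum.elim_inl, mass_toReal, ← hp] at t1 t2
    have ho : |(occ x a : ℝ) - n * p| ≤ n * (ε₂ / 2) := by
      have h7 : δt * (n * p) ≤ n * (ε₂ / 2) := by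
        have : n * p ≤ n := mul_le_of_le_one_right hnn.le hp1
        calc δt * (n * p) ≤ ε₂ / 2 * n := mul_le_mul hδt4 this (by positivity) (by positivity)
          _ = _ := mul_comm _ _
      rw [abs_le]
      constructor <;> linarith
    calc |(occ x a : ℝ) * r - n * w a u| =
          |((occ x a : ℝ) - n * p) * r + n * (p * ((r : ℝ) - bern (κ a) u))| := by
          congr 1; simp only [hw, ← hp]; ring
      _ ≤ |(occ x a : ℝ) - n * p| * r + n * (p * |(r : ℝ) - bern (κ a) u|) := by
          refine (abs_add_le _ _).trans (le_of_eq ?_)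
          rw [abs_mul, abs_mul, abs_mul, abs_of_nonneg r.2.1, abs_of_nonneg hnn.le,
            abs_of_nonneg hp0]
      _ ≤ n * (ε₂ / 2) * 1 + n * (ε₂ / 2) :=
          add_le_add (mul_le_mul ho r.2.2 r.2.1 (by positivity))
            (mul_le_mul_of_nonneg_left hnear.le hnn.le)
      _ = _ := by ring
  have hne : ∀ i, P (x i, y i) ≠ 0 := fun i h0 => e4.ne_zero i (mass_eq_zero.2 h0)
  have hqne : ∀ j, pS (q j) ≠ 0 := fun j h0 => e5.ne_zero j (mass_eq_zero.2 h0)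
  have hfd : ∀ i, bitCost (pd (y i)) (z i) ≠ ∞ := fun i =>
    bitCost_encWord_ne_top hf hR1 hU (hC ▸ hCfin) hmd hb₂ H x q hqne hcfin i (y i) (hne i)
  have hfe : ∀ i, bitCost (pe (x i)) (z i) ≠ ∞ := by
    have h7 := hcfin
    rw [word, seqCost_sum, ENNReal.add_ne_top, ENNReal.sum_ne_top] at h7
    exact fun i => h7.1 i (Finset.mem_univ i)
  have hdcost : seqCost (Sum.elim pd b) (Sum.map y q) (word H z) ≤
      n * (D + ENNReal.ofReal δ₁) := by
    have h7 := decoder_cost_le (pe := pe) (pd := pd) (b := b) x y q z (parity H z) hw0 hg0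
      hε₂0.le hδc0.le (by positivity : 0 ≤ δ₁ / 4) hD₂fin hocc hfe hfd
      (by rw [← seqCost_sum, ← hCeq]; exact hcost) e6
    refine h7.trans ?_
    rw [← hDeq]
    gcongr
    have : δc ≤ δ₁ / 4 := min_le_left _ _
    linarith
  have hdfin : seqCost (Sum.elim pd b) (Sum.map y q) (word H z) ≠ ∞ :=
    ne_top_of_le_ne_top (ENNReal.mul_ne_top (ENNReal.natCast_ne_top n)
      (ENNReal.add_ne_top.2 ⟨hDfin, ENNReal.ofReal_ne_top⟩)) hdcost
  obtain ⟨d1, d2⟩ := decWord_cost_le hf H y q z hdfin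
  -- Otherwise the decoder's output and z would be distinct, would share the message, and would be
  -- cheap for the decoder and the encoder respectively.
  have hrec : decWord f pd H (fun j => b (q j)) (messageBits H z) y = z := by
    by_contra hcon
    refine e1 ⟨hxt.mono hδt1, hyt.mono hδt1, z, _, Ne.symm hcon, hcost.trans ?_,
      d2.trans hdcost, d1.symm⟩
    gcongr
    exact (min_le_left _ _).trans (by linarith)
  obtain ⟨a, u, hau⟩ := hω
  rw [message_eq, ← hz, hrec] at hau
  have h8 : empirical x z a u = jointOcc x z a u / n := by
    rw [← hs.1]; rfl
  rw [h8] at hau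
  have h9 : |(jointOcc x z a u : ℝ) / n - w a u| ≤ ε₂ := by
    have : (jointOcc x z a u : ℝ) / n - w a u = (jointOcc x z a u - n * w a u) / n := by
      field_simp
    rw [this, abs_div, abs_of_pos hnn, div_le_iff₀ hnn, mul_comm ε₂]
    exact hocc a u
  have h10 : ε₂ ≤ ε / 2 := min_le_left _ _
  exact absurd (hau.trans h9) (by linarith)

end finite

/-! ### Restriction of the parity bias law to its support -/

theorem crossEntropy_bitVal (u : ZMod 2) (ψ : I) : crossEntropy (bitVal u) ψ = bitCost ψ u := by
  rcases bit_cases u with rfl | rfl <;> simp [crossEntropy, bitVal, bitCost]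

theorem expCross_eq {A : Type*} (p : PMF A) (κ g : A → I) :
    expCross p κ g = expect p fun a => meanCost (g a) (κ a) := by
  simp only [expCross, meanCost, crossEntropy_bitVal]

theorem expect_fintype {A : Type*} [Fintype A] (p : PMF A) (φ : A → ℝ≥0∞) :
    expect p φ = ∑ a, p a * φ a := tsum_fintype _

theorem sum_mul_ofReal {A : Type*} [Fintype A] (p : PMF A) {φ : A → ℝ} (hφ : ∀ a, 0 ≤ φ a) :
    ∑ a, p a * ENNReal.ofReal (φ a) = ENNReal.ofReal (∑ a, (p a).toReal * φ a) := by
  rw [ENNReal.ofReal_sum_of_nonneg fun a _ => mul_nonneg ENNReal.toReal_nonneg (hφ a)]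
  refine Finset.sum_congr rfl fun a _ => ?_
  rw [ENNReal.ofReal_mul ENNReal.toReal_nonneg, ENNReal.ofReal_toReal (p.apply_ne_top a)]

open Classical in
theorem sum_ite_nonneg {A : Type*} [Fintype A] (p : PMF A) (B : A → Prop) :
    0 ≤ ∑ a, if B a then (p a).toReal else 0 :=
  Finset.sum_nonneg fun a _ => by split_ifs; exacts [ENNReal.toReal_nonneg, le_rfl]

open Classical in
theorem toOuterMeasure_setOf {A : Type*} [Fintype A] (p : PMF A) (B : A → Prop) :
    p.toOuterMeasure {a | B a} = ENNReal.ofReal (∑ a, if B a then (p a).toReal else 0) := by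
  rw [PMF.toOuterMeasure_apply_fintype, ENNReal.ofReal_sum_of_nonneg fun a _ => by
    split_ifs; exacts [ENNReal.toReal_nonneg, le_rfl]]
  refine Finset.sum_congr rfl fun a _ => ?_
  by_cases h : B a <;> simp [h, p.apply_ne_top a]

theorem map_symm_apply (PQ : PMF I) (q : I) : PQ.map σ q = PQ (σ q) := by
  classical
  rw [PMF.map_apply, tsum_eq_single (σ q)]
  · simp
  · intro q' hq'
    rw [if_neg]
    rintro rfl
    simp at hq'

theorem expect_symm {PQ : PMF I} (h : PQ.map σ = PQ) (φ : I → ℝ≥0∞) :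
    expect PQ (fun q => φ (σ q)) = expect PQ φ := by
  have h1 : ∀ q, PQ (σ q) = PQ q := fun q => by rw [← map_symm_apply, h]
  unfold expect
  rw [← (Function.Involutive.toPerm σ unitInterval.symm_involutive).tsum_eq]
  refine tsum_congr fun q => ?_
  simp only [Function.Involutive.coe_toPerm, h1, unitInterval.symm_symm]

section support

variable (PQ : PMF I) [Fintype PQ.support]

/-- The parity bias law, as a law on its support. -/
def onSupport : PMF PQ.support :=
  PMF.ofFintype (fun c => PQ c) (by
    rw [← tsum_fintype (L := .unconditional _)]
    exact (tsum_subtype_support (f := PQ)).trans PQ.tsum_coe)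

theorem onSupport_apply (c : PQ.support) : onSupport PQ c = PQ c := rfl

theorem expect_eq_onSupport (φ : I → ℝ≥0∞) :
    expect PQ φ = ∑ c, onSupport PQ c * φ c := by
  rw [← tsum_fintype (L := .unconditional _)]
  refine (tsum_subtype_eq_of_support_subset (f := fun q => PQ q * φ q) ?_).symm
  intro q hq
  exact left_ne_zero_of_mul hq

theorem onSupport_map : (onSupport PQ).map Subtype.val = PQ := by
  classical
  ext q
  rw [PMF.map_apply]
  by_cases hq : q ∈ PQ.support
  · rw [tsum_eq_single ⟨q, hq⟩]
    · simp [onSupport_apply]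
    · rintro ⟨q', hq'⟩ hne
      rw [if_neg]
      rintro rfl
      exact hne rfl
  · rw [ENNReal.tsum_eq_zero.2, (PMF.apply_eq_zero_iff _ _).2 hq]
    rintro ⟨q', hq'⟩
    rw [if_neg]
    rintro rfl
    exact hq hq'

variable {A : Type*} [Fintype A] (p : PMF A) {R : ℝ} (hR1 : R < 1)

include hR1 in
theorem condEntropy_add (κ : A → I) (ν : I → I) :
    condEntropy p κ + ENNReal.ofReal (1 - R) * condEntropy PQ ν =
      ENNReal.ofReal (ent (sumWeight p (1 - R).toNNReal (onSupport PQ))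
        (Sum.elim κ fun c => ν c)) := by
  have h1 : 0 ≤ ∑ a, (p a).toReal * bitEnt (κ a) :=
    Finset.sum_nonneg fun a _ => mul_nonneg ENNReal.toReal_nonneg (bitEnt_nonneg _)
  have h2 : 0 ≤ ∑ c, (onSupport PQ c).toReal * bitEnt (ν c) :=
    Finset.sum_nonneg fun a _ => mul_nonneg ENNReal.toReal_nonneg (bitEnt_nonneg _)
  have hR : 0 ≤ 1 - R := by linarith
  simp only [ent_sumWeight _ hR1, Sum.elim_inl, Sum.elim_inr]
  rw [ENNReal.ofReal_add h1 (mul_nonneg hR h2), ENNReal.ofReal_mul hR,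
    ← sum_mul_ofReal _ fun a => bitEnt_nonneg _, ← sum_mul_ofReal _ fun a => bitEnt_nonneg _,
    condEntropy, condEntropy, expect_fintype, expect_eq_onSupport]
  rfl

theorem expCross_add (κ g : A → I) (ν : I → I) :
    expCross p κ g + ENNReal.ofReal (1 - R) * expCross PQ ν id =
      avgCost (sumWeight p (1 - R).toNNReal (onSupport PQ)) (Sum.elim g Subtype.val)
        (Sum.elim κ fun c => ν c) := by
  rw [avgCost_sumWeight, expCross_eq, expCross_eq, expect_fintype, expect_eq_onSupport]
  rfl

open Classical in
include hR1 in
theorem toOuterMeasure_add (B : I → Prop) (g : A → I) :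
    p.toOuterMeasure {a | B (g a)} + ENNReal.ofReal (1 - R) * PQ.toOuterMeasure {q | B q} =
      ENNReal.ofReal (∑ a, if B (Sum.elim g Subtype.val a) then
        (sumWeight p (1 - R).toNNReal (onSupport PQ) a : ℝ) else 0) := by
  have hR : 0 ≤ 1 - R := by linarith
  have h1 : PQ.toOuterMeasure {q | B q} =
      (onSupport PQ).toOuterMeasure {c | B (Subtype.val c)} := by
    conv_lhs => rw [← onSupport_map PQ, PMF.toOuterMeasure_map_apply]
    rfl
  rw [sum_sumWeight_ite _ hR1]
  change _ = ENNReal.ofReal ((∑ a, if B (g a) then (p a).toReal else 0) +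
    (1 - R) * ∑ c : PQ.support, if B c then (onSupport PQ c).toReal else 0)
  rw [ENNReal.ofReal_add (sum_ite_nonneg p _) (mul_nonneg hR (sum_ite_nonneg _ _)),
    ENNReal.ofReal_mul hR, h1, toOuterMeasure_setOf, toOuterMeasure_setOf]

omit [Fintype PQ.support] in
theorem elim_extend {B : Type*} (κ : B ⊕ PQ.support → I) :
    ∃ ν : I → I, Sum.elim (fun a => κ (Sum.inl a)) (fun c : PQ.support => ν c) = κ := by
  classical
  refine ⟨fun q => if h : q ∈ PQ.support then κ (Sum.inr ⟨q, h⟩) else 0, ?_⟩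
  funext a
  rcases a with a | ⟨q, hq⟩
  · rfl
  · exact dif_pos hq

include hR1 in
-- A feasible point whose cost is at most that of a minimizer is itself a minimizer, so uniqueness
-- applies to it. Values of ν outside the support play no role.
theorem IsUniqueEncMin.isUMin {pe κ : A → I} {ν : I → I} (h : IsUniqueEncMin p PQ pe R κ ν) :
    IsUMin (sumWeight p (1 - R).toNNReal (onSupport PQ)) (Sum.elim pe Subtype.val) (1 - R)
      (Sum.elim κ fun c => ν c) := by
  have hfeas : ∀ κ' ν', EncFeasible p PQ R κ' ν' ↔
      1 - R ≤ ent (sumWeight p (1 - R).toNNReal (onSupport PQ)) (Sum.elim κ' fun c => ν' c) := by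
    intro κ' ν'
    rw [EncFeasible, condEntropy_add PQ p hR1, ENNReal.ofReal_le_ofReal_iff (ent_nonneg _)]
  refine ⟨(hfeas _ _).1 h.1.1, fun κ' hκ' hle => ?_⟩
  obtain ⟨ν', hν'⟩ := elim_extend PQ κ'
  rw [← hν'] at hκ' hle
  rw [← expCross_add, ← expCross_add] at hle
  have hmin : IsEncMin p PQ pe R (fun a => κ' (Sum.inl a)) ν' :=
    ⟨(hfeas _ _).2 hκ', fun κ'' ν'' h'' => hle.trans (h.1.2 κ'' ν'' h'')⟩
  obtain ⟨h1, h2⟩ := h.2 _ _ hmin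
  rintro (a | c) ha
  · refine h1 a fun h0 => ha ?_
    rwa [sumWeight, Sum.elim_inl, mass_eq_zero]
  · rw [← hν']
    exact h2 c c.2

end support

theorem scale_floor {R : ℝ} (hR0 : 0 < R) (hR1 : R < 1) (n : ℕ) :
    Scale R n ⌊(n : ℝ) * R⌋₊ (n - ⌊(n : ℝ) * R⌋₊) := by
  have h0 : 0 ≤ (n : ℝ) * R := by positivity
  refine ⟨Nat.add_sub_cancel' ?_, Nat.floor_le h0, (Nat.lt_floor_add_one _).le⟩
  refine Nat.floor_le_of_le ?_
  exact mul_le_of_le_one_right (Nat.cast_nonneg n) hR1.le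

end WPC

end

theorem mainTheorem3 {X Y : Type*} [Fintype X] [Fintype Y]
    -- the source, the bias functions, the parity bias distribution and the rate
    (P : PMF (X × Y)) (pe : X → I) (pd : Y → I)
    (PQ : PMF I) (hPQ_fin : PQ.support.Finite) (hPQ_symm : PQ.map σ = PQ)
    (R : ℝ) (hR0 : 0 < R) (hR1 : R < 1)
    -- the query function, with an arbitrary tie-breaking rule
    (f : (n : ℕ) → GL (Fin n) (ZMod 2) → (Fin n → I) → (Fin n → I) → Fin n → ZMod 2)
    (hf : WPC.IsQuery f)
    -- `κ x = P_{Z|X}(1|x)` and `ν q = P_{V|Q}(1|q)` are the unique minimizer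
    (κ : X → I) (ν : I → I)
    (hmin : WPC.IsUniqueEncMin (P.map Prod.fst) PQ pe R κ ν)
    -- the strict inequality for the decoder
    (hdec : ∀ (κ' : Y → I) (ν' : I → I),
      1 ≤ WPC.condEntropy (P.map Prod.snd) κ' +
          ENNReal.ofReal (1 - R) * WPC.condEntropy PQ ν' →
      WPC.expCross P (fun s => κ s.1) (fun s => pd s.2) +
          ENNReal.ofReal (1 - R) * WPC.expCross PQ ν id <
        WPC.expCross (P.map Prod.snd) κ' pd +
          ENNReal.ofReal (1 - R) * WPC.expCross PQ ν' id)
    -- two boundary cases: biases equal to `0` or `1` that balance exactly against the rate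
    (hbdry₁ : (P.map Prod.fst).toOuterMeasure {x | 0 < pe x ∧ pe x < 1} +
        ENNReal.ofReal (1 - R) * PQ.toOuterMeasure {q | 0 < q ∧ q < 1} =
          ENNReal.ofReal (1 - R) →
      PQ.toOuterMeasure {q | 0 < q ∧ q < 1} = 1)
    (hbdry₂ : (P.map Prod.fst).toOuterMeasure {x | pe x = WPC.half} +
        ENNReal.ofReal (1 - R) * PQ.toOuterMeasure {q | q = WPC.half} =
          ENNReal.ofReal (1 - R) →
      PQ.toOuterMeasure {q | q = WPC.half} = 1 ∨
        ∀ x y, P (x, y) ≠ 0 → (pd y = 0 ∨ pd y = 1) → pe x = pd y) :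
    ∀ ε : ℝ, 0 < ε →
      Tendsto
        (fun n : ℕ =>
          (WPC.sampleLaw P PQ ⌊(n : ℝ) * R⌋₊ (n - ⌊(n : ℝ) * R⌋₊)).toOuterMeasure
            (WPC.deviation f pe pd (P.map Prod.fst) κ ε))
        atTop (𝓝 0) := by
  classical
  intro ε hε
  have := hPQ_fin.fintype
  have hk := WPC.scale_floor hR0 hR1
  -- Reflecting the bias at 1/2 exchanges the costs of the two bit values.
  have hsymm : ∑ c, WPC.onSupport PQ c * WPC.bitCost c 0 =
      ∑ c, WPC.onSupport PQ c * WPC.bitCost c 1 := by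
    rw [← WPC.expect_eq_onSupport PQ fun q => WPC.bitCost q 0,
      ← WPC.expect_eq_onSupport PQ fun q => WPC.bitCost q 1, ← WPC.expect_symm hPQ_symm]
    simp [WPC.bitCost]
  have hmem : ∀ {B : I → Prop}, PQ.toOuterMeasure {q | B q} = 1 →
      ∀ c : PQ.support, B c := fun h c =>
    (PMF.toOuterMeasure_apply_eq_one_iff _ _).1 h c.2
  rw [ENNReal.tendsto_nhds_zero]
  intro η hη
  obtain ⟨η', hη', hle⟩ : ∃ η' : ℝ, 0 < η' ∧ ENNReal.ofReal η' ≤ η := by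
    obtain ⟨r, hr, hrη⟩ := ENNReal.lt_iff_exists_nnreal_btwn.1 hη
    exact ⟨r, by exact_mod_cast hr, by simpa using hrη.le⟩
  refine (WPC.eventually_deviation_le (b := Subtype.val) hf hR0 hR1
    (WPC.IsUniqueEncMin.isUMin PQ _ hR1 hmin) hsymm (P := P) (pd := pd) (fun κ' hκ' => ?_)
    (fun h c _ => ?_) (fun h => ?_) hε hη').mono fun n hn => ?_
  · obtain ⟨ν', hν'⟩ := WPC.elim_extend PQ κ'
    rw [← hν'] at hκ' ⊢
    have h1 := hdec (fun a => κ' (Sum.inl a)) ν' (by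
      rw [WPC.condEntropy_add PQ _ hR1, ← ENNReal.ofReal_one]
      exact ENNReal.ofReal_le_ofReal hκ')
    rw [WPC.expCross_add PQ (P.map Prod.snd), WPC.expCross_eq, WPC.expCross_eq, WPC.expect_fintype,
      WPC.expect_eq_onSupport] at h1
    exact h1
  · refine hmem (hbdry₁ ?_) c
    rw [WPC.toOuterMeasure_add PQ _ hR1 (fun q => 0 < q ∧ q < 1) pe]
    refine Eq.trans ?_ (congrArg ENNReal.ofReal h)
    congr!
  · refine (hbdry₂ ?_).imp (fun h c _ => hmem h c) id
    rw [WPC.toOuterMeasure_add PQ _ hR1 (fun q => q = WPC.half) pe]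
    refine Eq.trans (congrArg ENNReal.ofReal (Finset.sum_congr rfl fun a _ => ?_))
      (congrArg ENNReal.ofReal h)
    change _ = _ * WPC.bitEnt (if Sum.elim pe Subtype.val a = WPC.half then WPC.half else 0)
    split_ifs
    · rw [WPC.bitEnt_eq_one.2 rfl, mul_one]
    · rw [WPC.bitEnt_eq_zero.2 (Or.inl rfl), mul_zero]
  · refine le_trans (le_of_eq ?_) ((hn _ _ (hk n)).trans hle)
    -- The parity biases are sampled on the finite support and then included in [0,1]; the law of
    -- the whole sample is unchanged.
    have h1 : WPC.sampleLaw P PQ ⌊(n : ℝ) * R⌋₊ (n - ⌊(n : ℝ) * R⌋₊) = _ :=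
      congrArg (WPC.jointLaw _ _) ((congrArg (fun p => WPC.iid p _)
        (WPC.onSupport_map PQ).symm).trans (WPC.iid_map _ _ _).symm)
    rw [h1, WPC.jointLaw_map_third, PMF.toOuterMeasure_map_apply]
    rfl
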